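/- Let $D=\mathbb R$ or $D=(0,\infty)$. Consider the class of equations $$v_t=v_{xx}+H(x)v^m+F(x)v,$$ each taken on a nonempty connected open domain $U$ of the space of $(t,x,v)$ with values $v\in D$, where $F,H$ are smooth real functions on the $x$-projection of $U$, $H$ has no zeros there, and $m\ne0,1$ is a real constant. The arbitrary elements of an equation are $F,H,m$ (together with $U$). If $D=\mathbb R$, the base of powers is taken in modulus, i.e. $v^m$ means $|v|^m$ and $\delta^{m-1}$ means $|\delta|^m/\delta$, and points with $v=0$ are left out when an equation is considered as a submanifold of the jet space. A point transformation maps an equation to another if its second prolongation maps the submanifold of the second-order jet space given by the first equation onto that given by the second one. An equivalence transformation is a bijection $(\theta,p)\mapsto(\tilde\theta,\varphi_\theta(p))$ of the set of pairs (equation $\theta$ of the class, point $p=(t,x,v)$ of its domain) such that, for each $\theta$, $\varphi_\theta$ is a point transformation (smooth, with a smooth inverse) of the domain of $\theta$ onto that of $\tilde\theta$ which maps the equation $\theta$ to the equation $\tilde\theta$. * The generalized extended equivalence group $\hat G^\sim_{FH}$ consists of the equivalence transformations that, together with their inverses, depend smoothly, but possibly nonlocally, on the arbitrary elements: along each smooth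 one-parameter family $\theta_s$ of equations of the class, the equations $\tilde\theta_s$ form a smooth family and $\varphi_{\theta_s}(p)$ is smooth in $(s,p)$. * The usual equivalence group $G^\sim_{FH}$ consists of the equivalence transformations induced by point transformations of the space of $(t,x,v,F,H,m)$ that are projectible on the space of $(t,x,v)$. **Theorem.** Both sets are groups. The usual equivalence group $G^\sim_{FH}$ consists exactly of the transformations $$\tilde t=\delta_1^2t+\delta_2,\quad \tilde x=\delta_1x+\delta_3,\quad \tilde v=\delta_4v,\quad \tilde F=\frac{F}{\delta_1^2},\quad \tilde H=\frac{H}{\delta_1^2\delta_4^{m-1}},\quad \tilde m=m,$$ where $\delta_1,\dots,\delta_4$ are arbitrary real constants with $\delta_1\delta_4\ne0$ (and $\delta_4>0$ if $D=(0,\infty)$); each choice of the constants gives exactly one transformation. The generalized extended equivalence group $\hat G^\sim_{FH}$ coincides with $G^\sim_{FH}$ up to the dependence of the group parameters on the arbitrary elements: $G^\sim_{FH}\subseteq\hat G^\sim_{FH}$, and on each single equation of the class every element of $\hat G^\sim_{FH}$ acts as some element of $G^\sim_{FH}$. More precisely, $\hat G^\sim_{FH}$ consists exactly of the bijections $\Phi$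 of the above set of pairs such that both $\Phi$ and $\Phi^{-1}$ are given by the above formulas with parameters $\delta_1,\dots,\delta_4$ that do not depend on $(t,x,v)$ and are smooth functionals of the arbitrary elements (smooth along every smooth one-parameter family of equations). -/

import Mathlib

open scoped ContDiff

noncomputable section

namespace ImagedClass

/-! ### The class of equations `v_t = v_xx + H(x) v^m + F(x) v` -/

/-- The space with coordinates `(t, x, v)`. -/
abbrev Pt : Type := ℝ × ℝ × ℝ

/-- The interval over which the `x`-coordinate ranges on a domain of the `(t, x, v)`-space. -/
def xProj (U : Set Pt) : Set ℝ := (fun p : Pt => p.2.1) '' U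

/-- An equation `v_t = v_xx + H(x) |v|^m + F(x) v`, considered on a domain `dom` of the space of
`(t, x, v)` on which `v` takes values in `D`. The arbitrary elements `F`, `H` are smooth functions
on the `x`-projection of the domain, `H` has no zeros there, and the constant `m` is different
from `0` and `1`.

`D` is either the half-line of positive numbers, where `|v|^m` is `v^m`, or the whole line, where
the modulus is the base of the power.

(`F` and `H` are extended by zero, so that two elements of this type are equal iff they have the
same domain, the same exponent and the same `F`, `H` on the domain.) -/
structure Eqn (D : Set ℝ) where
  dom : Set Pt
  isOpen_dom : IsOpen dom
  isConnected_dom : IsConnected dom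
  dom_values : ∀ p ∈ dom, p.2.2 ∈ D
  F : ℝ → ℝ
  H : ℝ → ℝ
  m : ℝ
  smooth_F : ContDiffOn ℝ ∞ F (xProj dom)
  smooth_H : ContDiffOn ℝ ∞ H (xProj dom)
  H_ne_zero : ∀ x ∈ xProj dom, H x ≠ 0
  m_ne_zero : m ≠ 0
  m_ne_one : m ≠ 1
  F_off : ∀ x, x ∉ xProj dom → F x = 0
  H_off : ∀ x, x ∉ xProj dom → H x = 0

variable {D : Set ℝ}

/-- The algebraic relation on jets given by the equation: `vt`, `vxx` are the values of the
derivatives `v_t`, `v_xx`. -/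
def Eqn.Holds (θ : Eqn D) (x v vt vxx : ℝ) : Prop :=
  vt = vxx + θ.H x * |v| ^ θ.m + θ.F x * v

/-! ### Point transformations and their prolongation to second-order jets -/

/-- `f` is a nondegenerate point transformation of `A` onto `B`: a smooth bijection with a smooth
inverse (used for open `A`, `B`). -/
def IsPointTransformation {E : Type*} [NormedAddCommGroup E] [NormedSpace ℝ E]
    (f : E → E) (A B : Set E) : Prop :=
  Set.BijOn f A B ∧ ContDiffOn ℝ ∞ f A ∧ ∃ g : E → E, ContDiffOn ℝ ∞ g B ∧ ∀ a ∈ A, g (f a) = a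

/-- Partial derivative in the first variable `t`. -/
def dt (g : ℝ × ℝ → ℝ) (z : ℝ × ℝ) : ℝ := deriv (fun s => g (s, z.2)) z.1

/-- Partial derivative in the second variable `x`. -/
def dx (g : ℝ × ℝ → ℝ) (z : ℝ × ℝ) : ℝ := deriv (fun y => g (z.1, y)) z.2

/-- The point over `z = (t, x)` of the graph `v = u(t, x)`. -/
def graphPt (u : ℝ × ℝ → ℝ) (z : ℝ × ℝ) : Pt := (z.1, z.2, u z)

section Prolongation

variable (f : Pt → Pt) (u : ℝ × ℝ → ℝ)

/-- `T(t, x, u(t, x))`, where `f = (T, X, V)`. -/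
def tNew (z : ℝ × ℝ) : ℝ := (f (graphPt u z)).1

/-- `X(t, x, u(t, x))`, where `f = (T, X, V)`. -/
def xNew (z : ℝ × ℝ) : ℝ := (f (graphPt u z)).2.1

/-- `V(t, x, u(t, x))`, where `f = (T, X, V)`. -/
def vNew (z : ℝ × ℝ) : ℝ := (f (graphPt u z)).2.2

/-- The Jacobian `D_t T · D_x X - D_x T · D_t X` of the change of independent variables along the
graph of `u`. The prolongation of `f` is defined on the jets of `u` where it does not vanish. -/
def jac (z : ℝ × ℝ) : ℝ :=
  dt (tNew f u) z * dx (xNew f u) z - dx (tNew f u) z * dt (xNew f u) z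

/-- Differentiation with respect to the new variable `t̃`, expressed through `(t, x)`. -/
def dtNew (g : ℝ × ℝ → ℝ) (z : ℝ × ℝ) : ℝ :=
  (dt g z * dx (xNew f u) z - dx g z * dt (xNew f u) z) / jac f u z

/-- Differentiation with respect to the new variable `x̃`, expressed through `(t, x)`. -/
def dxNew (g : ℝ × ℝ → ℝ) (z : ℝ × ℝ) : ℝ :=
  (dx g z * dt (tNew f u) z - dt g z * dx (tNew f u) z) / jac f u z

end Prolongation

/-- The second prolongation of `f` maps the manifold of the equation `θ` in the second-order jet
space onto that of `θ'`: a second-order jet (of a function `u` at `z = (t, x)`) satisfies `θ` if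
and only if its image, which has `v_t`-coordinate `dtNew f u (vNew f u) z` and `v_xx`-coordinate
`dxNew f u (dxNew f u (vNew f u)) z`, satisfies `θ'`. The jets with `v = 0` or with image having
`ṽ = 0`, where the power need be neither smooth nor defined, are left out. -/
def MapsEquation (f : Pt → Pt) (θ θ' : Eqn D) : Prop :=
  ∀ u : ℝ × ℝ → ℝ, ContDiff ℝ ∞ u → ∀ z : ℝ × ℝ, graphPt u z ∈ θ.dom →
    u z ≠ 0 → vNew f u z ≠ 0 → jac f u z ≠ 0 →
    (θ.Holds z.2 (u z) (dt u z) (dx (dx u) z) ↔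
      θ'.Holds (xNew f u z) (vNew f u z)
        (dtNew f u (vNew f u) z) (dxNew f u (dxNew f u (vNew f u)) z))

/-! ### Equivalence transformations -/

/-- Pairs of an equation of the class and a point of its domain. A family `(θ̃, φ_θ)` consisting of
a transformation `θ ↦ θ̃` of equations and of transformations `φ_θ` from the domain of `θ` to
the domain of `θ̃` is the same thing as a transformation `(θ, p) ↦ (θ̃, φ_θ p)` of such pairs. -/
abbrev Total (D : Set ℝ) : Type := Σ θ : Eqn D, θ.dom

/-- `Φ` transforms every equation `θ` of the class to an equation of the class by means of a
point transformation of `(t, x, v)`, which may depend on `θ` in any way. -/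
def IsEquivalenceTransformation (Φ : Equiv.Perm (Total D)) : Prop :=
  ∀ θ : Eqn D, ∃ (θ' : Eqn D) (f : Pt → Pt),
    (∀ p : θ.dom, (Φ ⟨θ, p⟩).1 = θ' ∧ ((Φ ⟨θ, p⟩).2 : Pt) = f p) ∧
    IsPointTransformation f θ.dom θ'.dom ∧ MapsEquation f θ θ'

/-- A one-parameter family of equations depending smoothly on the parameter. -/
def SmoothFamily (θ : ℝ → Eqn D) : Prop :=
  IsOpen {q : ℝ × Pt | q.2 ∈ (θ q.1).dom} ∧
  ContDiff ℝ ∞ (fun s => (θ s).m) ∧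
  ContDiffOn ℝ ∞ (fun q : ℝ × ℝ => (θ q.1).F q.2) {q : ℝ × ℝ | q.2 ∈ xProj (θ q.1).dom} ∧
  ContDiffOn ℝ ∞ (fun q : ℝ × ℝ => (θ q.1).H q.2) {q : ℝ × ℝ | q.2 ∈ xProj (θ q.1).dom}

/-- `Φ` depends smoothly on the arbitrary elements (possibly in a nonlocal way): along every smooth
family of equations, the new equations form a smooth family and the transformations of `(t, x, v)`
depend smoothly on the parameter. -/
def DependsSmoothly (Φ : Equiv.Perm (Total D)) : Prop :=
  ∀ θ : ℝ → Eqn D, SmoothFamily θ →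
    ∃ (θ' : ℝ → Eqn D) (f : ℝ × Pt → Pt),
      SmoothFamily θ' ∧ ContDiffOn ℝ ∞ f {q : ℝ × Pt | q.2 ∈ (θ q.1).dom} ∧
      ∀ (s : ℝ) (p : (θ s).dom), (Φ ⟨θ s, p⟩).1 = θ' s ∧ ((Φ ⟨θ s, p⟩).2 : Pt) = f (s, p)

/-- The generalized extended equivalence group of the class: the transformations of `(t, x, v)` may
depend on the arbitrary elements, in a smooth and not necessarily local way, and become point
transformations when the arbitrary elements are fixed; the new arbitrary elements are determined
by the old ones in a smooth and not necessarily local way. -/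
def genExtEquivGroup (D : Set ℝ) : Set (Equiv.Perm (Total D)) :=
  {Φ | IsEquivalenceTransformation Φ ∧ DependsSmoothly Φ ∧ DependsSmoothly Φ⁻¹}

/-- The space with coordinates `((t, x, v), (F, H, m))`. -/
def extSpace (D : Set ℝ) : Set (Pt × ℝ × ℝ × ℝ) :=
  {w | w.1.2.2 ∈ D ∧ w.2.2.1 ≠ 0 ∧ w.2.2.2 ≠ 0 ∧ w.2.2.2 ≠ 1}

/-- The usual equivalence group of the class: the equivalence transformations given by
nondegenerate point transformations `Θ` of the space of `(t, x, v, F, H, m)` which are projectible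
on the space of `(t, x, v)`. -/
def usualEquivGroup (D : Set ℝ) : Set (Equiv.Perm (Total D)) :=
  {Ψ | IsEquivalenceTransformation Ψ ∧
    ∃ (Θ : Pt × ℝ × ℝ × ℝ → Pt × ℝ × ℝ × ℝ) (φ : Pt → Pt),
      IsPointTransformation Θ (extSpace D) (extSpace D) ∧
      (∀ w ∈ extSpace D, (Θ w).1 = φ w.1) ∧
      ∀ (θ : Eqn D) (p : θ.dom) (θ' : Eqn D) (p' : θ'.dom), Ψ ⟨θ, p⟩ = ⟨θ', p'⟩ →
        Θ ((p : Pt), θ.F (p : Pt).2.1, θ.H (p : Pt).2.1, θ.m) =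
          ((p' : Pt), θ'.F (p' : Pt).2.1, θ'.H (p' : Pt).2.1, θ'.m)}

/-! ### The explicit transformations -/

/-- Values of the group parameters. -/
structure Params where
  δ₁ : ℝ
  δ₂ : ℝ
  δ₃ : ℝ
  δ₄ : ℝ

/-- `δ₁ δ₄ ≠ 0`, and multiplication by `δ₄` preserves the set `D` of admitted values of `v`
(no condition for the whole line, positivity of `δ₄` for the half-line). -/
def Params.Admissible (D : Set ℝ) (δ : Params) : Prop :=
  δ.δ₁ * δ.δ₄ ≠ 0 ∧ ∀ v ∈ D, δ.δ₄ * v ∈ D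

/-- `(t, x, v) ↦ (δ₁² t + δ₂, δ₁ x + δ₃, δ₄ v)`. -/
def Params.map (δ : Params) (p : Pt) : Pt :=
  (δ.δ₁ ^ 2 * p.1 + δ.δ₂, δ.δ₁ * p.2.1 + δ.δ₃, δ.δ₄ * p.2.2)

/-- The power `δ₄^(m-1)`, i.e. `δ₄^m / δ₄`, with the modulus as the base of the power `m`. -/
def Params.power (δ : Params) (m : ℝ) : ℝ := |δ.δ₄| ^ m / δ.δ₄

/-- On the equation `θ`, the transformation `Φ` acts by
`t̃ = δ₁² t + δ₂`, `x̃ = δ₁ x + δ₃`, `ṽ = δ₄ v`, `F̃ = F / δ₁²`, `H̃ = H / (δ₁² δ₄^(m-1))`,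
`m̃ = m`. -/
def ActsBy (δ : Params) (Φ : Equiv.Perm (Total D)) (θ : Eqn D) : Prop :=
  ∃ θ' : Eqn D,
    (∀ p : θ.dom, (Φ ⟨θ, p⟩).1 = θ' ∧ ((Φ ⟨θ, p⟩).2 : Pt) = δ.map p) ∧
    θ'.dom = δ.map '' θ.dom ∧
    (∀ x ∈ xProj θ.dom, θ'.F (δ.δ₁ * x + δ.δ₃) = θ.F x / δ.δ₁ ^ 2) ∧
    (∀ x ∈ xProj θ.dom, θ'.H (δ.δ₁ * x + δ.δ₃) = θ.H x / (δ.δ₁ ^ 2 * δ.power θ.m)) ∧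
    θ'.m = θ.m

/-- `Φ` is given by the above formulas, with parameters `δ₁, …, δ₄` that do not depend on
`(t, x, v)` and that are smooth functionals of the arbitrary elements. -/
def IsGivenByFormulas (Φ : Equiv.Perm (Total D)) : Prop :=
  ∃ δ : Eqn D → Params,
    (∀ θ, (δ θ).Admissible D ∧ ActsBy (δ θ) Φ θ) ∧
    ∀ θ : ℝ → Eqn D, SmoothFamily θ →
      ContDiff ℝ ∞ (fun s => (δ (θ s)).δ₁) ∧ ContDiff ℝ ∞ (fun s => (δ (θ s)).δ₂) ∧
      ContDiff ℝ ∞ (fun s => (δ (θ s)).δ₃) ∧ ContDiff ℝ ∞ (fun s => (δ (θ s)).δ₄)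

end ImagedClass

end

noncomputable section

namespace ImagedClass

open Filter Topology

variable {D : Set ℝ}

/-! ### Partial derivatives on the space of `(t, x, v)` -/

/-! The content of the theorem is a bound on the point transformations `(T, X, V)` from one equation
of the class to another; that the explicit transformations belong to the groups is direct
computation. On a jet satisfying the first equation, `u_t` is expressed through `u_xx`, while `u_x`,
`u_xx` and `u_tt` remain free, so the image equation can be split with respect to them. The
coefficient of `u_tt` gives `D_x T = 0`, hence `T = T(t)`; that of `u_xx` gives `X_v = 0` and `X_x²
= T_t`; the powers of `u_x` give the system `LocalMap.determining`, in particular `V_vv = 0`.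

On a line in the direction of `v` the last determining equation equates a combination of `|v|^m` and
`|αv + β|^m'` with an affine function of `v`. By `power_rigidity`, `m' = m` and, if `m ≠ 2`, `β =
0`. Taking logarithms of the resulting relation between the two functions `H` and eliminating the
new one yields `LocalMap.classifying`: with `Y = X_t / X_x`, affine in `x`, the product `Y · (log
|H|)'` is a quadratic polynomial in `x`. If the derivatives of `log |H|` are generic, this forces `Y
= 0` (`affine_mul_rigidity`). Then `X_t = V_t = V_x = 0`, and on a connected domain the
transformation has the explicit form (`exists_params_of_firstOrder`). The transformed `F`, `H`, `m`
are then determined as well (`formulas_of_map`).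

Equations with `m = 2` or nongeneric `H` are reached differently for the two groups. A usual
equivalence transformation has one point transformation for all equations, so a single generic
equation on the largest domain suffices. For the generalized extended group, any equation is the
value at `s = 0` of a smooth family that at each given point is generic with `m ≠ 2` for small `s ≠
0`; the conditions `FirstOrder` on first derivatives are closed and survive the limit `s → 0`.
Smoothness of the parameters follows because they are difference quotients of the transformation. -/

/-- The coordinate directions. -/
def eT : Pt := (1, 0, 0)
def eX : Pt := (0, 1, 0)
def eV : Pt := (0, 0, 1)

/-- The derivative of `g` at `p` in the direction `e`. -/
def pd (e : Pt) (g : Pt → ℝ) (p : Pt) : ℝ := fderiv ℝ g p e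

theorem fderiv_apply_eq (g : Pt → ℝ) (p : Pt) (a b c : ℝ) :
    fderiv ℝ g p (a, b, c) = a * pd eT g p + b * pd eX g p + c * pd eV g p := by
  have h : ((a, b, c) : Pt) = a • eT + b • eX + c • eV := by
    simp [eT, eX, eV]
  rw [h, map_add, map_add, map_smul, map_smul, map_smul]
  rfl

theorem pd_contDiffAt {g : Pt → ℝ} {p : Pt} (e : Pt) (hg : ContDiffAt ℝ ∞ g p) :
    ContDiffAt ℝ ∞ (pd e g) p :=
  (hg.fderiv_right (m := ∞) (by simp)).clm_apply contDiffAt_const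

theorem differentiableAt_of_smooth {E : Type*} [NormedAddCommGroup E] [NormedSpace ℝ E]
    {F : Type*} [NormedAddCommGroup F] [NormedSpace ℝ F] {g : E → F} {p : E}
    (hg : ContDiffAt ℝ ∞ g p) : DifferentiableAt ℝ g p :=
  hg.differentiableAt (by simp)

theorem pd_comm {g : Pt → ℝ} {p : Pt} (e e' : Pt) (hg : ContDiffAt ℝ ∞ g p) :
    pd e (pd e' g) p = pd e' (pd e g) p := by
  have h1 : DifferentiableAt ℝ (fderiv ℝ g) p :=
    differentiableAt_of_smooth (hg.fderiv_right (m := ∞) (by simp))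
  have h2 : ∀ a b : Pt, pd a (pd b g) p = fderiv ℝ (fderiv ℝ g) p a b := by
    intro a b
    have : HasFDerivAt (pd b g) _ p := h1.hasFDerivAt.clm_apply (hasFDerivAt_const b p)
    unfold pd at this ⊢
    rw [this.fderiv]
    simp
  rw [h2, h2]
  refine hg.isSymmSndFDerivAt ?_ e e'
  rw [minSmoothness_of_isRCLikeNormedField]
  exact WithTop.coe_le_coe.mpr (le_top : (2 : ℕ∞) ≤ ⊤)

theorem pd_congr {g g' : Pt → ℝ} {p : Pt} (e : Pt) (h : g =ᶠ[𝓝 p] g') : pd e g p = pd e g' p := by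
  unfold pd
  rw [h.fderiv_eq]

theorem pd_eq_of_eqOn {g g' : Pt → ℝ} {O : Set Pt} (hO : IsOpen O) (h : ∀ p ∈ O, g p = g' p)
    (e : Pt) : ∀ p ∈ O, pd e g p = pd e g' p :=
  fun _ hp => pd_congr e (mem_of_superset (hO.mem_nhds hp) h)

theorem pd_const (e : Pt) (c : ℝ) (p : Pt) : pd e (fun _ => c) p = 0 := by
  simp [pd]

theorem pd_eq_zero_of_eqOn {g : Pt → ℝ} {O : Set Pt} (hO : IsOpen O) (h : ∀ p ∈ O, g p = 0)
    (e : Pt) : ∀ p ∈ O, pd e g p = 0 := fun p hp => by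
  rw [pd_eq_of_eqOn hO (g' := fun _ => 0) h e p hp, pd_const]

theorem pd_mul {g g' : Pt → ℝ} {p : Pt} (e : Pt) (hg : ContDiffAt ℝ ∞ g p)
    (hg' : ContDiffAt ℝ ∞ g' p) :
    pd e (fun p => g p * g' p) p = g p * pd e g' p + g' p * pd e g p := by
  have := (differentiableAt_of_smooth hg).hasFDerivAt.mul
    (differentiableAt_of_smooth hg').hasFDerivAt
  unfold pd
  rw [show (fun p => g p * g' p) = g * g' from rfl, this.fderiv]
  simp

theorem pd_add {g g' : Pt → ℝ} {p : Pt} (e : Pt) (hg : ContDiffAt ℝ ∞ g p)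
    (hg' : ContDiffAt ℝ ∞ g' p) :
    pd e (fun p => g p + g' p) p = pd e g p + pd e g' p := by
  have := (differentiableAt_of_smooth hg).hasFDerivAt.add
    (differentiableAt_of_smooth hg').hasFDerivAt
  unfold pd
  rw [show (fun p => g p + g' p) = g + g' from rfl, this.fderiv]
  simp

theorem pd_comp {φ : ℝ → ℝ} {φ' : ℝ} {g : Pt → ℝ} {p : Pt} (e : Pt)
    (hφ : HasDerivAt φ φ' (g p)) (hg : ContDiffAt ℝ ∞ g p) :
    pd e (fun p => φ (g p)) p = φ' * pd e g p := by
  have := hφ.comp_hasFDerivAt p (differentiableAt_of_smooth hg).hasFDerivAt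
  unfold pd
  rw [show (fun p => φ (g p)) = φ ∘ g from rfl, this.fderiv]
  simp

theorem contDiffAt_coordT (p : Pt) : ContDiffAt ℝ ∞ (fun p : Pt => p.1) p := contDiff_fst.contDiffAt

theorem contDiffAt_coordX (p : Pt) : ContDiffAt ℝ ∞ (fun p : Pt => p.2.1) p :=
  (contDiff_fst.comp contDiff_snd).contDiffAt

theorem contDiffAt_coordV (p : Pt) : ContDiffAt ℝ ∞ (fun p : Pt => p.2.2) p :=
  (contDiff_snd.comp contDiff_snd).contDiffAt

theorem pd_coordX (e p : Pt) : pd e (fun p : Pt => p.2.1) p = e.2.1 := by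
  have h : HasFDerivAt (fun p : Pt => p.2.1)
      ((ContinuousLinearMap.fst ℝ ℝ ℝ).comp (ContinuousLinearMap.snd ℝ ℝ (ℝ × ℝ))) p :=
    hasFDerivAt_snd.fst
  unfold pd
  rw [h.fderiv]
  rfl

theorem pd_coordV (e p : Pt) : pd e (fun p : Pt => p.2.2) p = e.2.2 := by
  have h : HasFDerivAt (fun p : Pt => p.2.2)
      ((ContinuousLinearMap.snd ℝ ℝ ℝ).comp (ContinuousLinearMap.snd ℝ ℝ (ℝ × ℝ))) p :=
    hasFDerivAt_snd.snd
  unfold pd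
  rw [h.fderiv]
  rfl

theorem pd_coordT (e p : Pt) : pd e (fun p : Pt => p.1) p = e.1 := by
  have h : HasFDerivAt (fun p : Pt => p.1) (ContinuousLinearMap.fst ℝ ℝ (ℝ × ℝ)) p :=
    hasFDerivAt_fst
  unfold pd
  rw [h.fderiv]
  rfl

theorem hasDerivAt_comp_curve {g : Pt → ℝ} {γ₁ γ₂ γ₃ : ℝ → ℝ} {a b c s : ℝ}
    (h₁ : HasDerivAt γ₁ a s) (h₂ : HasDerivAt γ₂ b s) (h₃ : HasDerivAt γ₃ c s)
    (hg : DifferentiableAt ℝ g (γ₁ s, γ₂ s, γ₃ s)) :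
    HasDerivAt (fun s => g (γ₁ s, γ₂ s, γ₃ s))
      (a * pd eT g (γ₁ s, γ₂ s, γ₃ s) + b * pd eX g (γ₁ s, γ₂ s, γ₃ s)
        + c * pd eV g (γ₁ s, γ₂ s, γ₃ s)) s := by
  rw [← fderiv_apply_eq]
  exact hg.hasFDerivAt.comp_hasDerivAt s (f := fun s => ((γ₁ s, γ₂ s, γ₃ s) : Pt))
    (h₁.prodMk (h₂.prodMk h₃))

theorem hasDerivAt_lineX {g : Pt → ℝ} {t x v : ℝ} (hg : DifferentiableAt ℝ g (t, x, v)) :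
    HasDerivAt (fun y => g (t, y, v)) (pd eX g (t, x, v)) x := by
  simpa using hasDerivAt_comp_curve (γ₁ := fun _ => t) (γ₂ := fun y => y) (γ₃ := fun _ => v)
    (hasDerivAt_const x t) (hasDerivAt_id' x) (hasDerivAt_const x v) hg

theorem hasDerivAt_lineV {g : Pt → ℝ} {t x v : ℝ} (hg : DifferentiableAt ℝ g (t, x, v)) :
    HasDerivAt (fun y => g (t, x, y)) (pd eV g (t, x, v)) v := by
  simpa using hasDerivAt_comp_curve (γ₁ := fun _ => t) (γ₂ := fun _ => x) (γ₃ := fun y => y)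
    (hasDerivAt_const v t) (hasDerivAt_const v x) (hasDerivAt_id' v) hg

/-! ### The components of a transformation and the Jacobian determinant -/

def compT (f : Pt → Pt) (p : Pt) : ℝ := (f p).1
def compX (f : Pt → Pt) (p : Pt) : ℝ := (f p).2.1
def compV (f : Pt → Pt) (p : Pt) : ℝ := (f p).2.2

theorem contDiffAt_compT {f : Pt → Pt} {p : Pt} (h : ContDiffAt ℝ ∞ f p) :
    ContDiffAt ℝ ∞ (compT f) p := h.fst
theorem contDiffAt_compX {f : Pt → Pt} {p : Pt} (h : ContDiffAt ℝ ∞ f p) :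
    ContDiffAt ℝ ∞ (compX f) p := h.snd.fst
theorem contDiffAt_compV {f : Pt → Pt} {p : Pt} (h : ContDiffAt ℝ ∞ f p) :
    ContDiffAt ℝ ∞ (compV f) p := h.snd.snd

/-- The Jacobian determinant of three functions of `(t, x, v)`. -/
def jacDet (T X V : Pt → ℝ) (p : Pt) : ℝ :=
  pd eT T p * (pd eX X p * pd eV V p - pd eV X p * pd eX V p)
    - pd eX T p * (pd eT X p * pd eV V p - pd eV X p * pd eT V p)
    + pd eV T p * (pd eT X p * pd eX V p - pd eX X p * pd eT V p)

/-- The chain rule for `g ∘ f = id` makes the derivative of `f` injective, whereas a zero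
determinant would supply a nonzero kernel vector. -/
theorem jacDet_ne_zero {f : Pt → Pt} {A B : Set Pt} (hA : IsOpen A) (hB : IsOpen B)
    (hf : IsPointTransformation f A B) {p : Pt} (hp : p ∈ A) :
    jacDet (compT f) (compX f) (compV f) p ≠ 0 := by
  obtain ⟨hbij, hfs, g, hg, hgf⟩ := hf
  have hfp : ContDiffAt ℝ ∞ f p := hfs.contDiffAt (hA.mem_nhds hp)
  have hgp : ContDiffAt ℝ ∞ g (f p) := hg.contDiffAt (hB.mem_nhds (hbij.mapsTo hp))
  have hcomp := (differentiableAt_of_smooth hgp).hasFDerivAt.comp p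
    (differentiableAt_of_smooth hfp).hasFDerivAt
  have hid : HasFDerivAt (g ∘ f) (ContinuousLinearMap.id ℝ Pt) p :=
    (hasFDerivAt_id p).congr_of_eventuallyEq (mem_of_superset (hA.mem_nhds hp) hgf)
  have heq := hcomp.unique hid
  have hinj : ∀ w, fderiv ℝ f p w = 0 → w = 0 := by
    intro w hw
    have := congrArg (fun L => L w) heq
    simpa [hw] using this.symm
  intro hdet
  let M : Matrix (Fin 3) (Fin 3) ℝ := !![pd eT (compT f) p, pd eX (compT f) p, pd eV (compT f) p;
    pd eT (compX f) p, pd eX (compX f) p, pd eV (compX f) p;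
    pd eT (compV f) p, pd eX (compV f) p, pd eV (compV f) p]
  have hM : M.det = 0 := by
    rw [Matrix.det_fin_three]
    simp only [M, Matrix.of_apply, Matrix.cons_val', Matrix.cons_val_zero, Matrix.cons_val_one,
      Matrix.cons_val_fin_one, Matrix.cons_val]
    rw [← hdet]
    unfold jacDet
    ring
  obtain ⟨w, hw0, hw⟩ := Matrix.exists_mulVec_eq_zero_iff.mpr hM
  have hfd := (differentiableAt_of_smooth hfp)
  have h1 := hfd.hasFDerivAt.fst.fderiv
  have h2 := hfd.hasFDerivAt.snd.fst.fderiv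
  have h3 := hfd.hasFDerivAt.snd.snd.fderiv
  have hz : fderiv ℝ f p (w 0, w 1, w 2) = 0 := by
    have e0 := congrFun hw 0
    have e1 := congrFun hw 1
    have e2 := congrFun hw 2
    simp [M, Matrix.mulVec, dotProduct, Fin.sum_univ_three] at e0 e1 e2
    have k1 := fderiv_apply_eq (compT f) p (w 0) (w 1) (w 2)
    have k2 := fderiv_apply_eq (compX f) p (w 0) (w 1) (w 2)
    have k3 := fderiv_apply_eq (compV f) p (w 0) (w 1) (w 2)
    unfold compT at k1
    unfold compX at k2
    unfold compV at k3
    rw [h1] at k1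
    rw [h2] at k2
    rw [h3] at k3
    refine Prod.ext ?_ (Prod.ext ?_ ?_)
    · refine k1.trans ?_
      unfold compT at e0
      simpa using by linarith
    · refine k2.trans ?_
      unfold compX at e1
      simpa using by linarith
    · refine k3.trans ?_
      unfold compV at e2
      simpa using by linarith
  have := hinj _ hz
  apply hw0
  simp only [Prod.mk_eq_zero] at this
  funext i
  fin_cases i
  · exact this.1
  · exact this.2.1
  · exact this.2.2

/-! ### Total derivatives along second-order jets -/

/-- A polynomial whose graph passes through `p₀` and whose derivatives at the base point of `p₀` are
`u_t = a`, `u_x = b`, `u_xx = r`, `u_tt = l`, `u_tx = 0`. -/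
def jetFn (p₀ : Pt) (a b r l : ℝ) (z : ℝ × ℝ) : ℝ :=
  p₀.2.2 + a * (z.1 - p₀.1) + b * (z.2 - p₀.2.1) + r / 2 * (z.2 - p₀.2.1) ^ 2
    + l / 2 * (z.1 - p₀.1) ^ 2

section Jets

variable (p₀ : Pt) (a b r l : ℝ)

theorem contDiff_jetFn : ContDiff ℝ ∞ (jetFn p₀ a b r l) := by
  unfold jetFn
  fun_prop

theorem graphPt_jetFn : graphPt (jetFn p₀ a b r l) (p₀.1, p₀.2.1) = p₀ := by
  simp [graphPt, jetFn]

theorem hasDerivAt_jetFn_x (z : ℝ × ℝ) :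
    HasDerivAt (fun y => jetFn p₀ a b r l (z.1, y)) (b + r * (z.2 - p₀.2.1)) z.2 := by
  unfold jetFn
  have h : HasDerivAt (fun y : ℝ => y - p₀.2.1) 1 z.2 := (hasDerivAt_id' z.2).sub_const _
  have := ((((h.const_mul b).const_add (p₀.2.2 + a * (z.1 - p₀.1))).add
    ((h.pow 2).const_mul (r / 2)))).add_const (l / 2 * (z.1 - p₀.1) ^ 2)
  refine this.congr_deriv ?_
  simp only [Nat.cast_ofNat, Nat.add_one_sub_one, pow_one, mul_one]
  ring

theorem hasDerivAt_jetFn_t (z : ℝ × ℝ) :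
    HasDerivAt (fun s => jetFn p₀ a b r l (s, z.2)) (a + l * (z.1 - p₀.1)) z.1 := by
  unfold jetFn
  have h : HasDerivAt (fun y : ℝ => y - p₀.1) 1 z.1 := (hasDerivAt_id' z.1).sub_const _
  have := ((((h.const_mul a).const_add (p₀.2.2)).add_const (b * (z.2 - p₀.2.1))).add_const
    (r / 2 * (z.2 - p₀.2.1) ^ 2)).add ((h.pow 2).const_mul (l / 2))
  refine this.congr_deriv ?_
  simp only [Nat.cast_ofNat, Nat.add_one_sub_one, pow_one, mul_one]
  ring

theorem dt_jetFn (z : ℝ × ℝ) : dt (jetFn p₀ a b r l) z = a + l * (z.1 - p₀.1) :=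
  (hasDerivAt_jetFn_t p₀ a b r l z).deriv

theorem dx_jetFn (z : ℝ × ℝ) : dx (jetFn p₀ a b r l) z = b + r * (z.2 - p₀.2.1) :=
  (hasDerivAt_jetFn_x p₀ a b r l z).deriv

theorem dx_dx_jetFn (z : ℝ × ℝ) : dx (dx (jetFn p₀ a b r l)) z = r := by
  have h : dx (jetFn p₀ a b r l) = fun z => b + r * (z.2 - p₀.2.1) :=
    funext (dx_jetFn p₀ a b r l)
  rw [h]
  have h : HasDerivAt (fun y : ℝ => b + r * (y - p₀.2.1)) (r * 1) z.2 :=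
    (((hasDerivAt_id' z.2).sub_const _).const_mul r).const_add b
  exact h.deriv.trans (mul_one r)

/-- The total `x`-derivative of `g` along the graph of `jetFn`. -/
def totX (g : Pt → ℝ) (z : ℝ × ℝ) : ℝ :=
  pd eX g (graphPt (jetFn p₀ a b r l) z)
    + (b + r * (z.2 - p₀.2.1)) * pd eV g (graphPt (jetFn p₀ a b r l) z)

/-- The total `t`-derivative of `g` along the graph of `jetFn`. -/
def totT (g : Pt → ℝ) (z : ℝ × ℝ) : ℝ :=
  pd eT g (graphPt (jetFn p₀ a b r l) z)
    + (a + l * (z.1 - p₀.1)) * pd eV g (graphPt (jetFn p₀ a b r l) z)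

variable {g : Pt → ℝ}

theorem hasDerivAt_graph_x {z : ℝ × ℝ}
    (hg : DifferentiableAt ℝ g (graphPt (jetFn p₀ a b r l) z)) :
    HasDerivAt (fun y => g (graphPt (jetFn p₀ a b r l) (z.1, y))) (totX p₀ a b r l g z) z.2 := by
  refine (hasDerivAt_comp_curve (hasDerivAt_const z.2 z.1) (hasDerivAt_id' z.2)
    (hasDerivAt_jetFn_x p₀ a b r l z) hg).congr_deriv ?_
  simp [totX, graphPt]

theorem hasDerivAt_graph_t {z : ℝ × ℝ}
    (hg : DifferentiableAt ℝ g (graphPt (jetFn p₀ a b r l) z)) :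
    HasDerivAt (fun s => g (graphPt (jetFn p₀ a b r l) (s, z.2))) (totT p₀ a b r l g z) z.1 := by
  refine (hasDerivAt_comp_curve (hasDerivAt_id' z.1) (hasDerivAt_const z.1 z.2)
    (hasDerivAt_jetFn_t p₀ a b r l z) hg).congr_deriv ?_
  simp [totT, graphPt]

/-- Values of the first and second total derivatives of `g` at `p₀`. -/
def jX (g : Pt → ℝ) : ℝ := pd eX g p₀ + b * pd eV g p₀
def jT (g : Pt → ℝ) : ℝ := pd eT g p₀ + a * pd eV g p₀
def jXX (g : Pt → ℝ) : ℝ :=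
  pd eX (pd eX g) p₀ + b * pd eV (pd eX g) p₀
    + (r * pd eV g p₀ + b * (pd eX (pd eV g) p₀ + b * pd eV (pd eV g) p₀))
-- No term with `u_tx` occurs here or in `jTX`, since the mixed derivative of `jetFn` is zero.
def jXT (g : Pt → ℝ) : ℝ :=
  pd eX (pd eT g) p₀ + b * pd eV (pd eT g) p₀
    + a * (pd eX (pd eV g) p₀ + b * pd eV (pd eV g) p₀)
def jTX (g : Pt → ℝ) : ℝ :=
  pd eT (pd eX g) p₀ + a * pd eV (pd eX g) p₀
    + b * (pd eT (pd eV g) p₀ + a * pd eV (pd eV g) p₀)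
def jTT (g : Pt → ℝ) : ℝ :=
  pd eT (pd eT g) p₀ + a * pd eV (pd eT g) p₀
    + (l * pd eV g p₀ + a * (pd eT (pd eV g) p₀ + a * pd eV (pd eV g) p₀))

theorem totX_base : totX p₀ a b r l g (p₀.1, p₀.2.1) = jX p₀ b g := by
  simp [totX, graphPt_jetFn, jX]

theorem totT_base : totT p₀ a b r l g (p₀.1, p₀.2.1) = jT p₀ a g := by
  simp [totT, graphPt_jetFn, jT]

variable (hg : ContDiffAt ℝ ∞ g p₀)
include hg

theorem hasDerivAt_totX_x :
    HasDerivAt (fun y => totX p₀ a b r l g (p₀.1, y)) (jXX p₀ b r g) p₀.2.1 := by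
  have hd : ∀ e, DifferentiableAt ℝ (pd e g) (graphPt (jetFn p₀ a b r l) (p₀.1, p₀.2.1)) := by
    intro e
    rw [graphPt_jetFn]
    exact differentiableAt_of_smooth (pd_contDiffAt e hg)
  have h1 := hasDerivAt_graph_x p₀ a b r l (z := (p₀.1, p₀.2.1)) (hd eX)
  have h2 := hasDerivAt_graph_x p₀ a b r l (z := (p₀.1, p₀.2.1)) (hd eV)
  have h3 : HasDerivAt (fun y : ℝ => b + r * (y - p₀.2.1)) (r * 1) p₀.2.1 :=
    (((hasDerivAt_id' p₀.2.1).sub_const _).const_mul r).const_add b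
  refine (h1.add (h3.mul h2)).congr_deriv ?_
  simp only [totX_base, graphPt_jetFn, jX, jXX]
  simp

theorem hasDerivAt_totT_x :
    HasDerivAt (fun y => totT p₀ a b r l g (p₀.1, y)) (jXT p₀ a b g) p₀.2.1 := by
  have hd : ∀ e, DifferentiableAt ℝ (pd e g) (graphPt (jetFn p₀ a b r l) (p₀.1, p₀.2.1)) := by
    intro e
    rw [graphPt_jetFn]
    exact differentiableAt_of_smooth (pd_contDiffAt e hg)
  have h1 := hasDerivAt_graph_x p₀ a b r l (z := (p₀.1, p₀.2.1)) (hd eT)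
  have h2 := hasDerivAt_graph_x p₀ a b r l (z := (p₀.1, p₀.2.1)) (hd eV)
  refine (h1.add (h2.const_mul (a + l * (p₀.1 - p₀.1)))).congr_deriv ?_
  simp only [totX_base, jX, jXT]
  simp

theorem hasDerivAt_totX_t :
    HasDerivAt (fun s => totX p₀ a b r l g (s, p₀.2.1)) (jTX p₀ a b g) p₀.1 := by
  have hd : ∀ e, DifferentiableAt ℝ (pd e g) (graphPt (jetFn p₀ a b r l) (p₀.1, p₀.2.1)) := by
    intro e
    rw [graphPt_jetFn]
    exact differentiableAt_of_smooth (pd_contDiffAt e hg)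
  have h1 := hasDerivAt_graph_t p₀ a b r l (z := (p₀.1, p₀.2.1)) (hd eX)
  have h2 := hasDerivAt_graph_t p₀ a b r l (z := (p₀.1, p₀.2.1)) (hd eV)
  refine (h1.add (h2.const_mul (b + r * (p₀.2.1 - p₀.2.1)))).congr_deriv ?_
  simp only [totT_base, jT, jTX]
  simp

theorem hasDerivAt_totT_t :
    HasDerivAt (fun s => totT p₀ a b r l g (s, p₀.2.1)) (jTT p₀ a l g) p₀.1 := by
  have hd : ∀ e, DifferentiableAt ℝ (pd e g) (graphPt (jetFn p₀ a b r l) (p₀.1, p₀.2.1)) := by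
    intro e
    rw [graphPt_jetFn]
    exact differentiableAt_of_smooth (pd_contDiffAt e hg)
  have h1 := hasDerivAt_graph_t p₀ a b r l (z := (p₀.1, p₀.2.1)) (hd eT)
  have h2 := hasDerivAt_graph_t p₀ a b r l (z := (p₀.1, p₀.2.1)) (hd eV)
  have h3 : HasDerivAt (fun y : ℝ => a + l * (y - p₀.1)) (l * 1) p₀.1 :=
    (((hasDerivAt_id' p₀.1).sub_const _).const_mul l).const_add a
  refine (h1.add (h3.mul h2)).congr_deriv ?_
  simp only [totT_base, graphPt_jetFn, jT, jTT]
  simp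

end Jets

/-! ### The second prolongation in coordinates -/

section Formulas

variable (f : Pt → Pt) (p₀ : Pt) (a b r l : ℝ)

/-- The total Jacobian `D_t T D_x X - D_x T D_t X` at the jet `(p₀, u_t = a, u_x = b)`. -/
def jetJac : ℝ :=
  jT p₀ a (compT f) * jX p₀ b (compX f) - jX p₀ b (compT f) * jT p₀ a (compX f)

/-- The value of the `v_t`-coordinate of the image of a jet. -/
def jetVt : ℝ :=
  (jT p₀ a (compV f) * jX p₀ b (compX f) - jX p₀ b (compV f) * jT p₀ a (compX f)) / jetJac f p₀ a b

/-- The numerator `D_x V D_t T - D_t V D_x T` of the image of `v_x`. -/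
def jetNum : ℝ :=
  jX p₀ b (compV f) * jT p₀ a (compT f) - jT p₀ a (compV f) * jX p₀ b (compT f)

/-- The total `x`-derivatives of `jetJac` and `jetNum`. -/
def jetJacX : ℝ :=
  jXT p₀ a b (compT f) * jX p₀ b (compX f) + jT p₀ a (compT f) * jXX p₀ b r (compX f)
    - (jXX p₀ b r (compT f) * jT p₀ a (compX f) + jX p₀ b (compT f) * jXT p₀ a b (compX f))
def jetNumX : ℝ :=
  jXX p₀ b r (compV f) * jT p₀ a (compT f) + jX p₀ b (compV f) * jXT p₀ a b (compT f)
    - (jXT p₀ a b (compV f) * jX p₀ b (compT f) + jT p₀ a (compV f) * jXX p₀ b r (compT f))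

/-- The total `t`-derivatives of `jetJac` and `jetNum`. -/
def jetJacT : ℝ :=
  jTT p₀ a l (compT f) * jX p₀ b (compX f) + jT p₀ a (compT f) * jTX p₀ a b (compX f)
    - (jTX p₀ a b (compT f) * jT p₀ a (compX f) + jX p₀ b (compT f) * jTT p₀ a l (compX f))
def jetNumT : ℝ :=
  jTX p₀ a b (compV f) * jT p₀ a (compT f) + jX p₀ b (compV f) * jTT p₀ a l (compT f)
    - (jTT p₀ a l (compV f) * jX p₀ b (compT f) + jT p₀ a (compV f) * jTX p₀ a b (compT f))

/-- The value of the `v_xx`-coordinate of the image of a jet. -/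
def jetVxx : ℝ :=
  ((jetNumX f p₀ a b r * jetJac f p₀ a b - jetNum f p₀ a b * jetJacX f p₀ a b r)
      / jetJac f p₀ a b ^ 2 * jT p₀ a (compT f)
    - (jetNumT f p₀ a b l * jetJac f p₀ a b - jetNum f p₀ a b * jetJacT f p₀ a b l)
      / jetJac f p₀ a b ^ 2 * jX p₀ b (compT f)) / jetJac f p₀ a b

variable {f}
variable {z : ℝ × ℝ} {g : Pt → ℝ}

theorem dt_comp_graph (hg : DifferentiableAt ℝ g (graphPt (jetFn p₀ a b r l) z)) :
    dt (fun z => g (graphPt (jetFn p₀ a b r l) z)) z = totT p₀ a b r l g z :=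
  (hasDerivAt_graph_t p₀ a b r l hg).deriv

theorem dx_comp_graph (hg : DifferentiableAt ℝ g (graphPt (jetFn p₀ a b r l) z)) :
    dx (fun z => g (graphPt (jetFn p₀ a b r l) z)) z = totX p₀ a b r l g z :=
  (hasDerivAt_graph_x p₀ a b r l hg).deriv

variable (f) in
/-- The total Jacobian near the base point. -/
def totJac (z : ℝ × ℝ) : ℝ :=
  totT p₀ a b r l (compT f) z * totX p₀ a b r l (compX f) z
    - totX p₀ a b r l (compT f) z * totT p₀ a b r l (compX f) z

variable (f) in
def totNum (z : ℝ × ℝ) : ℝ :=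
  totX p₀ a b r l (compV f) z * totT p₀ a b r l (compT f) z
    - totT p₀ a b r l (compV f) z * totX p₀ a b r l (compT f) z

theorem jac_jetFn (hf : DifferentiableAt ℝ f (graphPt (jetFn p₀ a b r l) z)) :
    jac f (jetFn p₀ a b r l) z = totJac f p₀ a b r l z := by
  have h1 := dt_comp_graph p₀ a b r l (g := compT f) hf.fst
  have h2 := dx_comp_graph p₀ a b r l (g := compT f) hf.fst
  have h3 := dt_comp_graph p₀ a b r l (g := compX f) hf.snd.fst
  have h4 := dx_comp_graph p₀ a b r l (g := compX f) hf.snd.fst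
  unfold totJac
  rw [← h1, ← h2, ← h3, ← h4]
  rfl

theorem dxNew_jetFn (hf : DifferentiableAt ℝ f (graphPt (jetFn p₀ a b r l) z)) :
    dxNew f (jetFn p₀ a b r l) (vNew f (jetFn p₀ a b r l)) z
      = totNum f p₀ a b r l z / totJac f p₀ a b r l z := by
  rw [← jac_jetFn p₀ a b r l hf]
  have h1 := dt_comp_graph p₀ a b r l (g := compT f) hf.fst
  have h2 := dx_comp_graph p₀ a b r l (g := compT f) hf.fst
  have h3 := dt_comp_graph p₀ a b r l (g := compV f) hf.snd.snd
  have h4 := dx_comp_graph p₀ a b r l (g := compV f) hf.snd.snd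
  unfold totNum
  rw [← h1, ← h2, ← h3, ← h4]
  rfl

variable (hf : ContDiffAt ℝ ∞ f p₀)
include hf

theorem jac_base : jac f (jetFn p₀ a b r l) (p₀.1, p₀.2.1) = jetJac f p₀ a b := by
  rw [jac_jetFn]
  · simp only [totJac, totT_base, totX_base, jetJac]
  · rw [graphPt_jetFn]
    exact differentiableAt_of_smooth hf

theorem dtNew_base :
    dtNew f (jetFn p₀ a b r l) (vNew f (jetFn p₀ a b r l)) (p₀.1, p₀.2.1) = jetVt f p₀ a b := by
  have hd : DifferentiableAt ℝ f (graphPt (jetFn p₀ a b r l) (p₀.1, p₀.2.1)) := by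
    rw [graphPt_jetFn]
    exact differentiableAt_of_smooth hf
  have h1 := dt_comp_graph p₀ a b r l (g := compX f) hd.snd.fst
  have h2 := dx_comp_graph p₀ a b r l (g := compX f) hd.snd.fst
  have h3 := dt_comp_graph p₀ a b r l (g := compV f) hd.snd.snd
  have h4 := dx_comp_graph p₀ a b r l (g := compV f) hd.snd.snd
  rw [totT_base] at h1 h3
  rw [totX_base] at h2 h4
  unfold jetVt
  rw [← jac_base p₀ a b r l hf, ← h1, ← h2, ← h3, ← h4]
  rfl

/-- The outer `dxNew` differentiates the inner one, so the quotient formula for the first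
prolongation is needed on a neighbourhood of the base point (`hloc`); the rest is the quotient rule.
-/
theorem dxNew_dxNew_base (hJ : jetJac f p₀ a b ≠ 0) :
    dxNew f (jetFn p₀ a b r l) (dxNew f (jetFn p₀ a b r l) (vNew f (jetFn p₀ a b r l)))
      (p₀.1, p₀.2.1) = jetVxx f p₀ a b r l := by
  set u := jetFn p₀ a b r l with hu
  have hd : DifferentiableAt ℝ f (graphPt u (p₀.1, p₀.2.1)) := by
    rw [graphPt_jetFn]
    exact differentiableAt_of_smooth hf
  have hcont : ContinuousAt (graphPt u) (p₀.1, p₀.2.1) := by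
    have := (contDiff_jetFn p₀ a b r l).continuous
    unfold graphPt
    fun_prop
  have hev : ∀ᶠ p in 𝓝 p₀, DifferentiableAt ℝ f p := by
    have h1 : ContDiffAt ℝ 1 f p₀ := hf.of_le (by simp)
    filter_upwards [h1.eventually (by simp)] with p hp
    exact hp.differentiableAt (by simp)
  have hev' : ∀ᶠ z in 𝓝 (p₀.1, p₀.2.1), DifferentiableAt ℝ f (graphPt u z) := by
    apply hcont.eventually
    rwa [graphPt_jetFn]
  have hloc : dxNew f u (vNew f u) =ᶠ[𝓝 (p₀.1, p₀.2.1)]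
      fun z => totNum f p₀ a b r l z / totJac f p₀ a b r l z := by
    filter_upwards [hev'] with z hz
    exact dxNew_jetFn p₀ a b r l hz
  have hJ0 : totJac f p₀ a b r l (p₀.1, p₀.2.1) = jetJac f p₀ a b := by
    simp only [totJac, totT_base, totX_base, jetJac]
  have hN0 : totNum f p₀ a b r l (p₀.1, p₀.2.1) = jetNum f p₀ a b := by
    simp only [totNum, totT_base, totX_base, jetNum]
  have cT := contDiffAt_compT hf
  have cX := contDiffAt_compX hf
  have cV := contDiffAt_compV hf
  have hx : dx (dxNew f u (vNew f u)) (p₀.1, p₀.2.1) =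
      (jetNumX f p₀ a b r * jetJac f p₀ a b - jetNum f p₀ a b * jetJacX f p₀ a b r)
      / jetJac f p₀ a b ^ 2 := by
    have e1 : (fun y => dxNew f u (vNew f u) (p₀.1, y)) =ᶠ[𝓝 p₀.2.1]
        fun y => totNum f p₀ a b r l (p₀.1, y) / totJac f p₀ a b r l (p₀.1, y) :=
      (Continuous.prodMk_right p₀.1).continuousAt.eventually hloc
    unfold dx
    rw [e1.deriv_eq]
    have hN := ((hasDerivAt_totX_x p₀ a b r l cV).mul (hasDerivAt_totT_x p₀ a b r l cT)).sub
      ((hasDerivAt_totT_x p₀ a b r l cV).mul (hasDerivAt_totX_x p₀ a b r l cT))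
    have hJ' := ((hasDerivAt_totT_x p₀ a b r l cT).mul (hasDerivAt_totX_x p₀ a b r l cX)).sub
      ((hasDerivAt_totX_x p₀ a b r l cT).mul (hasDerivAt_totT_x p₀ a b r l cX))
    have := hN.div hJ' (by simpa [totT_base, totX_base, jetJac] using hJ)
    simp only [Pi.sub_apply, Pi.mul_apply, totT_base, totX_base] at this
    exact this.deriv
  have ht : dt (dxNew f u (vNew f u)) (p₀.1, p₀.2.1) =
      (jetNumT f p₀ a b l * jetJac f p₀ a b - jetNum f p₀ a b * jetJacT f p₀ a b l)
      / jetJac f p₀ a b ^ 2 := by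
    have e1 : (fun s => dxNew f u (vNew f u) (s, p₀.2.1)) =ᶠ[𝓝 p₀.1]
        fun s => totNum f p₀ a b r l (s, p₀.2.1) / totJac f p₀ a b r l (s, p₀.2.1) :=
      (Continuous.prodMk_left p₀.2.1).continuousAt.eventually hloc
    unfold dt
    rw [e1.deriv_eq]
    have hN := ((hasDerivAt_totX_t p₀ a b r l cV).mul (hasDerivAt_totT_t p₀ a b r l cT)).sub
      ((hasDerivAt_totT_t p₀ a b r l cV).mul (hasDerivAt_totX_t p₀ a b r l cT))
    have hJ' := ((hasDerivAt_totT_t p₀ a b r l cT).mul (hasDerivAt_totX_t p₀ a b r l cX)).sub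
      ((hasDerivAt_totX_t p₀ a b r l cT).mul (hasDerivAt_totT_t p₀ a b r l cX))
    have := hN.div hJ' (by simpa [totT_base, totX_base, jetJac] using hJ)
    simp only [Pi.sub_apply, Pi.mul_apply, totT_base, totX_base] at this
    exact this.deriv
  have h1 := dt_comp_graph p₀ a b r l (g := compT f) hd.fst
  have h2 := dx_comp_graph p₀ a b r l (g := compT f) hd.fst
  rw [totT_base] at h1
  rw [totX_base] at h2
  have h1' : dt (tNew f u) (p₀.1, p₀.2.1) = jT p₀ a (compT f) := h1
  have h2' : dx (tNew f u) (p₀.1, p₀.2.1) = jX p₀ b (compT f) := h2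
  rw [dxNew, hx, ht, h1', h2', jac_base p₀ a b r l hf]
  rfl

omit hf in
/-- The condition that `f` maps `θ` to `θ'`, written for a jet over `p₀`. -/
theorem MapsEquation.jet {D : Set ℝ} {θ θ' : Eqn D} {p₀ : Pt} (h : MapsEquation f θ θ')
    (hp : p₀ ∈ θ.dom) (hf : ContDiffAt ℝ ∞ f p₀) (hv : p₀.2.2 ≠ 0) (hV : compV f p₀ ≠ 0)
    {a b r l : ℝ} (hJ : jetJac f p₀ a b ≠ 0) :
    θ.Holds p₀.2.1 p₀.2.2 a r ↔
      θ'.Holds (compX f p₀) (compV f p₀) (jetVt f p₀ a b) (jetVxx f p₀ a b r l) := by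
  have hg := graphPt_jetFn p₀ a b r l
  have hu : jetFn p₀ a b r l (p₀.1, p₀.2.1) = p₀.2.2 := congrArg (fun p : Pt => p.2.2) hg
  have := h (jetFn p₀ a b r l) (contDiff_jetFn p₀ a b r l) (p₀.1, p₀.2.1) (by rwa [hg])
    (by rwa [hu]) (by unfold vNew; rwa [hg]) (by rwa [jac_base p₀ a b r l hf])
  rw [dtNew_base p₀ a b r l hf, dxNew_dxNew_base p₀ a b r l hf hJ, dx_dx_jetFn, dt_jetFn, hu] at this
  unfold xNew vNew at this
  rw [hg] at this
  simpa [compX, compV] using this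

end Formulas

/-! ### Functions of one variable -/

/-- The conclusion again holds near the point and not only at it, so the lemma can be iterated; all
splitting by repeated differentiation goes through it. -/
theorem eventually_deriv_eq {A B A' B' : ℝ → ℝ} {x₀ : ℝ} (h : ∀ᶠ x in 𝓝 x₀, A x = B x)
    (hA : ∀ᶠ x in 𝓝 x₀, HasDerivAt A (A' x) x) (hB : ∀ᶠ x in 𝓝 x₀, HasDerivAt B (B' x) x) :
    ∀ᶠ x in 𝓝 x₀, A' x = B' x := by
  filter_upwards [h.eventually_nhds, hA, hB] with x h1 h2 h3
  exact h2.unique (h3.congr_of_eventuallyEq h1)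

theorem hasDerivAt_abs_rpow (m : ℝ) {v : ℝ} (hv : v ≠ 0) :
    HasDerivAt (fun v : ℝ => |v| ^ m) (m * |v| ^ m / v) v := by
  have h : (fun v : ℝ => |v| ^ m) =ᶠ[𝓝 v] fun v => Real.exp (Real.log v * m) := by
    filter_upwards [isOpen_ne.mem_nhds hv] with w hw
    rw [Real.rpow_def_of_pos (abs_pos.mpr hw), Real.log_abs]
  have h2 := ((Real.hasDerivAt_log hv).mul_const m).exp
  refine (h2.congr_of_eventuallyEq h).congr_deriv ?_
  rw [← h.eq_of_nhds]
  ring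

theorem abs_rpow_ne_zero (m : ℝ) {v : ℝ} (hv : v ≠ 0) : |v| ^ m ≠ 0 :=
  (Real.rpow_pos_of_pos (abs_pos.mpr hv) m).ne'

/-- Derivatives of `|αv+β|^m / (αv+β)^k`. -/
theorem hasDerivAt_abs_rpow_div (m α β : ℝ) (k : ℕ) {v : ℝ} (hv : α * v + β ≠ 0) :
    HasDerivAt (fun v : ℝ => |α * v + β| ^ m / (α * v + β) ^ k)
      ((m - k) * α * (|α * v + β| ^ m / (α * v + β) ^ (k + 1))) v := by
  have hl : HasDerivAt (fun v : ℝ => α * v + β) α v := by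
    simpa using ((hasDerivAt_id' v).const_mul α).add_const β
  have h1 := HasDerivAt.comp (h₂ := fun v : ℝ => |v| ^ m) v (hasDerivAt_abs_rpow m hv) hl
  refine (h1.div (hl.pow k) (pow_ne_zero k hv)).congr_deriv ?_
  rcases k with _ | k
  · simp
    field_simp
  · simp only [Function.comp, Pi.pow_apply, Nat.add_sub_cancel]
    push_cast
    field_simp
    ring

/-- Two differentiations remove the affine right-hand side. -/
theorem power_second_deriv {a b α β c d m m' v₀ : ℝ} (hv : v₀ ≠ 0) (hV : α * v₀ + β ≠ 0)
    (h : ∀ᶠ v in 𝓝 v₀, a * |v| ^ m - b * |α * v + β| ^ m' = c * v + d) :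
    ∀ᶠ v in 𝓝 v₀, a * (m * (m - 1)) * (|v| ^ m / v ^ 2)
      = b * α ^ 2 * (m' * (m' - 1)) * (|α * v + β| ^ m' / (α * v + β) ^ 2) := by
  have e1 : ∀ᶠ v : ℝ in 𝓝 v₀, v ≠ 0 := isOpen_ne.mem_nhds hv
  have e2 : ∀ᶠ v : ℝ in 𝓝 v₀, α * v + β ≠ 0 :=
    (by fun_prop : ContinuousAt (fun v : ℝ => α * v + β) v₀).eventually_ne hV
  have key : ∀ (m : ℝ) (k : ℕ) (v : ℝ), v ≠ 0 → HasDerivAt (fun v : ℝ => |v| ^ m / v ^ k)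
      ((m - k) * (|v| ^ m / v ^ (k + 1))) v := by
    intro m k v hv
    simpa using hasDerivAt_abs_rpow_div m 1 0 k (v := v) (by simpa using hv)
  have d1 := eventually_deriv_eq h
    (A' := fun v => a * (m * (|v| ^ m / v ^ 1)) - b * (m' * α * (|α * v + β| ^ m' / (α * v + β) ^ 1)))
    (B' := fun _ => c) (by
      filter_upwards [e1, e2] with v h1 h2
      have k1 := (key m 0 v h1).const_mul a
      have k2 := (hasDerivAt_abs_rpow_div m' α β 0 h2).const_mul b
      simpa using k1.fun_sub k2)
    (by
      filter_upwards with v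
      simpa using ((hasDerivAt_id' v).const_mul c).add_const d)
  have d2 := eventually_deriv_eq d1
    (A' := fun v => a * (m * ((m - 1) * (|v| ^ m / v ^ 2)))
      - b * (m' * α * ((m' - 1) * α * (|α * v + β| ^ m' / (α * v + β) ^ 2))))
    (B' := fun _ => 0) (by
      filter_upwards [e1, e2] with v h1 h2
      have k1 := ((key m 1 v h1).const_mul m).const_mul a
      have k2 := ((hasDerivAt_abs_rpow_div m' α β 1 h2).const_mul (m' * α)).const_mul b
      simpa using k1.fun_sub k2)
    (by
      filter_upwards with v
      exact hasDerivAt_const v c)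
  filter_upwards [d2] with v h
  linear_combination h

/-- If a power of `v` and a power of an affine function of `v` are equal up to constant factors and
an affine function of `v`, the exponents coincide, and the affine function is linear if the
exponent is different from two. -/
theorem power_rigidity {a b α β c d m m' v₀ : ℝ} (hv : v₀ ≠ 0) (hV : α * v₀ + β ≠ 0)
    (ha : a ≠ 0) (hα : α ≠ 0) (hm0 : m ≠ 0) (hm1 : m ≠ 1)
    (h : ∀ᶠ v in 𝓝 v₀, a * |v| ^ m - b * |α * v + β| ^ m' = c * v + d) :
    m' = m ∧ (m - 2) * β = 0 ∧
      a * |v₀| ^ m * (α * v₀ + β) ^ 2 = b * α ^ 2 * |α * v₀ + β| ^ m * v₀ ^ 2 := by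
  have e1 : ∀ᶠ v : ℝ in 𝓝 v₀, v ≠ 0 := isOpen_ne.mem_nhds hv
  have e2 : ∀ᶠ v : ℝ in 𝓝 v₀, α * v + β ≠ 0 :=
    (by fun_prop : ContinuousAt (fun v : ℝ => α * v + β) v₀).eventually_ne hV
  have d2 := power_second_deriv hv hV h
  have d3 := eventually_deriv_eq d2
    (A' := fun v => a * (m * (m - 1)) * ((m - 2) * (|v| ^ m / v ^ 3)))
    (B' := fun v => b * α ^ 2 * (m' * (m' - 1)) *
      ((m' - 2) * α * (|α * v + β| ^ m' / (α * v + β) ^ 3))) (by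
      filter_upwards [e1] with v h1
      have := (hasDerivAt_abs_rpow_div m 1 0 2 (v := v) (by simpa using h1)).const_mul
        (a * (m * (m - 1)))
      simpa using this)
    (by
      filter_upwards [e2] with v h2
      simpa using (hasDerivAt_abs_rpow_div m' α β 2 h2).const_mul (b * α ^ 2 * (m' * (m' - 1))))
  have hP : a * (m * (m - 1)) ≠ 0 := mul_ne_zero ha (mul_ne_zero hm0 (sub_ne_zero.mpr hm1))
  -- The logarithmic derivatives of the two sides of `d2` are `(m - 2) / v` and `(m' - 2) α / (α v +
  -- β)`; they agree because the sides are nonzero. Clearing denominators leaves affine functions of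
  -- `v`, whose slopes give `m' = m` and whose constant terms give `(m - 2) β = 0`.
  have hlin : ∀ᶠ v in 𝓝 v₀, (m - 2) * (α * v + β) = (m' - 2) * α * v := by
    filter_upwards [e1, e2, d2, d3] with v h1 h2 h3 h4
    have hw : |v| ^ m ≠ 0 := abs_rpow_ne_zero m h1
    set A := |v| ^ m
    set B := |α * v + β| ^ m'
    have h5 : a * (m * (m - 1)) * (A / v ^ 2) *
        ((m - 2) / v - (m' - 2) * α / (α * v + β)) = 0 := by
      have e3 : A / v ^ 3 = A / v ^ 2 / v := by field_simp
      have e4 : B / (α * v + β) ^ 3 = B / (α * v + β) ^ 2 / (α * v + β) := by field_simp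
      rw [e3, e4] at h4
      linear_combination h4 - (m' - 2) * α / (α * v + β) * h3
    have h6 : (m - 2) / v - (m' - 2) * α / (α * v + β) = 0 := by
      refine (mul_eq_zero.mp h5).resolve_left ?_
      exact mul_ne_zero hP (div_ne_zero hw (pow_ne_zero 2 h1))
    rw [sub_eq_zero, div_eq_div_iff h1 h2] at h6
    linear_combination h6
  have hlin' := eventually_deriv_eq hlin (A' := fun _ => (m - 2) * α) (B' := fun _ => (m' - 2) * α)
    (by
      filter_upwards with v
      simpa using (((hasDerivAt_id' v).const_mul α).add_const β).const_mul (m - 2))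
    (by
      filter_upwards with v
      simpa using (hasDerivAt_id' v).const_mul ((m' - 2) * α))
  have hmm : m' = m := by
    have := mul_right_cancel₀ hα hlin'.self_of_nhds
    linarith
  subst hmm
  refine ⟨rfl, ?_, ?_⟩
  · linear_combination hlin.self_of_nhds
  · have h3 := d2.self_of_nhds
    have hmm : m' * (m' - 1) ≠ 0 := mul_ne_zero hm0 (sub_ne_zero.mpr hm1)
    have : a * (|v₀| ^ m' / v₀ ^ 2) = b * α ^ 2 * (|α * v₀ + β| ^ m' / (α * v₀ + β) ^ 2) := by
      apply mul_left_cancel₀ hmm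
      linear_combination h3
    rw [← mul_div_assoc, ← mul_div_assoc, div_eq_div_iff (pow_ne_zero 2 hv) (pow_ne_zero 2 hV)] at this
    linear_combination this

/-- If the product of an affine function `Y` and a function `ℓ 0` is a quadratic polynomial and
`ℓ 0` is generic, then `Y = 0`. -/
theorem affine_mul_rigidity {Y Y₁ Z Z₁ S : ℝ → ℝ} {ℓ : ℕ → ℝ → ℝ} {k x₀ : ℝ}
    (hℓ : ∀ i, ∀ᶠ x in 𝓝 x₀, HasDerivAt (ℓ i) (ℓ (i + 1) x) x)
    (hY : ∀ᶠ x in 𝓝 x₀, HasDerivAt Y (Y₁ x) x) (hY₁ : ∀ᶠ x in 𝓝 x₀, HasDerivAt Y₁ 0 x)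
    (hZ : ∀ᶠ x in 𝓝 x₀, HasDerivAt Z (Z₁ x) x) (hZ₁ : ∀ᶠ x in 𝓝 x₀, HasDerivAt Z₁ 0 x)
    (hS : ∀ᶠ x in 𝓝 x₀, HasDerivAt S (-Z x / 2) x)
    (hE : ∀ᶠ x in 𝓝 x₀, Y x * ℓ 0 x = -2 * Y₁ x - k * S x - k / 2 * (Y x * Y x))
    (hQ : 4 * ℓ 3 x₀ ^ 2 - 3 * ℓ 2 x₀ * ℓ 4 x₀ ≠ 0) : Y x₀ = 0 ∧ Y₁ x₀ = 0 := by
  -- `Y` and `Z` are affine and `S' = -Z / 2`, so the right-hand side is a quadratic polynomial;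
  -- three differentiations annihilate it and the fourth gives one more equation.
  have d1 := eventually_deriv_eq hE
    (A' := fun x => Y₁ x * ℓ 0 x + Y x * ℓ 1 x)
    (B' := fun x => -2 * 0 - k * (-Z x / 2) - k / 2 * (Y₁ x * Y x + Y x * Y₁ x)) (by
      filter_upwards [hY, hℓ 0] with x h1 h2
      exact h1.mul h2)
    (by
      filter_upwards [hY, hY₁, hS] with x h1 h2 h3
      exact ((h2.const_mul (-2)).sub (h3.const_mul k)).sub ((h1.mul h1).const_mul (k / 2)))
  have d2 := eventually_deriv_eq d1
    (A' := fun x => (0 * ℓ 0 x + Y₁ x * ℓ 1 x) + (Y₁ x * ℓ 1 x + Y x * ℓ 2 x))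
    (B' := fun x => 0 - k * (-Z₁ x / 2) -
      k / 2 * ((0 * Y x + Y₁ x * Y₁ x) + (Y₁ x * Y₁ x + Y x * 0))) (by
      filter_upwards [hY, hY₁, hℓ 0, hℓ 1] with x h1 h2 h3 h4
      exact (h2.mul h3).add (h1.mul h4))
    (by
      filter_upwards [hY, hY₁, hZ] with x h1 h2 h3
      exact ((hasDerivAt_const x (-2 * 0 : ℝ)).sub (((h3.neg).div_const 2).const_mul k)).sub
        (((h2.mul h1).add (h1.mul h2)).const_mul (k / 2)))
  have d2' : ∀ᶠ x in 𝓝 x₀, 2 * (Y₁ x * ℓ 1 x) + Y x * ℓ 2 x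
      = k / 2 * Z₁ x - k * (Y₁ x * Y₁ x) := by
    filter_upwards [d2] with x h
    linear_combination h
  have d3 := eventually_deriv_eq d2'
    (A' := fun x => 2 * (0 * ℓ 1 x + Y₁ x * ℓ 2 x) + (Y₁ x * ℓ 2 x + Y x * ℓ 3 x))
    (B' := fun x => k / 2 * 0 - k * (0 * Y₁ x + Y₁ x * 0)) (by
      filter_upwards [hY, hY₁, hℓ 1, hℓ 2] with x h1 h2 h3 h4
      exact ((h2.mul h3).const_mul 2).add (h1.mul h4))
    (by
      filter_upwards [hY₁, hZ₁] with x h1 h2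
      exact (h2.const_mul (k / 2)).sub ((h1.mul h1).const_mul k))
  have d3' : ∀ᶠ x in 𝓝 x₀, 3 * (Y₁ x * ℓ 2 x) + Y x * ℓ 3 x = 0 := by
    filter_upwards [d3] with x h
    linear_combination h
  have d4 := eventually_deriv_eq d3'
    (A' := fun x => 3 * (0 * ℓ 2 x + Y₁ x * ℓ 3 x) + (Y₁ x * ℓ 3 x + Y x * ℓ 4 x))
    (B' := fun _ => 0) (by
      filter_upwards [hY, hY₁, hℓ 2, hℓ 3] with x h1 h2 h3 h4
      exact ((h2.mul h3).const_mul 3).add (h1.mul h4))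
    (by
      filter_upwards with x
      exact hasDerivAt_const x 0)
  -- The third and fourth derivatives form a homogeneous linear system for `(Y, Y₁)` with rows `(ℓ
  -- 3, 3 ℓ 2)` and `(ℓ 4, 4 ℓ 3)`; its determinant is the quantity in `hQ`.
  have h3 := d3'.self_of_nhds
  have h4 := d4.self_of_nhds
  constructor
  · refine (mul_eq_zero.mp (?_ : Y x₀ * (4 * ℓ 3 x₀ ^ 2 - 3 * ℓ 2 x₀ * ℓ 4 x₀) = 0)).resolve_right hQ
    linear_combination 4 * ℓ 3 x₀ * h3 - 3 * ℓ 2 x₀ * h4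
  · refine (mul_eq_zero.mp (?_ : Y₁ x₀ * (4 * ℓ 3 x₀ ^ 2 - 3 * ℓ 2 x₀ * ℓ 4 x₀) = 0)).resolve_right hQ
    linear_combination ℓ 3 x₀ * h4 - ℓ 4 x₀ * h3

/-- A function with vanishing second derivative is affine. -/
theorem eventually_affine {φ φ₁ : ℝ → ℝ} {x₀ : ℝ} (h : ∀ᶠ x in 𝓝 x₀, HasDerivAt φ (φ₁ x) x)
    (h₁ : ∀ᶠ x in 𝓝 x₀, HasDerivAt φ₁ 0 x) :
    ∀ᶠ x in 𝓝 x₀, φ x = φ₁ x₀ * x + (φ x₀ - φ₁ x₀ * x₀) := by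
  obtain ⟨ε, hε, hball⟩ := Metric.eventually_nhds_iff_ball.mp (h.and h₁)
  have hpre : IsPreconnected (Metric.ball x₀ ε) := (convex_ball x₀ ε).isPreconnected
  have hx₀ : x₀ ∈ Metric.ball x₀ ε := Metric.mem_ball_self hε
  have c1 : ∀ x ∈ Metric.ball x₀ ε, φ₁ x = φ₁ x₀ := fun x hx =>
    Metric.isOpen_ball.is_const_of_deriv_eq_zero hpre
      (fun y hy => (hball y hy).2.differentiableAt.differentiableWithinAt)
      (fun y hy => (hball y hy).2.deriv) hx hx₀
  have c2 : ∀ x ∈ Metric.ball x₀ ε, φ x - φ₁ x₀ * x = φ x₀ - φ₁ x₀ * x₀ := fun x hx => by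
    have hd : ∀ y ∈ Metric.ball x₀ ε, HasDerivAt (fun y => φ y - φ₁ x₀ * y) 0 y := by
      intro y hy
      refine ((hball y hy).1.sub ((hasDerivAt_id' y).const_mul (φ₁ x₀))).congr_deriv ?_
      rw [c1 y hy]
      ring
    exact Metric.isOpen_ball.is_const_of_deriv_eq_zero hpre
      (fun y hy => (hd y hy).differentiableAt.differentiableWithinAt)
      (fun y hy => (hd y hy).deriv) hx hx₀
  filter_upwards [Metric.ball_mem_nhds x₀ hε] with x hx
  linear_combination c2 x hx

/-! ### Local form of a point transformation between equations of the class -/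

/-- `f` is a nondegenerate smooth transformation mapping `θ` to `θ'`, and `O` is an open part of
the domain of `θ` where neither `v` nor its image vanishes. -/
structure LocalMap {D : Set ℝ} (f : Pt → Pt) (θ θ' : Eqn D) (O : Set Pt) : Prop where
  isOpen : IsOpen O
  mem_dom : ∀ p ∈ O, p ∈ θ.dom
  map_mem : ∀ p ∈ O, f p ∈ θ'.dom
  smooth : ∀ p ∈ O, ContDiffAt ℝ ∞ f p
  v_ne : ∀ p ∈ O, p.2.2 ≠ 0
  V_ne : ∀ p ∈ O, compV f p ≠ 0
  det_ne : ∀ p ∈ O, jacDet (compT f) (compX f) (compV f) p ≠ 0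
  map : MapsEquation f θ θ'

namespace LocalMap

variable {D : Set ℝ} {f : Pt → Pt} {θ θ' : Eqn D} {O : Set Pt}

/-- The right-hand side of the equation without `v_xx`. -/
def source (θ : Eqn D) (x v : ℝ) : ℝ := θ.H x * |v| ^ θ.m + θ.F x * v

/-- The choice `u_t = u_xx + source` puts the jet on the first equation while `b`, `r`, `l` stay
free; the following lemmas vary them. -/
theorem jet_eq (h : LocalMap f θ θ' O) {p : Pt} (hp : p ∈ O) {b : ℝ} (r l : ℝ)
    (hJ : jetJac f p (r + source θ p.2.1 p.2.2) b ≠ 0) :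
    jetVt f p (r + source θ p.2.1 p.2.2) b =
      jetVxx f p (r + source θ p.2.1 p.2.2) b r l + source θ' (compX f p) (compV f p) := by
  have := (h.map.jet (h.mem_dom p hp) (h.smooth p hp) (h.v_ne p hp) (h.V_ne p hp)
    (r := r) (l := l) hJ).mp (by unfold Eqn.Holds source; ring)
  unfold Eqn.Holds at this
  unfold source at this ⊢
  linarith

/-- Changing `u_tt` from `0` to `1` affects only the new `v_xx`, where the coefficient of `u_tt` is
`(D_x T)²` times the Jacobian determinant of `f`, up to sign and a power of the total Jacobian. -/
theorem totX_T_eq_zero (h : LocalMap f θ θ' O) {p : Pt} (hp : p ∈ O) {a b : ℝ}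
    (hJ : jetJac f p a b ≠ 0) : jX p b (compT f) = 0 := by
  set R := source θ p.2.1 p.2.2
  have hJ' : jetJac f p ((a - R) + source θ p.2.1 p.2.2) b ≠ 0 := by simpa [R] using hJ
  have e0 := h.jet_eq hp (a - R) 0 hJ'
  have e1 := h.jet_eq hp (a - R) 1 hJ'
  have ha : (a - R) + source θ p.2.1 p.2.2 = a := by simp [R]
  rw [ha] at e0 e1
  have e2 : jetVxx f p a b (a - R) 0 = jetVxx f p a b (a - R) 1 := by linarith
  unfold jetVxx at e2
  rw [div_left_inj' hJ, sub_right_inj, div_mul_eq_mul_div, div_mul_eq_mul_div,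
    div_left_inj' (pow_ne_zero 2 hJ)] at e2
  have key : jX p b (compT f) ^ 2 * jacDet (compT f) (compX f) (compV f) p = 0 := by
    unfold jetNumT jetJacT jetNum jetJac jTT jTX jT jX at e2
    unfold jX jacDet
    linear_combination e2
  have := (mul_eq_zero.mp key).resolve_right (h.det_ne p hp)
  exact pow_eq_zero_iff (two_ne_zero) |>.mp this

/-- The new time depends only on `t`. -/
theorem T_x_T_v (h : LocalMap f θ θ' O) {p : Pt} (hp : p ∈ O) :
    pd eX (compT f) p = 0 ∧ pd eV (compT f) p = 0 := by
  -- The factor `jetJac` makes the identity valid for all `a`, `b`. It is then polynomial in them,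
  -- and a few values yield its coefficients.
  have key : ∀ a b : ℝ, (pd eX (compT f) p + b * pd eV (compT f) p) * jetJac f p a b = 0 := by
    intro a b
    by_cases hJ : jetJac f p a b = 0
    · rw [hJ, mul_zero]
    · have := h.totX_T_eq_zero hp hJ
      unfold jX at this
      rw [this, zero_mul]
  have hdet := h.det_ne p hp
  have k00 := key 0 0
  have k10 := key 1 0
  have k01 := key 0 1
  have k02 := key 0 (-1)
  have k11 := key 1 1
  unfold jetJac jT jX at k00 k10 k01 k02 k11
  unfold jacDet at hdet
  generalize pd eT (compT f) p = Tt at *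
  generalize pd eX (compT f) p = A at *
  generalize pd eV (compT f) p = B at *
  generalize pd eT (compX f) p = Xt at *
  generalize pd eX (compX f) p = Xx at *
  generalize pd eV (compX f) p = Xv at *
  generalize pd eT (compV f) p = Vt at *
  generalize pd eX (compV f) p = Vx at *
  generalize pd eV (compV f) p = Vv at *
  -- The total Jacobian is `j0 + a j1 + b j2`; these coefficients are, up to sign, also the minors
  -- in the expansion of the Jacobian determinant along the row of `V` (`hd`). Hence `l1`–`l5` are
  -- the coefficients of `(A + b B)(j0 + a j1 + b j2)`.
  obtain ⟨j0, hj0⟩ : ∃ j, j = Tt * Xx - A * Xt := ⟨_, rfl⟩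
  obtain ⟨j1, hj1⟩ : ∃ j, j = B * Xx - A * Xv := ⟨_, rfl⟩
  obtain ⟨j2, hj2⟩ : ∃ j, j = Tt * Xv - B * Xt := ⟨_, rfl⟩
  have l1 : A * j0 = 0 := by rw [hj0]; linear_combination k00
  have l2 : A * j1 = 0 := by rw [hj1]; linear_combination k10 - k00
  have l3 : A * j2 + B * j0 = 0 := by rw [hj0, hj2]; linear_combination (k01 - k02) / 2
  have l4 : B * j2 = 0 := by rw [hj2]; linear_combination (k01 + k02) / 2 - k00
  have l5 : B * j1 = 0 := by rw [hj1]; linear_combination k11 - k01 - k10 + k00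
  have hd : Vv * j0 - Vx * j2 - Vt * j1 ≠ 0 := by
    rw [hj0, hj1, hj2]
    intro h0
    apply hdet
    linear_combination h0
  constructor
  · have : A ^ 2 * (Vv * j0 - Vx * j2 - Vt * j1) = 0 := by
      linear_combination A * Vv * l1 - A * Vt * l2 - Vx * A * l3 + Vx * B * l1
    exact pow_eq_zero_iff (two_ne_zero) |>.mp ((mul_eq_zero.mp this).resolve_right hd)
  · have : B ^ 2 * (Vv * j0 - Vx * j2 - Vt * j1) = 0 := by
      linear_combination Vv * B * l3 - A * Vv * l4 - Vx * B * l4 - Vt * B * l5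
    exact pow_eq_zero_iff (two_ne_zero) |>.mp ((mul_eq_zero.mp this).resolve_right hd)

section
variable (h : LocalMap f θ θ' O) {p : Pt} (hp : p ∈ O)
include h hp

theorem smoothT : ContDiffAt ℝ ∞ (compT f) p := contDiffAt_compT (h.smooth p hp)
theorem smoothX : ContDiffAt ℝ ∞ (compX f) p := contDiffAt_compX (h.smooth p hp)
theorem smoothV : ContDiffAt ℝ ∞ (compV f) p := contDiffAt_compV (h.smooth p hp)

theorem pd_T_x (e : Pt) : pd e (pd eX (compT f)) p = 0 :=
  pd_eq_zero_of_eqOn h.isOpen (fun _ hq => (h.T_x_T_v hq).1) e p hp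

theorem pd_T_v (e : Pt) : pd e (pd eV (compT f)) p = 0 :=
  pd_eq_zero_of_eqOn h.isOpen (fun _ hq => (h.T_x_T_v hq).2) e p hp

theorem pd_x_T (e : Pt) : pd eX (pd e (compT f)) p = 0 := by
  rw [pd_comm _ _ (h.smoothT hp), h.pd_T_x hp]

theorem pd_v_T (e : Pt) : pd eV (pd e (compT f)) p = 0 := by
  rw [pd_comm _ _ (h.smoothT hp), h.pd_T_v hp]

theorem jX_T (b : ℝ) : jX p b (compT f) = 0 := by
  simp [jX, (h.T_x_T_v hp).1, (h.T_x_T_v hp).2]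

theorem jT_T (a : ℝ) : jT p a (compT f) = pd eT (compT f) p := by
  simp [jT, (h.T_x_T_v hp).2]

theorem jXX_T (b r : ℝ) : jXX p b r (compT f) = 0 := by
  simp [jXX, (h.T_x_T_v hp).2, h.pd_T_x hp, h.pd_T_v hp]

theorem jXT_T (a b : ℝ) : jXT p a b (compT f) = 0 := by
  simp [jXT, h.pd_x_T hp, h.pd_v_T hp]

theorem T_t_ne : pd eT (compT f) p ≠ 0 := by
  intro h0
  apply h.det_ne p hp
  simp [jacDet, (h.T_x_T_v hp).1, (h.T_x_T_v hp).2, h0]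

theorem det₂_ne : pd eX (compX f) p * pd eV (compV f) p - pd eV (compX f) p * pd eX (compV f) p ≠ 0 := by
  intro h0
  apply h.det_ne p hp
  simp [jacDet, (h.T_x_T_v hp).1, (h.T_x_T_v hp).2, h0]

theorem jetJac_eq (a b : ℝ) : jetJac f p a b = pd eT (compT f) p * jX p b (compX f) := by
  simp [jetJac, h.jX_T hp, h.jT_T hp]

theorem jetVxx_eq {a b : ℝ} (r l : ℝ) (hX : jX p b (compX f) ≠ 0) :
    jetVxx f p a b r l = (jXX p b r (compV f) * jX p b (compX f)
      - jX p b (compV f) * jXX p b r (compX f)) / jX p b (compX f) ^ 3 := by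
  have hT := h.T_t_ne hp
  unfold jetVxx
  rw [h.jetJac_eq hp]
  unfold jetNumX jetNum jetJacX
  rw [h.jX_T hp, h.jT_T hp, h.jXX_T hp, h.jXT_T hp]
  field_simp
  ring

/-- The equation for the components of `f`, with the third power of `D_x X` as a common
denominator. -/
theorem reduced_eq {b : ℝ} (r : ℝ) (hX : jX p b (compX f) ≠ 0) :
    (jT p (r + source θ p.2.1 p.2.2) (compV f) * jX p b (compX f)
      - jX p b (compV f) * jT p (r + source θ p.2.1 p.2.2) (compX f)) * jX p b (compX f) ^ 2
      = pd eT (compT f) p * (jXX p b r (compV f) * jX p b (compX f)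
        - jX p b (compV f) * jXX p b r (compX f)
        + jX p b (compX f) ^ 3 * source θ' (compX f p) (compV f p)) := by
  have hT := h.T_t_ne hp
  have hJ := mul_ne_zero hT hX
  have e := h.jet_eq hp (b := b) r 0 (by rw [h.jetJac_eq hp]; exact hJ)
  rw [h.jetVxx_eq hp _ _ hX] at e
  unfold jetVt at e
  rw [h.jetJac_eq hp] at e
  generalize jT p (r + source θ p.2.1 p.2.2) (compV f) = s1 at *
  generalize jT p (r + source θ p.2.1 p.2.2) (compX f) = s2 at *
  generalize jX p b (compX f) = s3 at *
  generalize jX p b (compV f) = s4 at *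
  generalize jXX p b r (compV f) = s5 at *
  generalize jXX p b r (compX f) = s6 at *
  generalize source θ' (compX f p) (compV f p) = s7 at *
  generalize pd eT (compT f) p = s8 at *
  field_simp at e
  linear_combination e

/-- Comparing `u_xx = 0` with `u_xx = 1`: the coefficient of `u_xx` is `(D_x X)² - T_t` times the
minor of `det₂_ne`, in which `u_x` cancels. -/
theorem sq_jX_X {b : ℝ} (hX : jX p b (compX f) ≠ 0) :
    jX p b (compX f) ^ 2 = pd eT (compT f) p := by
  have e0 := h.reduced_eq hp 0 hX
  have e1 := h.reduced_eq hp 1 hX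
  have key : (pd eX (compX f) p * pd eV (compV f) p - pd eV (compX f) p * pd eX (compV f) p)
      * (jX p b (compX f) ^ 2 - pd eT (compT f) p) = 0 := by
    unfold jXX jT jX at e0 e1
    unfold jX
    linear_combination e1 - e0
  exact sub_eq_zero.mp ((mul_eq_zero.mp key).resolve_left (h.det₂_ne hp))

/-- The new space variable does not depend on `v`, and `X_x² = T_t`. -/
theorem X_v_X_x : pd eV (compX f) p = 0 ∧ pd eX (compX f) p ≠ 0 ∧
    pd eX (compX f) p ^ 2 = pd eT (compT f) p := by
  have hv : pd eV (compX f) p = 0 := by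
    -- If `X_v ≠ 0`, then `D_x X` takes every value as `u_x` varies, while the squares of its
    -- nonzero values all equal `T_t`.
    by_contra hv
    have key : ∀ c : ℝ, c ≠ 0 → c ^ 2 = pd eT (compT f) p := by
      intro c hc
      have e : jX p ((c - pd eX (compX f) p) / pd eV (compX f) p) (compX f) = c := by
        unfold jX
        field_simp
        ring
      have := h.sq_jX_X hp (b := (c - pd eX (compX f) p) / pd eV (compX f) p) (by rwa [e])
      rwa [e] at this
    have h1 := key 1 one_ne_zero
    have h2 := key 2 two_ne_zero
    linarith
  have hx : pd eX (compX f) p ≠ 0 := by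
    intro h0
    apply h.det₂_ne hp
    simp [hv, h0]
  refine ⟨hv, hx, ?_⟩
  have := h.sq_jX_X hp (b := 0) (by simpa [jX] using hx)
  simpa [jX] using this

theorem V_v_ne : pd eV (compV f) p ≠ 0 := by
  intro h0
  apply h.det₂_ne hp
  simp [(h.X_v_X_x hp).1, h0]

theorem pd_X_v (e : Pt) : pd e (pd eV (compX f)) p = 0 :=
  pd_eq_zero_of_eqOn h.isOpen (fun _ hq => (h.X_v_X_x hq).1) e p hp

theorem pd_v_X (e : Pt) : pd eV (pd e (compX f)) p = 0 := by
  rw [pd_comm _ _ (h.smoothX hp), h.pd_X_v hp]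

theorem X_e_mul (e : Pt) : 2 * pd eX (compX f) p * pd e (pd eX (compX f)) p
    = pd e (pd eT (compT f)) p := by
  have hs := pd_contDiffAt eX (h.smoothX hp)
  have := pd_eq_of_eqOn h.isOpen (g := fun p => pd eX (compX f) p * pd eX (compX f) p)
    (g' := pd eT (compT f)) (fun q hq => by rw [← (h.X_v_X_x hq).2.2]; ring) e p hp
  rw [pd_mul e hs hs] at this
  linear_combination this

/-- In `X_x² = T_t` the right-hand side does not depend on `x`. -/
theorem X_xx : pd eX (pd eX (compX f)) p = 0 := by
  have := h.X_e_mul hp eX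
  rw [h.pd_x_T hp] at this
  exact (mul_eq_zero.mp this).resolve_left (mul_ne_zero two_ne_zero (h.X_v_X_x hp).2.1)

/-- The determining equations obtained by splitting with respect to `v_x`. -/
theorem determining :
    pd eV (pd eV (compV f)) p = 0 ∧
    2 * pd eX (compX f) p * pd eX (pd eV (compV f)) p
      = - pd eV (compV f) p * pd eT (compX f) p ∧
    (pd eT (compV f) p + source θ p.2.1 p.2.2 * pd eV (compV f) p) * pd eX (compX f) p
      - pd eX (compV f) p * pd eT (compX f) p
      = pd eX (compX f) p * pd eX (pd eX (compV f)) p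
        + pd eX (compX f) p ^ 3 * source θ' (compX f p) (compV f p) := by
  obtain ⟨hv, hx, hT⟩ := h.X_v_X_x hp
  have hX : ∀ b, jX p b (compX f) = pd eX (compX f) p := by
    intro b
    simp [jX, hv]
  have hXX : ∀ b r, jXX p b r (compX f) = 0 := by
    intro b r
    simp [jXX, hv, h.X_xx hp, h.pd_v_X hp, h.pd_X_v hp]
  have key : ∀ b, (jT p (source θ p.2.1 p.2.2) (compV f) * pd eX (compX f) p
      - jX p b (compV f) * pd eT (compX f) p)
      = jXX p b 0 (compV f) * pd eX (compX f) p
        + pd eX (compX f) p ^ 3 * source θ' (compX f p) (compV f p) := by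
    intro b
    have := h.reduced_eq hp (b := b) 0 (by rwa [hX])
    rw [hX, hXX, ← hT, zero_add] at this
    have e : jT p (source θ p.2.1 p.2.2) (compX f) = pd eT (compX f) p := by simp [jT, hv]
    rw [e] at this
    apply mul_left_cancel₀ (pow_ne_zero 2 hx)
    linear_combination this
  have hc : pd eV (pd eX (compV f)) p = pd eX (pd eV (compV f)) p := pd_comm _ _ (h.smoothV hp)
  -- At `u_xx = 0` the identity is a quadratic polynomial in `u_x`; its values at `0`, `1` and `-1`
  -- determine the three coefficients.
  have k0 := key 0
  have k1 := key 1
  have k2 := key (-1)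
  unfold jXX jX jT at k0 k1 k2
  rw [hc] at k0 k1 k2
  refine ⟨?_, ?_, ?_⟩
  · apply mul_left_cancel₀ hx
    linear_combination k0 - (k1 + k2) / 2
  · linear_combination (k2 - k1) / 2
  · linear_combination k0

end

end LocalMap

/-! ### Genericity of `log |H|`, and the first-order conditions. -/

theorem isOpen_xProj {U : Set Pt} (hU : IsOpen U) : IsOpen (xProj U) :=
  (isOpenMap_fst.comp isOpenMap_snd) U hU

theorem mem_xProj {U : Set Pt} {p : Pt} (hp : p ∈ U) : p.2.1 ∈ xProj U := ⟨p, hp, rfl⟩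

/-- `log |H|` as a function of `x`. -/
def Eqn.logH {D : Set ℝ} (θ : Eqn D) (x : ℝ) : ℝ := Real.log (θ.H x)

theorem Eqn.contDiffAt_logH {D : Set ℝ} (θ : Eqn D) {x : ℝ} (hx : x ∈ xProj θ.dom) :
    ContDiffAt ℝ ∞ θ.logH x :=
  (θ.smooth_H.contDiffAt ((isOpen_xProj θ.isOpen_dom).mem_nhds hx)).log (θ.H_ne_zero x hx)

/-- A condition on the derivatives of `log |H|` at `x` which excludes that the product of `(log |H|)'`
and an affine function of `x` is a quadratic polynomial. -/
def Eqn.Generic {D : Set ℝ} (θ : Eqn D) (x : ℝ) : Prop :=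
  4 * iteratedDeriv 4 θ.logH x ^ 2 - 3 * iteratedDeriv 3 θ.logH x * iteratedDeriv 5 θ.logH x ≠ 0

theorem contDiffAt_iteratedDeriv {φ : ℝ → ℝ} {x : ℝ} (h : ContDiffAt ℝ ∞ φ x) (n : ℕ) :
    ContDiffAt ℝ ∞ (iteratedDeriv n φ) x := by
  induction n with
  | zero => simpa using h
  | succ n ih =>
    rw [iteratedDeriv_succ]
    exact (ih.fderiv_right (m := ∞) (by simp)).clm_apply contDiffAt_const

theorem hasDerivAt_iteratedDeriv {φ : ℝ → ℝ} {x : ℝ} (h : ContDiffAt ℝ ∞ φ x) (n : ℕ) :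
    HasDerivAt (iteratedDeriv n φ) (iteratedDeriv (n + 1) φ x) x := by
  rw [iteratedDeriv_succ]
  exact (differentiableAt_of_smooth (contDiffAt_iteratedDeriv h n)).hasDerivAt

/-- The conditions on the first derivatives which characterize the explicit transformations. -/
structure FirstOrder (f : Pt → Pt) (p : Pt) : Prop where
  T_x : pd eX (compT f) p = 0
  T_v : pd eV (compT f) p = 0
  X_v : pd eV (compX f) p = 0
  X_t : pd eT (compX f) p = 0
  V_t : pd eT (compV f) p = 0
  V_x : pd eX (compV f) p = 0
  T_t : pd eX (compX f) p ^ 2 = pd eT (compT f) p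
  V_v : compV f p = p.2.2 * pd eV (compV f) p

/-- Being affine in the direction `e` is inherited by all partial derivatives, as partial
derivatives commute. -/
theorem pd_pd_pd_eq_zero {g : Pt → ℝ} {O : Set Pt} (hO : IsOpen O)
    (hg : ∀ p ∈ O, ContDiffAt ℝ ∞ g p) {e : Pt} (h : ∀ p ∈ O, pd e (pd e g) p = 0) (e' : Pt) :
    ∀ p ∈ O, pd e (pd e (pd e' g)) p = 0 := by
  intro p hp
  rw [pd_eq_of_eqOn hO (fun q hq => pd_comm e e' (hg q hq)) e p hp,
    pd_comm e e' (pd_contDiffAt e (hg p hp))]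
  exact pd_eq_zero_of_eqOn hO h e' p hp

theorem eventually_mem_lineV {O : Set Pt} (hO : IsOpen O) {t x v : ℝ} (hp : (t, x, v) ∈ O) :
    ∀ᶠ w in 𝓝 v, (t, x, w) ∈ O :=
  (by fun_prop : Continuous fun w : ℝ => ((t, x, w) : Pt)).continuousAt.eventually (hO.mem_nhds hp)

theorem eventually_mem_lineX {O : Set Pt} (hO : IsOpen O) {t x v : ℝ} (hp : (t, x, v) ∈ O) :
    ∀ᶠ w in 𝓝 x, (t, w, v) ∈ O :=
  (by fun_prop : Continuous fun w : ℝ => ((t, w, v) : Pt)).continuousAt.eventually (hO.mem_nhds hp)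

theorem eventually_affine_lineV {g : Pt → ℝ} {O : Set Pt} (hO : IsOpen O)
    (hg : ∀ p ∈ O, ContDiffAt ℝ ∞ g p) (h : ∀ p ∈ O, pd eV (pd eV g) p = 0) {t x v : ℝ}
    (hp : (t, x, v) ∈ O) :
    ∀ᶠ w in 𝓝 v, g (t, x, w)
      = pd eV g (t, x, v) * w + (g (t, x, v) - pd eV g (t, x, v) * v) := by
  refine eventually_affine (φ := fun w => g (t, x, w)) (φ₁ := fun w => pd eV g (t, x, w)) ?_ ?_
  · filter_upwards [eventually_mem_lineV hO hp] with w hw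
    exact hasDerivAt_lineV (differentiableAt_of_smooth (hg _ hw))
  · filter_upwards [eventually_mem_lineV hO hp] with w hw
    rw [← h _ hw]
    exact hasDerivAt_lineV (differentiableAt_of_smooth (pd_contDiffAt eV (hg _ hw)))

/-! ### Splitting with respect to `v`, and the relation restricting `H`. -/

namespace LocalMap

variable {D : Set ℝ} {f : Pt → Pt} {θ θ' : Eqn D} {O : Set Pt}

section
variable (h : LocalMap f θ θ' O) (hm : θ.m ≠ 2) {p : Pt} (hp : p ∈ O)
include h hm hp

/-- Splitting the last determining equation with respect to `v`. -/
theorem splitting : θ'.m = θ.m ∧ compV f p = p.2.2 * pd eV (compV f) p ∧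
    θ.H p.2.1 * pd eV (compV f) p * |p.2.2| ^ θ.m
      = pd eT (compT f) p * θ'.H (compX f p) * |compV f p| ^ θ.m := by
  obtain ⟨t, x, v⟩ := p
  have hv : v ≠ 0 := h.v_ne _ hp
  have hV := h.V_ne _ hp
  obtain ⟨-, hx, hT⟩ := h.X_v_X_x hp
  have hα := h.V_v_ne hp
  have hH : θ.H x ≠ 0 := θ.H_ne_zero x (mem_xProj (h.mem_dom _ hp))
  have sV : ∀ q ∈ O, ContDiffAt ℝ ∞ (compV f) q := fun q hq => h.smoothV hq
  have sX : ∀ q ∈ O, ContDiffAt ℝ ∞ (compX f) q := fun q hq => h.smoothX hq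
  have V_vv : ∀ q ∈ O, pd eV (pd eV (compV f)) q = 0 := fun q hq => (h.determining hq).1
  have V_evv := pd_pd_pd_eq_zero h.isOpen sV V_vv
  have sVx : ∀ q ∈ O, ContDiffAt ℝ ∞ (pd eX (compV f)) q := fun q hq => pd_contDiffAt eX (sV q hq)
  -- Along the `v`-line through the point, `V` and its derivatives in the third determining equation
  -- are affine in `v`, and `X`, `X_t`, `X_x` are constant. The equation thus takes the form
  -- required by `power_rigidity`.
  have lV := eventually_affine_lineV h.isOpen sV V_vv hp
  have lVv := eventually_affine_lineV h.isOpen (fun q hq => pd_contDiffAt eV (sV q hq))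
    (V_evv eV) hp
  have lVt := eventually_affine_lineV h.isOpen (fun q hq => pd_contDiffAt eT (sV q hq))
    (V_evv eT) hp
  have lVx := eventually_affine_lineV h.isOpen sVx (V_evv eX) hp
  have lVxx := eventually_affine_lineV h.isOpen (fun q hq => pd_contDiffAt eX (sVx q hq))
    (pd_pd_pd_eq_zero h.isOpen sVx (V_evv eX) eX) hp
  have X_vv : ∀ q ∈ O, pd eV (pd eV (compX f)) q = 0 := fun q hq => h.pd_X_v hq eV
  have X_evv := pd_pd_pd_eq_zero h.isOpen sX X_vv
  have lX := eventually_affine_lineV h.isOpen sX X_vv hp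
  have lXt := eventually_affine_lineV h.isOpen (fun q hq => pd_contDiffAt eT (sX q hq))
    (X_evv eT) hp
  have lXx := eventually_affine_lineV h.isOpen (fun q hq => pd_contDiffAt eX (sX q hq))
    (X_evv eX) hp
  rw [(h.X_v_X_x hp).1] at lX
  rw [h.pd_v_X hp] at lXt lXx
  rw [V_vv _ hp] at lVv
  simp only [zero_mul, zero_add, sub_zero] at lX lXt lXx lVv
  have hdet := eventually_mem_lineV h.isOpen hp
  set α := pd eV (compV f) (t, x, v) with hαdef
  obtain ⟨β, hβ⟩ : ∃ β, β = compV f (t, x, v) - α * v := ⟨_, rfl⟩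
  have hVβ : compV f (t, x, v) = α * v + β := by rw [hβ]; ring
  rw [← hβ] at lV
  generalize compX f (t, x, v) = ξ at *
  generalize pd eT (compX f) (t, x, v) = Xt at *
  generalize pd eX (compX f) (t, x, v) = Xx at *
  generalize pd eV (pd eT (compV f)) (t, x, v) = t1 at *
  generalize pd eT (compV f) (t, x, v) - t1 * v = t0 at *
  generalize pd eV (pd eX (compV f)) (t, x, v) = x1 at *
  generalize pd eX (compV f) (t, x, v) - x1 * v = x0 at *
  generalize pd eV (pd eX (pd eX (compV f))) (t, x, v) = s1 at *
  generalize pd eX (pd eX (compV f)) (t, x, v) - s1 * v = s0 at *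
  have key : ∀ᶠ w in 𝓝 v, θ.H x * α * Xx * |w| ^ θ.m
      - Xx ^ 3 * θ'.H ξ * |α * w + β| ^ θ'.m
      = (Xx * s1 + Xx ^ 3 * θ'.F ξ * α + x1 * Xt - t1 * Xx - θ.F x * α * Xx) * w
        + (Xx * s0 + Xx ^ 3 * θ'.F ξ * β + x0 * Xt - t0 * Xx) := by
    filter_upwards [hdet, lV, lVv, lVt, lVx, lVxx, lX, lXt, lXx] with w hw e1 e2 e3 e4 e5 e6 e7 e8
    have := (h.determining hw).2.2
    simp only [e1, e2, e3, e4, e5, e6, e7, e8, source] at this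
    linear_combination this
  obtain ⟨hmm, hβ0, hpow⟩ := power_rigidity hv (by rwa [← hVβ])
    (mul_ne_zero (mul_ne_zero hH hα) hx) hα θ.m_ne_zero θ.m_ne_one key
  -- For `m = 2` a shift of `v` changes the nonlinearity only by an affine function of `v`, so `β`
  -- could not be excluded here.
  have hβ1 : β = 0 := (mul_eq_zero.mp hβ0).resolve_left (sub_ne_zero.mpr hm)
  refine ⟨hmm, ?_, ?_⟩
  · rw [hVβ, hβ1]
    ring
  · rw [hβ1] at hpow hVβ
    rw [add_zero] at hpow hVβ
    rw [hVβ]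
    rw [← hT]
    have hne : Xx * (α * v) ^ 2 ≠ 0 := mul_ne_zero hx (pow_ne_zero 2 (mul_ne_zero hα hv))
    apply mul_left_cancel₀ hne
    linear_combination hpow

/-- The logarithm makes the relation of `splitting` between the two functions `H` additive, and `V =
v V_v` eliminates `V_v`. Signs play no role since `Real.log` only sees the modulus. -/
theorem logs : θ.logH p.2.1 + (θ.m - 1) * Real.log p.2.2
    = Real.log (pd eT (compT f) p) + θ'.logH (compX f p) + (θ.m - 1) * Real.log (compV f p) := by
  obtain ⟨-, h2, h3⟩ := h.splitting hm hp
  have hv := h.v_ne p hp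
  have hα := h.V_v_ne hp
  have hV := h.V_ne p hp
  have hH : θ.H p.2.1 ≠ 0 := θ.H_ne_zero _ (mem_xProj (h.mem_dom _ hp))
  have hH' : θ'.H (compX f p) ≠ 0 := θ'.H_ne_zero _ (mem_xProj (h.map_mem _ hp))
  have hT := h.T_t_ne hp
  have e := congrArg Real.log h3
  rw [Real.log_mul (mul_ne_zero hH hα) (abs_rpow_ne_zero _ hv), Real.log_mul hH hα,
    Real.log_mul (mul_ne_zero hT hH') (abs_rpow_ne_zero _ hV), Real.log_mul hT hH',
    Real.log_rpow (abs_pos.mpr hv), Real.log_rpow (abs_pos.mpr hV), Real.log_abs,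
    Real.log_abs] at e
  have e2 := congrArg Real.log h2
  rw [Real.log_mul hv hα] at e2
  unfold Eqn.logH
  linear_combination e + e2

/-- These are the `t`- and `x`-derivatives of `logs`. The number `k` is the logarithmic derivative
of the new `H` at the image point; being common to both equations, it can be eliminated. -/
theorem log_derivs : ∃ k,
    0 = pd eT (pd eT (compT f)) p / pd eT (compT f) p + k * pd eT (compX f) p
      + (θ.m - 1) * (pd eT (compV f) p / compV f p) ∧
    iteratedDeriv 1 θ.logH p.2.1
      = k * pd eX (compX f) p + (θ.m - 1) * (pd eX (compV f) p / compV f p) := by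
  have c1 := θ.contDiffAt_logH (mem_xProj (h.mem_dom _ hp))
  have c2 := θ'.contDiffAt_logH (mem_xProj (h.map_mem _ hp))
  have d1 : HasDerivAt θ.logH (iteratedDeriv 1 θ.logH p.2.1) p.2.1 := by
    simpa using hasDerivAt_iteratedDeriv c1 0
  have d2 := (differentiableAt_of_smooth c2).hasDerivAt
  have hv := h.v_ne p hp
  have hV := h.V_ne p hp
  have hT := h.T_t_ne hp
  have sTt := pd_contDiffAt eT (h.smoothT hp)
  have a1 : ContDiffAt ℝ ∞ (fun p : Pt => θ.logH p.2.1) p :=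
    ContDiffAt.comp p (g := θ.logH) c1 (contDiffAt_coordX p)
  have a2 : ContDiffAt ℝ ∞ (fun p : Pt => (θ.m - 1) * Real.log p.2.2) p :=
    contDiffAt_const.mul ((contDiffAt_coordV p).log hv)
  have a3 := sTt.log hT
  have a4 : ContDiffAt ℝ ∞ (fun p : Pt => θ'.logH (compX f p)) p :=
    ContDiffAt.comp p (g := θ'.logH) c2 (h.smoothX hp)
  have a5 : ContDiffAt ℝ ∞ (fun p : Pt => (θ.m - 1) * Real.log (compV f p)) p :=
    contDiffAt_const.mul ((h.smoothV hp).log hV)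
  have key : ∀ e, iteratedDeriv 1 θ.logH p.2.1 * e.2.1 + (θ.m - 1) * p.2.2⁻¹ * e.2.2
      = (pd eT (compT f) p)⁻¹ * pd e (pd eT (compT f)) p
        + deriv θ'.logH (compX f p) * pd e (compX f) p
        + (θ.m - 1) * (compV f p)⁻¹ * pd e (compV f) p := by
    intro e
    have := pd_eq_of_eqOn h.isOpen (fun q hq => h.logs hm hq) e p hp
    rw [pd_add e a1 a2, pd_add e (a3.add a4) a5, pd_add e a3 a4,
      pd_comp e d1 (contDiffAt_coordX p),
      pd_comp e ((Real.hasDerivAt_log hv).const_mul (θ.m - 1)) (contDiffAt_coordV p),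
      pd_comp e (Real.hasDerivAt_log hT) sTt, pd_comp e d2 (h.smoothX hp),
      pd_comp e ((Real.hasDerivAt_log hV).const_mul (θ.m - 1)) (h.smoothV hp),
      pd_coordX, pd_coordV] at this
    exact this
  refine ⟨deriv θ'.logH (compX f p), ?_, ?_⟩
  · have := key eT
    simp only [eT, mul_zero, add_zero] at this
    rw [this]
    simp only [eT]
    ring
  · have := key eX
    rw [h.pd_x_T hp] at this
    simp only [eX, mul_zero, add_zero, mul_one] at this
    rw [this]
    simp only [eX]
    ring

end

/-- The ratio `X_t / X_x`. -/
def ratio (f : Pt → Pt) (p : Pt) : ℝ := pd eT (compX f) p / pd eX (compX f) p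

/-- The ratio `V_t / V`. -/
def logRate (f : Pt → Pt) (p : Pt) : ℝ := pd eT (compV f) p / compV f p

section
variable (h : LocalMap f θ θ' O) {p : Pt} (hp : p ∈ O)
include h hp

theorem smooth_ratio : ContDiffAt ℝ ∞ (ratio f) p :=
  (pd_contDiffAt eT (h.smoothX hp)).div (pd_contDiffAt eX (h.smoothX hp)) (h.X_v_X_x hp).2.1

theorem smooth_logRate : ContDiffAt ℝ ∞ (logRate f) p :=
  (pd_contDiffAt eT (h.smoothV hp)).div (h.smoothV hp) (h.V_ne p hp)

theorem ratio_mul : ratio f p * pd eX (compX f) p = pd eT (compX f) p :=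
  div_mul_cancel₀ _ (h.X_v_X_x hp).2.1

theorem logRate_mul : logRate f p * compV f p = pd eT (compV f) p :=
  div_mul_cancel₀ _ (h.V_ne p hp)

theorem ratio_x_mul : pd eX (ratio f) p * pd eX (compX f) p = pd eX (pd eT (compX f)) p := by
  have := pd_eq_of_eqOn h.isOpen (fun q hq => h.ratio_mul hq) eX p hp
  rw [pd_mul eX (h.smooth_ratio hp) (pd_contDiffAt eX (h.smoothX hp)), h.X_xx hp] at this
  linear_combination this

/-- Since `X_xx = 0`, the denominator `X_x` is constant in `x` and the numerator `X_t` is affine in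
`x`. -/
theorem ratio_xx : pd eX (pd eX (ratio f)) p = 0 := by
  have := pd_eq_of_eqOn h.isOpen (fun q hq => h.ratio_x_mul hq) eX p hp
  rw [pd_mul eX (pd_contDiffAt eX (h.smooth_ratio hp)) (pd_contDiffAt eX (h.smoothX hp)),
    h.X_xx hp, pd_pd_pd_eq_zero h.isOpen (fun q hq => h.smoothX hq) (fun q hq => h.X_xx hq) eT p hp,
    mul_zero, zero_add] at this
  exact (mul_eq_zero.mp this).resolve_left (h.X_v_X_x hp).2.1

theorem T_tt_div : pd eT (pd eT (compT f)) p / pd eT (compT f) p = 2 * pd eX (ratio f) p := by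
  rw [div_eq_iff (h.T_t_ne hp), ← h.X_e_mul hp eT, pd_comm eT eX (h.smoothX hp),
    ← h.ratio_x_mul hp, ← (h.X_v_X_x hp).2.2]
  ring

variable (hm : θ.m ≠ 2)
include hm

/-- From `V = v V_v` follows `V_x = v V_xv`, and the second determining equation expresses `V_xv`
through `X_t`. -/
theorem V_x_eq : pd eX (compV f) p = -ratio f p / 2 * compV f p := by
  have e1 := pd_eq_of_eqOn h.isOpen (fun q hq => (h.splitting hm hq).2.1) eX p hp
  rw [pd_mul eX (contDiffAt_coordV p) (pd_contDiffAt eV (h.smoothV hp)), pd_coordV] at e1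
  simp only [eX, mul_zero, add_zero] at e1
  have e2 := (h.determining hp).2.1
  have e3 := h.ratio_mul hp
  have e4 := (h.splitting hm hp).2.1
  have hx := (h.X_v_X_x hp).2.1
  apply mul_left_cancel₀ (mul_ne_zero two_ne_zero hx)
  simp only [eX] at e2 e3 hx ⊢
  linear_combination 2 * pd (0, 1, 0) (compX f) p * e1 + p.2.2 * e2
    + pd eT (compX f) p * e4 + compV f p * e3

/-- This is the equality of the mixed derivatives of `log |V|`, whose `x`-derivative is `-ratio / 2`
by `V_x_eq`. -/
theorem logRate_x : pd eX (logRate f) p = -pd eT (ratio f) p / 2 := by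
  have e1 := pd_eq_of_eqOn h.isOpen (fun q hq => h.logRate_mul hq) eX p hp
  have e2 := pd_eq_of_eqOn h.isOpen (g := pd eX (compV f)) (g' := fun q => -(1 / 2) * ratio f q * compV f q)
    (fun q hq => by rw [h.V_x_eq hq hm]; ring) eT p hp
  have hs : ContDiffAt ℝ ∞ (fun q => -(1 / 2) * ratio f q) p :=
    contDiffAt_const.mul (h.smooth_ratio hp)
  rw [pd_mul eT hs (h.smoothV hp),
    pd_mul eT contDiffAt_const (h.smooth_ratio hp), pd_const, pd_comm eT eX (h.smoothV hp)] at e2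
  rw [pd_mul eX (h.smooth_logRate hp) (h.smoothV hp), e2] at e1
  have e3 := h.V_x_eq hp hm
  have e4 := h.logRate_mul hp
  apply mul_left_cancel₀ (h.V_ne p hp)
  linear_combination e1 - logRate f p * e3 + ratio f p / 2 * e4

/-- Elimination of `k` from `log_derivs`. By `ratio_xx` and `logRate_x` the right-hand side is, on
`x`-lines, a quadratic polynomial in `x`, which a generic `H` allows only for zero `ratio`. -/
theorem classifying : ratio f p * iteratedDeriv 1 θ.logH p.2.1
    = -2 * pd eX (ratio f) p - (θ.m - 1) * logRate f p
      - (θ.m - 1) / 2 * (ratio f p * ratio f p) := by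
  obtain ⟨k, h1, h2⟩ := h.log_derivs hm hp
  rw [h.T_tt_div hp, ← h.ratio_mul hp] at h1
  have e : pd eX (compV f) p / compV f p = -ratio f p / 2 := by
    rw [h.V_x_eq hp hm, mul_div_cancel_right₀ _ (h.V_ne p hp)]
  rw [e] at h2
  rw [h2]
  change 0 = _ + _ + (θ.m - 1) * logRate f p at h1
  linear_combination -h1

/-- A transformation of a generic equation satisfies the first-order conditions. -/
theorem firstOrder (hQ : θ.Generic p.2.1) : FirstOrder f p := by
  obtain ⟨t, x, v⟩ := p
  have hO := h.isOpen
  have hline := eventually_mem_lineX hO hp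
  have hd : ∀ {g : Pt → ℝ} (g' : Pt → ℝ), (∀ q ∈ O, ContDiffAt ℝ ∞ g q) →
      (∀ q ∈ O, pd eX g q = g' q) →
      ∀ᶠ y in 𝓝 x, HasDerivAt (fun y => g (t, y, v)) (g' (t, y, v)) y := by
    intro g g' hg hgg
    filter_upwards [hline] with y hy
    rw [← hgg _ hy]
    exact hasDerivAt_lineX (differentiableAt_of_smooth (hg _ hy))
  have hx : x ∈ xProj θ.dom := mem_xProj (h.mem_dom _ hp)
  have sr : ∀ q ∈ O, ContDiffAt ℝ ∞ (ratio f) q := fun q hq => h.smooth_ratio hq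
  have sS : ∀ q ∈ O, ContDiffAt ℝ ∞ (logRate f) q := fun q hq => h.smooth_logRate hq
  have srt : ∀ q ∈ O, ContDiffAt ℝ ∞ (pd eT (ratio f)) q := fun q hq => pd_contDiffAt eT (sr q hq)
  have hxx : ∀ q ∈ O, pd eX (pd eX (ratio f)) q = 0 := fun q hq => h.ratio_xx hq
  -- The shift `i + 1` is due to `ℓ 0` being the first derivative of `log |H|`; thus `ℓ 2`, `ℓ 3`,
  -- `ℓ 4` are the derivatives of orders three, four and five in `Generic`.
  obtain ⟨hy, hy1⟩ := affine_mul_rigidity (ℓ := fun i => iteratedDeriv (i + 1) θ.logH)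
    (k := θ.m - 1) (x₀ := x)
    (Y := fun y => ratio f (t, y, v)) (Y₁ := fun y => pd eX (ratio f) (t, y, v))
    (Z := fun y => pd eT (ratio f) (t, y, v)) (Z₁ := fun y => pd eX (pd eT (ratio f)) (t, y, v))
    (S := fun y => logRate f (t, y, v))
    (by
      intro i
      filter_upwards [(isOpen_xProj θ.isOpen_dom).mem_nhds hx] with y hy
      exact hasDerivAt_iteratedDeriv (θ.contDiffAt_logH hy) (i + 1))
    (hd _ sr fun _ _ => rfl)
    (hd (fun _ => 0) (fun q hq => pd_contDiffAt eX (sr q hq)) hxx)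
    (hd _ srt fun _ _ => rfl)
    (hd (fun _ => 0) (fun q hq => pd_contDiffAt eX (srt q hq)) (pd_pd_pd_eq_zero hO sr hxx eT))
    (hd (fun q => -pd eT (ratio f) q / 2) sS fun q hq => h.logRate_x hq hm)
    (by
      filter_upwards [hline] with y hy
      exact h.classifying hy hm)
    hQ
  have hE := h.classifying hp hm
  have hS : logRate f (t, x, v) = 0 := by
    rw [hy, hy1] at hE
    have : (θ.m - 1) * logRate f (t, x, v) = 0 := by linear_combination hE
    exact (mul_eq_zero.mp this).resolve_left (sub_ne_zero.mpr θ.m_ne_one)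
  obtain ⟨h1, h2⟩ := h.T_x_T_v hp
  obtain ⟨h3, h4, h5⟩ := h.X_v_X_x hp
  refine ⟨h1, h2, h3, ?_, ?_, ?_, h5, (h.splitting hm hp).2.1⟩
  · rw [← h.ratio_mul hp, hy, zero_mul]
  · rw [← h.logRate_mul hp, hS, zero_mul]
  · rw [h.V_x_eq hp hm, hy]
    ring

end

end LocalMap

/-! ### From first-order conditions to the explicit form -/

/-- The part of the domain where neither `v` nor its image vanishes. -/
def regularPart (f : Pt → Pt) (U : Set Pt) : Set Pt := {p ∈ U | p.2.2 ≠ 0 ∧ compV f p ≠ 0}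

theorem isOpen_regularPart {f : Pt → Pt} {U : Set Pt} (hU : IsOpen U)
    (hf : ∀ p ∈ U, ContDiffAt ℝ ∞ f p) : IsOpen (regularPart f U) := by
  rw [isOpen_iff_mem_nhds]
  rintro p ⟨hp, hv, hV⟩
  have h1 := (contDiffAt_coordV p).continuousAt.eventually_ne hv
  have h2 := (contDiffAt_compV (hf p hp)).continuousAt.eventually_ne hV
  filter_upwards [hU.mem_nhds hp, h1, h2] with q h3 h4 h5
  exact ⟨h3, h4, h5⟩

/-- Density of the regular part: if `v` or its image vanished on a nonempty open set, so would all
its derivatives, against `v_v = 1` or the nondegeneracy of `f`. -/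
theorem exists_mem_regularPart {f : Pt → Pt} {U W : Set Pt} (hW : IsOpen W) (hWU : W ⊆ U)
    (hdet : ∀ p ∈ U, jacDet (compT f) (compX f) (compV f) p ≠ 0) (hne : W.Nonempty) :
    ∃ q ∈ W, q ∈ regularPart f U := by
  have h1 : ∃ q ∈ W, q.2.2 ≠ 0 := by
    by_contra! hc
    obtain ⟨p, hp⟩ := hne
    have := pd_eq_zero_of_eqOn hW hc eV p hp
    rw [pd_coordV] at this
    simp [eV] at this
  let W' := {q ∈ W | q.2.2 ≠ 0}
  have hW' : IsOpen W' := hW.inter (isOpen_ne.preimage (continuous_snd.comp continuous_snd))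
  have h2 : ∃ q ∈ W', compV f q ≠ 0 := by
    by_contra! hc
    obtain ⟨p, hp⟩ := h1
    apply hdet p (hWU hp.1)
    have h0 := fun e => pd_eq_zero_of_eqOn hW' hc e p hp
    simp [jacDet, h0]
  obtain ⟨q, hq, hV⟩ := h2
  exact ⟨q, hq.1, hWU hq.1, hq.2, hV⟩

/-- By density and continuity, identities found where the power is smooth extend across the points
where `v` or its image vanishes. -/
theorem eq_zero_of_regularPart {f : Pt → Pt} {U : Set Pt} (hU : IsOpen U)
    (hdet : ∀ p ∈ U, jacDet (compT f) (compX f) (compV f) p ≠ 0) {g : Pt → ℝ}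
    (hg : ∀ p ∈ U, ContDiffAt ℝ ∞ g p) (h : ∀ p ∈ regularPart f U, g p = 0) :
    ∀ p ∈ U, g p = 0 := by
  intro p hp
  by_contra hne
  have hev : ∀ᶠ q in 𝓝 p, q ∈ U ∧ g q ≠ 0 :=
    (hU.eventually_mem hp).and ((hg p hp).continuousAt.eventually_ne hne)
  obtain ⟨W, hW, hWo, hpW⟩ := eventually_nhds_iff.mp hev
  obtain ⟨q, hq, hqr⟩ := exists_mem_regularPart hWo (fun q hq => (hW q hq).1) hdet ⟨p, hpW⟩
  exact (hW q hq).2 (h q hqr)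

theorem firstOrder_of_regularPart {f : Pt → Pt} {U : Set Pt} (hU : IsOpen U)
    (hf : ∀ p ∈ U, ContDiffAt ℝ ∞ f p)
    (hdet : ∀ p ∈ U, jacDet (compT f) (compX f) (compV f) p ≠ 0)
    (h : ∀ p ∈ regularPart f U, FirstOrder f p) : ∀ p ∈ U, FirstOrder f p := by
  have sT := fun e p hp => pd_contDiffAt e (contDiffAt_compT (hf p hp))
  have sX := fun e p hp => pd_contDiffAt e (contDiffAt_compX (hf p hp))
  have sV := fun e p hp => pd_contDiffAt e (contDiffAt_compV (hf p hp))
  intro p hp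
  refine ⟨?_, ?_, ?_, ?_, ?_, ?_, ?_, ?_⟩
  · exact eq_zero_of_regularPart hU hdet (sT eX) (fun q hq => (h q hq).T_x) p hp
  · exact eq_zero_of_regularPart hU hdet (sT eV) (fun q hq => (h q hq).T_v) p hp
  · exact eq_zero_of_regularPart hU hdet (sX eV) (fun q hq => (h q hq).X_v) p hp
  · exact eq_zero_of_regularPart hU hdet (sX eT) (fun q hq => (h q hq).X_t) p hp
  · exact eq_zero_of_regularPart hU hdet (sV eT) (fun q hq => (h q hq).V_t) p hp
  · exact eq_zero_of_regularPart hU hdet (sV eX) (fun q hq => (h q hq).V_x) p hp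
  · exact sub_eq_zero.mp (eq_zero_of_regularPart hU hdet
      (fun q hq => ((sX eX q hq).pow 2).sub (sT eT q hq))
      (fun q hq => sub_eq_zero.mpr (h q hq).T_t) p hp)
  · exact sub_eq_zero.mp (eq_zero_of_regularPart hU hdet
      (fun q hq => (contDiffAt_compV (hf q hq)).sub ((contDiffAt_coordV q).mul (sV eV q hq)))
      (fun q hq => sub_eq_zero.mpr (h q hq).V_v) p hp)

theorem exists_const_of_pd_eq_zero {U : Set Pt} (hU : IsOpen U) (hc : IsConnected U) {g : Pt → ℝ}
    (hg : ∀ p ∈ U, ContDiffAt ℝ ∞ g p)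
    (h : ∀ p ∈ U, pd eT g p = 0 ∧ pd eX g p = 0 ∧ pd eV g p = 0) : ∃ c, ∀ p ∈ U, g p = c := by
  refine hU.exists_is_const_of_fderiv_eq_zero (𝕜 := ℝ) hc.isPreconnected
    (fun p hp => (differentiableAt_of_smooth (hg p hp)).differentiableWithinAt) ?_
  intro p hp
  obtain ⟨h1, h2, h3⟩ := h p hp
  refine ContinuousLinearMap.ext fun ⟨a, b, c⟩ => ?_
  simp [fderiv_apply_eq, h1, h2, h3]

theorem pd_const_mul (e : Pt) (c : ℝ) {g : Pt → ℝ} {p : Pt} (hg : ContDiffAt ℝ ∞ g p) :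
    pd e (fun p => c * g p) p = c * pd e g p := by
  rw [pd_mul e contDiffAt_const hg, pd_const]
  ring

/-- `X_x` and `V_v` have zero gradient, so on the connected domain they are constants `δ₁`, `δ₄`.
Then `T - δ₁² t` and `X - δ₁ x` are constant too, while `V = v V_v` leaves no additive constant. -/
theorem exists_params_of_firstOrder {f : Pt → Pt} {U : Set Pt} (hU : IsOpen U) (hc : IsConnected U)
    (hf : ∀ p ∈ U, ContDiffAt ℝ ∞ f p)
    (hdet : ∀ p ∈ U, jacDet (compT f) (compX f) (compV f) p ≠ 0)
    (h : ∀ p ∈ U, FirstOrder f p) :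
    ∃ δ : Params, δ.δ₁ * δ.δ₄ ≠ 0 ∧ ∀ p ∈ U, f p = δ.map p := by
  have cT := fun p hp => contDiffAt_compT (hf p hp)
  have cX := fun p hp => contDiffAt_compX (hf p hp)
  have cV := fun p hp => contDiffAt_compV (hf p hp)
  have sX := fun e p hp => pd_contDiffAt e (contDiffAt_compX (hf p hp))
  have sV := fun e p hp => pd_contDiffAt e (contDiffAt_compV (hf p hp))
  have hXx : ∀ p ∈ U, pd eX (compX f) p ≠ 0 := by
    intro p hp h0
    apply hdet p hp
    have := (h p hp).T_t
    simp [jacDet, (h p hp).T_x, (h p hp).T_v, h0, (h p hp).X_v]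
  obtain ⟨d1, h1⟩ := exists_const_of_pd_eq_zero hU hc (sX eX) (by
    intro p hp
    refine ⟨?_, ?_, ?_⟩
    · rw [pd_comm _ _ (cX p hp)]
      exact pd_eq_zero_of_eqOn hU (fun q hq => (h q hq).X_t) eX p hp
    · have := pd_eq_of_eqOn hU (g := fun p => pd eX (compX f) p * pd eX (compX f) p)
        (g' := pd eT (compT f)) (fun q hq => by rw [← (h q hq).T_t]; ring) eX p hp
      rw [pd_mul eX (sX eX p hp) (sX eX p hp), pd_comm _ _ (cT p hp),
        pd_eq_zero_of_eqOn hU (fun q hq => (h q hq).T_x) eT p hp] at this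
      have h2 : 2 * pd eX (compX f) p * pd eX (pd eX (compX f)) p = 0 := by
        linear_combination this
      exact (mul_eq_zero.mp h2).resolve_left (mul_ne_zero two_ne_zero (hXx p hp))
    · rw [pd_comm _ _ (cX p hp)]
      exact pd_eq_zero_of_eqOn hU (fun q hq => (h q hq).X_v) eX p hp)
  obtain ⟨d4, h4⟩ := exists_const_of_pd_eq_zero hU hc (sV eV) (by
    intro p hp
    refine ⟨?_, ?_, ?_⟩
    · rw [pd_comm _ _ (cV p hp)]
      exact pd_eq_zero_of_eqOn hU (fun q hq => (h q hq).V_t) eV p hp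
    · rw [pd_comm _ _ (cV p hp)]
      exact pd_eq_zero_of_eqOn hU (fun q hq => (h q hq).V_x) eV p hp
    -- Differentiating `V = v V_v` in `v` gives only `v V_vv = 0`, so points with `v = 0` are
    -- reached by density.
    · refine eq_zero_of_regularPart hU hdet (fun q hq => pd_contDiffAt eV (sV eV q hq)) ?_ p hp
      rintro q ⟨hq, hv, -⟩
      have := pd_eq_of_eqOn hU (fun q hq => (h q hq).V_v) eV q hq
      rw [pd_mul eV (contDiffAt_coordV q) (sV eV q hq), pd_coordV] at this
      simp only [eV] at this
      have h2 : q.2.2 * pd (0, 0, 1) (pd (0, 0, 1) (compV f)) q = 0 := by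
        linear_combination -this
      exact (mul_eq_zero.mp h2).resolve_left hv)
  obtain ⟨d2, h2⟩ := exists_const_of_pd_eq_zero hU hc
    (g := fun p => compT f p + (-d1 ^ 2) * p.1)
    (fun p hp => (cT p hp).add (contDiffAt_const.mul (contDiffAt_coordT p))) (by
    intro p hp
    have hs : ContDiffAt ℝ ∞ (fun p : Pt => (-d1 ^ 2) * p.1) p :=
      contDiffAt_const.mul (contDiffAt_coordT p)
    rw [pd_add _ (cT p hp) hs, pd_add _ (cT p hp) hs, pd_add _ (cT p hp) hs,
      pd_const_mul _ _ (contDiffAt_coordT p), pd_const_mul _ _ (contDiffAt_coordT p),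
      pd_const_mul _ _ (contDiffAt_coordT p), pd_coordT, pd_coordT, pd_coordT,
      (h p hp).T_x, (h p hp).T_v, ← (h p hp).T_t, h1 p hp]
    simp [eT, eX, eV])
  obtain ⟨d3, h3⟩ := exists_const_of_pd_eq_zero hU hc
    (g := fun p => compX f p + (-d1) * p.2.1)
    (fun p hp => (cX p hp).add (contDiffAt_const.mul (contDiffAt_coordX p))) (by
    intro p hp
    have hs : ContDiffAt ℝ ∞ (fun p : Pt => (-d1) * p.2.1) p :=
      contDiffAt_const.mul (contDiffAt_coordX p)
    rw [pd_add _ (cX p hp) hs, pd_add _ (cX p hp) hs, pd_add _ (cX p hp) hs,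
      pd_const_mul _ _ (contDiffAt_coordX p), pd_const_mul _ _ (contDiffAt_coordX p),
      pd_const_mul _ _ (contDiffAt_coordX p), pd_coordX, pd_coordX, pd_coordX,
      (h p hp).X_t, (h p hp).X_v, h1 p hp]
    simp [eT, eX, eV])
  refine ⟨⟨d1, d2, d3, d4⟩, ?_, ?_⟩
  · obtain ⟨p, hp⟩ := hc.nonempty
    have hd := hdet p hp
    intro h0
    apply hd
    have hh := h p hp
    simp only [jacDet, hh.T_x, hh.T_v, ← hh.T_t, hh.X_v, hh.X_t, h1 p hp, h4 p hp]
    linear_combination d1 ^ 2 * h0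
  · intro p hp
    refine Prod.ext ?_ (Prod.ext ?_ ?_)
    · change compT f p = d1 ^ 2 * p.1 + d2
      linear_combination h2 p hp
    · change compX f p = d1 * p.2.1 + d3
      linear_combination h3 p hp
    · change compV f p = d4 * p.2.2
      rw [(h p hp).V_v, h4 p hp]
      ring

theorem IsPointTransformation.contDiffAt {f : Pt → Pt} {A B : Set Pt} (hA : IsOpen A)
    (hf : IsPointTransformation f A B) : ∀ p ∈ A, ContDiffAt ℝ ∞ f p :=
  fun _ hp => hf.2.1.contDiffAt (hA.mem_nhds hp)

theorem localMap_regularPart {f : Pt → Pt} {θ θ' : Eqn D}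
    (hf : IsPointTransformation f θ.dom θ'.dom) (hmap : MapsEquation f θ θ') :
    LocalMap f θ θ' (regularPart f θ.dom) where
  isOpen := isOpen_regularPart θ.isOpen_dom (hf.contDiffAt θ.isOpen_dom)
  mem_dom := fun _ hp => hp.1
  map_mem := fun _ hp => hf.1.mapsTo hp.1
  smooth := fun p hp => hf.contDiffAt θ.isOpen_dom p hp.1
  v_ne := fun _ hp => hp.2.1
  V_ne := fun _ hp => hp.2.2
  det_ne := fun _ hp => jacDet_ne_zero θ.isOpen_dom θ'.isOpen_dom hf hp.1
  map := hmap

theorem pd_map_X (δ : Params) (e p : Pt) : pd e (compX δ.map) p = δ.δ₁ * e.2.1 := by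
  have hs : ContDiffAt ℝ ∞ (fun p : Pt => δ.δ₁ * p.2.1) p :=
    contDiffAt_const.mul (contDiffAt_coordX p)
  change pd e (fun p : Pt => δ.δ₁ * p.2.1 + δ.δ₃) p = _
  rw [pd_add e hs contDiffAt_const, pd_const_mul e _ (contDiffAt_coordX p), pd_coordX, pd_const,
    add_zero]

theorem pd_map_V (δ : Params) (e p : Pt) : pd e (compV δ.map) p = δ.δ₄ * e.2.2 := by
  change pd e (fun p : Pt => δ.δ₄ * p.2.2) p = _
  rw [pd_const_mul e _ (contDiffAt_coordV p), pd_coordV]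

/-- The transformed arbitrary elements are determined by the transformation of `(t, x, v)`. -/
theorem formulas_of_map {f : Pt → Pt} {θ θ' : Eqn D}
    (hf : IsPointTransformation f θ.dom θ'.dom) (hmap : MapsEquation f θ θ') {δ : Params}
    (hδ : δ.δ₁ * δ.δ₄ ≠ 0) (hfδ : ∀ p ∈ θ.dom, f p = δ.map p) :
    (∀ x ∈ xProj θ.dom, θ'.F (δ.δ₁ * x + δ.δ₃) = θ.F x / δ.δ₁ ^ 2) ∧
    (∀ x ∈ xProj θ.dom, θ'.H (δ.δ₁ * x + δ.δ₃) = θ.H x / (δ.δ₁ ^ 2 * δ.power θ.m)) ∧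
    θ'.m = θ.m := by
  have h1 : δ.δ₁ ≠ 0 := left_ne_zero_of_mul hδ
  have h4 : δ.δ₄ ≠ 0 := right_ne_zero_of_mul hδ
  have hL := localMap_regularPart hf hmap
  have key : ∀ p ∈ θ.dom, θ'.F (δ.δ₁ * p.2.1 + δ.δ₃) = θ.F p.2.1 / δ.δ₁ ^ 2 ∧
      θ'.H (δ.δ₁ * p.2.1 + δ.δ₃) = θ.H p.2.1 / (δ.δ₁ ^ 2 * δ.power θ.m) ∧ θ'.m = θ.m := by
    rintro ⟨t, x, v⟩ hp
    -- The claim concerns `x` only, so the point may be moved along its `v`-line to where the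
    -- determining equations are available.
    obtain ⟨w, hw, hw0⟩ : ∃ w, (t, x, w) ∈ θ.dom ∧ w ≠ 0 := by
      have h1 := eventually_mem_lineV θ.isOpen_dom hp
      have h2 : ∃ᶠ w : ℝ in 𝓝 v, w ≠ 0 := by
        have : (𝓝[≠] v).NeBot := inferInstance
        by_contra hc
        rw [not_frequently] at hc
        obtain ⟨ε, hε, hb⟩ := Metric.eventually_nhds_iff_ball.mp hc
        have e1 : v = 0 := not_not.mp (hb v (Metric.mem_ball_self hε))
        have e2 : v + ε / 2 = 0 := not_not.mp (hb (v + ε / 2) (by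
          rw [Metric.mem_ball, Real.dist_eq, add_sub_cancel_left, abs_of_pos (by linarith)]
          linarith))
        linarith
      obtain ⟨w, hw, hw'⟩ := (h2.and_eventually h1).exists
      exact ⟨w, hw', hw⟩
    have hreg : ∀ p ∈ θ.dom, p.2.2 ≠ 0 → p ∈ regularPart f θ.dom := by
      intro p hp hv
      refine ⟨hp, hv, ?_⟩
      unfold compV
      rw [hfδ p hp]
      exact mul_ne_zero h4 hv
    have hcomp : ∀ {g g' : Pt → ℝ}, (∀ p ∈ θ.dom, g p = g' p) → ∀ e, ∀ p ∈ θ.dom,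
        pd e g p = pd e g' p := fun h e p hp => pd_eq_of_eqOn θ.isOpen_dom h e p hp
    have eXc : ∀ p ∈ θ.dom, compX f p = compX δ.map p := fun p hp => by simp [compX, hfδ p hp]
    have eVc : ∀ p ∈ θ.dom, compV f p = compV δ.map p := fun p hp => by simp [compV, hfδ p hp]
    -- The last determining equation for the explicit map, with `β = 0` known beforehand; hence `m =
    -- 2` is allowed here. `power_rigidity` yields `m` and `H`, and substituting them back yields
    -- `F`.
    have hsrc : ∀ᶠ s in 𝓝 w, δ.δ₁ * δ.δ₄ * θ.H x * |s| ^ θ.m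
        - δ.δ₁ ^ 3 * θ'.H (δ.δ₁ * x + δ.δ₃) * |δ.δ₄ * s + 0| ^ θ'.m
        = (δ.δ₁ ^ 3 * θ'.F (δ.δ₁ * x + δ.δ₃) * δ.δ₄ - δ.δ₁ * δ.δ₄ * θ.F x) * s + 0 := by
      filter_upwards [eventually_mem_lineV θ.isOpen_dom hw, isOpen_ne.mem_nhds hw0] with s hs hs0
      have := (hL.determining (hreg _ hs hs0)).2.2
      rw [hcomp eXc eX _ hs, hcomp eVc eV _ hs, hcomp eVc eT _ hs, hcomp eVc eX _ hs,
        pd_eq_zero_of_eqOn θ.isOpen_dom (g := pd eX (compV f)) (fun q hq => by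
          rw [hcomp eVc eX q hq, pd_map_V]; simp [eX]) eX _ hs, eXc _ hs, eVc _ hs,
        pd_map_X, pd_map_V, pd_map_V, pd_map_V] at this
      simp only [eT, eX, eV, mul_zero, mul_one, zero_add, zero_mul, sub_zero,
        LocalMap.source, compX, compV, Params.map] at this
      rw [add_zero, add_zero]
      linear_combination this
    have hH : θ.H x ≠ 0 := θ.H_ne_zero x (mem_xProj hp)
    obtain ⟨hm, -, hpow⟩ := power_rigidity hw0 (by simpa using mul_ne_zero h4 hw0)
      (mul_ne_zero hδ hH) h4 θ.m_ne_zero θ.m_ne_one hsrc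
    have hs := hsrc.self_of_nhds
    rw [add_zero, abs_mul, Real.mul_rpow (abs_nonneg _) (abs_nonneg _)] at hpow hs
    rw [hm] at hs
    have hw' := abs_rpow_ne_zero θ.m hw0
    have h4' := abs_rpow_ne_zero θ.m h4
    have e1 : δ.δ₄ * θ.H x = δ.δ₁ ^ 2 * θ'.H (δ.δ₁ * x + δ.δ₃) * |δ.δ₄| ^ θ.m := by
      have : δ.δ₁ * δ.δ₄ ^ 2 * w ^ 2 * |w| ^ θ.m ≠ 0 :=
        mul_ne_zero (mul_ne_zero (mul_ne_zero h1 (pow_ne_zero 2 h4)) (pow_ne_zero 2 hw0)) hw'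
      apply mul_left_cancel₀ this
      linear_combination hpow
    refine ⟨?_, ?_, hm⟩
    · change θ'.F (δ.δ₁ * x + δ.δ₃) = θ.F x / δ.δ₁ ^ 2
      rw [eq_div_iff (pow_ne_zero 2 h1)]
      have : δ.δ₁ * δ.δ₄ * w ≠ 0 := mul_ne_zero hδ hw0
      apply mul_left_cancel₀ this
      linear_combination δ.δ₁ * |w| ^ θ.m * e1 - hs
    · change θ'.H (δ.δ₁ * x + δ.δ₃) = θ.H x / (δ.δ₁ ^ 2 * δ.power θ.m)
      have hP : δ.power θ.m ≠ 0 := div_ne_zero h4' h4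
      rw [eq_div_iff (mul_ne_zero (pow_ne_zero 2 h1) hP)]
      unfold Params.power
      field_simp
      linear_combination -e1
  refine ⟨?_, ?_, ?_⟩
  · rintro x ⟨p, hp, rfl⟩
    exact (key p hp).1
  · rintro x ⟨p, hp, rfl⟩
    exact (key p hp).2.1
  · obtain ⟨p, hp⟩ := θ.isConnected_dom.nonempty
    exact (key p hp).2.2

/-! ### The group of parameters -/

namespace Params

@[ext]
theorem ext {δ δ' : Params} (h₁ : δ.δ₁ = δ'.δ₁) (h₂ : δ.δ₂ = δ'.δ₂) (h₃ : δ.δ₃ = δ'.δ₃)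
    (h₄ : δ.δ₄ = δ'.δ₄) : δ = δ' := by
  cases δ
  cases δ'
  simp_all

/-- The parameters of the inverse transformation. -/
def inv (δ : Params) : Params := ⟨δ.δ₁⁻¹, -δ.δ₂ / δ.δ₁ ^ 2, -δ.δ₃ / δ.δ₁, δ.δ₄⁻¹⟩

/-- The parameters of the composition. -/
def comp (δ' δ : Params) : Params :=
  ⟨δ'.δ₁ * δ.δ₁, δ'.δ₁ ^ 2 * δ.δ₂ + δ'.δ₂, δ'.δ₁ * δ.δ₃ + δ'.δ₃, δ'.δ₄ * δ.δ₄⟩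

/-- The parameters of the identity. -/
def one : Params := ⟨1, 0, 0, 1⟩

theorem map_one (p : Pt) : one.map p = p := by simp [one, map]

theorem map_comp (δ' δ : Params) (p : Pt) : (δ'.comp δ).map p = δ'.map (δ.map p) := by
  simp only [comp, map, Prod.mk.injEq]
  refine ⟨?_, ?_, ?_⟩ <;> ring

theorem inv_inv (δ : Params) (h : δ.δ₁ * δ.δ₄ ≠ 0) : δ.inv.inv = δ := by
  have h1 : δ.δ₁ ≠ 0 := left_ne_zero_of_mul h
  ext <;> simp only [inv] <;> field_simp

theorem inv_map_map (δ : Params) (h : δ.δ₁ * δ.δ₄ ≠ 0) (p : Pt) : δ.inv.map (δ.map p) = p := by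
  have h1 : δ.δ₁ ≠ 0 := left_ne_zero_of_mul h
  have h4 : δ.δ₄ ≠ 0 := right_ne_zero_of_mul h
  refine Prod.ext ?_ (Prod.ext ?_ ?_)
  · simp only [inv, map]
    field_simp
    ring
  · simp only [inv, map]
    field_simp
    ring
  · simp only [inv, map]
    field_simp

theorem map_inv_map (δ : Params) (h : δ.δ₁ * δ.δ₄ ≠ 0) (p : Pt) : δ.map (δ.inv.map p) = p := by
  have h1 : δ.δ₁ ≠ 0 := left_ne_zero_of_mul h
  have h4 : δ.δ₄ ≠ 0 := right_ne_zero_of_mul h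
  refine Prod.ext ?_ (Prod.ext ?_ ?_)
  · simp only [inv, map]
    field_simp
    ring
  · simp only [inv, map]
    field_simp
    ring
  · simp only [inv, map]
    field_simp

theorem contDiff_map (δ : Params) : ContDiff ℝ ∞ δ.map := by
  unfold map
  fun_prop

/-- In this form smoothness in both the exponent and `δ₄` is evident. -/
theorem power_eq_exp (δ : Params) (h : δ.δ₄ ≠ 0) (m : ℝ) :
    δ.power m = Real.exp (Real.log δ.δ₄ * m) / δ.δ₄ := by
  rw [power, Real.rpow_def_of_pos (abs_pos.mpr h), Real.log_abs]

theorem power_ne_zero (δ : Params) (h : δ.δ₄ ≠ 0) (m : ℝ) : δ.power m ≠ 0 :=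
  div_ne_zero (abs_rpow_ne_zero m h) h

theorem power_comp (δ' δ : Params) (m : ℝ) : (δ'.comp δ).power m = δ'.power m * δ.power m := by
  simp only [power, comp, abs_mul, Real.mul_rpow (abs_nonneg _) (abs_nonneg _), mul_div_mul_comm]

theorem power_inv (δ : Params) (m : ℝ) : δ.inv.power m = (δ.power m)⁻¹ := by
  simp only [power, inv, abs_inv, Real.inv_rpow (abs_nonneg _), inv_div, inv_div_inv]

theorem power_one (m : ℝ) : one.power m = 1 := by simp [power, one]

theorem image_map (δ : Params) (h : δ.δ₁ * δ.δ₄ ≠ 0) (U : Set Pt) :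
    δ.map '' U = δ.inv.map ⁻¹' U :=
  congrFun (Set.image_eq_preimage_of_inverse (δ.inv_map_map h) (δ.map_inv_map h)) U

theorem mem_xProj_image (δ : Params) (h : δ.δ₁ ≠ 0) {U : Set Pt} {y : ℝ} :
    y ∈ xProj (δ.map '' U) ↔ (y - δ.δ₃) / δ.δ₁ ∈ xProj U := by
  constructor
  · rintro ⟨-, ⟨p, hp, rfl⟩, rfl⟩
    refine ⟨p, hp, ?_⟩
    simp only [map]
    field_simp
    ring
  · rintro ⟨p, hp, hy⟩
    refine ⟨δ.map p, ⟨p, hp, rfl⟩, ?_⟩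
    simp only [map] at hy ⊢
    rw [hy]
    field_simp
    ring

theorem admissible_iff (hD : D = Set.univ ∨ D = Set.Ioi 0) (δ : Params) :
    δ.Admissible D ↔ δ.δ₁ * δ.δ₄ ≠ 0 ∧ (D = Set.univ ∨ 0 < δ.δ₄) := by
  unfold Admissible
  rcases hD with rfl | rfl
  · simp
  · have : ¬ (Set.Ioi (0 : ℝ) = Set.univ) := by
      intro h
      have : (0 : ℝ) ∈ Set.Ioi (0 : ℝ) := h ▸ Set.mem_univ _
      simp at this
    simp only [this, false_or]
    refine and_congr_right fun _ => ⟨fun h => ?_, fun h v hv => mul_pos h hv⟩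
    simpa using h 1 (Set.mem_Ioi.mpr one_pos)

theorem Admissible.inv (hD : D = Set.univ ∨ D = Set.Ioi 0) {δ : Params} (h : δ.Admissible D) :
    δ.inv.Admissible D := by
  rw [admissible_iff hD] at h ⊢
  refine ⟨?_, h.2.imp_right fun h => inv_pos.mpr h⟩
  simp only [Params.inv]
  rw [← mul_inv]
  exact inv_ne_zero h.1

theorem Admissible.comp {δ' δ : Params} (h' : δ'.Admissible D) (h : δ.Admissible D) :
    (δ'.comp δ).Admissible D := by
  refine ⟨?_, fun v hv => ?_⟩
  · have := mul_ne_zero h'.1 h.1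
    simp only [Params.comp]
    convert this using 1
    ring
  · simp only [Params.comp, mul_assoc]
    exact h'.2 _ (h.2 v hv)

theorem admissible_one : one.Admissible D := ⟨by simp [one], by simp [one]⟩

end Params

/-! ### The action on equations -/

/-- `θ'` is the equation obtained from `θ` by the explicit formulas. -/
def Related (δ : Params) (θ θ' : Eqn D) : Prop :=
  θ'.dom = δ.map '' θ.dom ∧
    (∀ x ∈ xProj θ.dom, θ'.F (δ.δ₁ * x + δ.δ₃) = θ.F x / δ.δ₁ ^ 2) ∧
    (∀ x ∈ xProj θ.dom, θ'.H (δ.δ₁ * x + δ.δ₃) = θ.H x / (δ.δ₁ ^ 2 * δ.power θ.m)) ∧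
    θ'.m = θ.m

theorem Eqn.eq_of {θ θ' : Eqn D} (hdom : θ.dom = θ'.dom)
    (hF : ∀ x ∈ xProj θ.dom, θ.F x = θ'.F x) (hH : ∀ x ∈ xProj θ.dom, θ.H x = θ'.H x)
    (hm : θ.m = θ'.m) : θ = θ' := by
  have hF' : θ.F = θ'.F := by
    funext x
    by_cases hx : x ∈ xProj θ.dom
    · exact hF x hx
    · rw [θ.F_off x hx, θ'.F_off x (hdom ▸ hx)]
  have hH' : θ.H = θ'.H := by
    funext x
    by_cases hx : x ∈ xProj θ.dom
    · exact hH x hx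
    · rw [θ.H_off x hx, θ'.H_off x (hdom ▸ hx)]
  cases θ
  cases θ'
  simp_all

theorem Total.eq_of {a b : Total D} (h₁ : a.1 = b.1) (h₂ : (a.2 : Pt) = b.2) : a = b := by
  obtain ⟨θ, p⟩ := a
  obtain ⟨θ', p'⟩ := b
  cases h₁
  congr
  exact Subtype.ext h₂

namespace Related

variable {δ δ' : Params} {θ θ' θ'' : Eqn D}

theorem F_eq (h : Related δ θ θ') (h1 : δ.δ₁ ≠ 0) (y : ℝ) :
    θ'.F y = θ.F ((y - δ.δ₃) / δ.δ₁) / δ.δ₁ ^ 2 := by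
  by_cases hy : (y - δ.δ₃) / δ.δ₁ ∈ xProj θ.dom
  · rw [← h.2.1 _ hy]
    congr 1
    field_simp
    ring
  · rw [θ.F_off _ hy, θ'.F_off y (by rwa [h.1, δ.mem_xProj_image h1]), zero_div]

theorem H_eq (h : Related δ θ θ') (h1 : δ.δ₁ ≠ 0) (y : ℝ) :
    θ'.H y = θ.H ((y - δ.δ₃) / δ.δ₁) / (δ.δ₁ ^ 2 * δ.power θ.m) := by
  by_cases hy : (y - δ.δ₃) / δ.δ₁ ∈ xProj θ.dom
  · rw [← h.2.2.1 _ hy]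
    congr 1
    field_simp
    ring
  · rw [θ.H_off _ hy, θ'.H_off y (by rwa [h.1, δ.mem_xProj_image h1]), zero_div]

theorem unique (h : Related δ θ θ') (h' : Related δ θ θ'') (h1 : δ.δ₁ ≠ 0) : θ' = θ'' :=
  Eqn.eq_of (h.1.trans h'.1.symm) (fun y _ => by rw [h.F_eq h1, h'.F_eq h1])
    (fun y _ => by rw [h.H_eq h1, h'.H_eq h1]) (h.2.2.2.trans h'.2.2.2.symm)

theorem comp (h : Related δ θ θ') (h' : Related δ' θ' θ'') : Related (δ'.comp δ) θ θ'' := by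
  obtain ⟨a1, a2, a3, a4⟩ := h
  obtain ⟨b1, b2, b3, b4⟩ := h'
  have hmem : ∀ x ∈ xProj θ.dom, δ.δ₁ * x + δ.δ₃ ∈ xProj θ'.dom := by
    rintro - ⟨p, hp, rfl⟩
    rw [a1]
    exact ⟨δ.map p, ⟨p, hp, rfl⟩, rfl⟩
  have harg : ∀ x, (δ'.comp δ).δ₁ * x + (δ'.comp δ).δ₃ = δ'.δ₁ * (δ.δ₁ * x + δ.δ₃) + δ'.δ₃ := by
    intro x
    simp only [Params.comp]
    ring
  refine ⟨?_, fun x hx => ?_, fun x hx => ?_, b4.trans a4⟩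
  · rw [b1, a1, Set.image_image]
    exact Set.image_congr fun p _ => (δ'.map_comp δ p).symm
  · rw [harg, b2 _ (hmem x hx), a2 x hx, div_div]
    congr 1
    simp only [Params.comp]
    ring
  · rw [harg, b3 _ (hmem x hx), a3 x hx, div_div, Params.power_comp, a4]
    congr 1
    simp only [Params.comp]
    ring

theorem inv (h : Related δ θ θ') (h0 : δ.δ₁ * δ.δ₄ ≠ 0) : Related δ.inv θ' θ := by
  have h1 : δ.δ₁ ≠ 0 := left_ne_zero_of_mul h0
  have h4 : δ.δ₄ ≠ 0 := right_ne_zero_of_mul h0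
  have hP := δ.power_ne_zero h4 θ.m
  have harg : ∀ y, δ.inv.δ₁ * y + δ.inv.δ₃ = (y - δ.δ₃) / δ.δ₁ := by
    intro y
    simp only [Params.inv]
    field_simp
    ring
  refine ⟨?_, fun y _ => ?_, fun y _ => ?_, h.2.2.2.symm⟩
  · rw [h.1, Set.image_image]
    simp [δ.inv_map_map h0]
  · rw [harg, h.F_eq h1]
    simp only [Params.inv]
    field_simp
  · rw [harg, h.H_eq h1, h.2.2.2, Params.power_inv]
    simp only [Params.inv]
    field_simp

theorem one (θ : Eqn D) : Related Params.one θ θ := by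
  refine ⟨?_, fun x _ => ?_, fun x _ => ?_, rfl⟩
  · simp [Params.map_one]
  · simp [Params.one]
  · rw [Params.power_one]
    simp [Params.one]

end Related

/-- The equation obtained from `θ` by the explicit formulas. -/
def Params.act (δ : Params) (hδ : δ.Admissible D) (θ : Eqn D) : Eqn D where
  dom := δ.map '' θ.dom
  isOpen_dom := by
    rw [δ.image_map hδ.1]
    exact θ.isOpen_dom.preimage δ.inv.contDiff_map.continuous
  isConnected_dom := θ.isConnected_dom.image _ δ.contDiff_map.continuous.continuousOn
  dom_values := by
    rintro - ⟨p, hp, rfl⟩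
    exact hδ.2 _ (θ.dom_values p hp)
  F := fun y => θ.F ((y - δ.δ₃) / δ.δ₁) / δ.δ₁ ^ 2
  H := fun y => θ.H ((y - δ.δ₃) / δ.δ₁) / (δ.δ₁ ^ 2 * δ.power θ.m)
  m := θ.m
  smooth_F := by
    refine ContDiffOn.div_const (θ.smooth_F.comp (f := fun y => (y - δ.δ₃) / δ.δ₁) ?_ ?_) _
    · exact ((contDiff_id.sub contDiff_const).div_const _).contDiffOn
    · exact fun y hy => (δ.mem_xProj_image (left_ne_zero_of_mul hδ.1)).mp hy
  smooth_H := by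
    refine ContDiffOn.div_const (θ.smooth_H.comp (f := fun y => (y - δ.δ₃) / δ.δ₁) ?_ ?_) _
    · exact ((contDiff_id.sub contDiff_const).div_const _).contDiffOn
    · exact fun y hy => (δ.mem_xProj_image (left_ne_zero_of_mul hδ.1)).mp hy
  H_ne_zero := fun y hy => by
    have h1 := left_ne_zero_of_mul hδ.1
    have h4 := right_ne_zero_of_mul hδ.1
    exact div_ne_zero (θ.H_ne_zero _ ((δ.mem_xProj_image h1).mp hy))
      (mul_ne_zero (pow_ne_zero 2 h1) (δ.power_ne_zero h4 _))
  m_ne_zero := θ.m_ne_zero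
  m_ne_one := θ.m_ne_one
  F_off := fun y hy => by
    rw [θ.F_off _ fun h => hy ((δ.mem_xProj_image (left_ne_zero_of_mul hδ.1)).mpr h), zero_div]
  H_off := fun y hy => by
    rw [θ.H_off _ fun h => hy ((δ.mem_xProj_image (left_ne_zero_of_mul hδ.1)).mpr h), zero_div]

theorem Params.related_act (δ : Params) (hδ : δ.Admissible D) (θ : Eqn D) :
    Related δ θ (δ.act hδ θ) := by
  have h1 := left_ne_zero_of_mul hδ.1
  have harg : ∀ x, (δ.δ₁ * x + δ.δ₃ - δ.δ₃) / δ.δ₁ = x := by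
    intro x
    field_simp
    ring
  refine ⟨rfl, fun x _ => ?_, fun x _ => ?_, rfl⟩
  · simp only [act, harg]
  · simp only [act, harg]

/-- The transformation with constant parameters. -/
def Params.perm (hD : D = Set.univ ∨ D = Set.Ioi 0) (δ : Params) (hδ : δ.Admissible D) :
    Equiv.Perm (Total D) where
  toFun := fun a => ⟨δ.act hδ a.1, ⟨δ.map a.2, a.2, a.2.2, rfl⟩⟩
  invFun := fun a => ⟨δ.inv.act (hδ.inv hD) a.1, ⟨δ.inv.map a.2, a.2, a.2.2, rfl⟩⟩
  left_inv := fun a => by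
    have h := (δ.related_act hδ a.1).inv hδ.1
    exact Total.eq_of ((δ.inv.related_act (hδ.inv hD) _).unique h
      (left_ne_zero_of_mul (hδ.inv hD).1)) (δ.inv_map_map hδ.1 _)
  right_inv := fun a => by
    have h := (δ.inv.related_act (hδ.inv hD) a.1).inv (hδ.inv hD).1
    rw [δ.inv_inv hδ.1] at h
    exact Total.eq_of ((δ.related_act hδ _).unique h (left_ne_zero_of_mul hδ.1))
      (δ.map_inv_map hδ.1 _)

theorem Params.actsBy_perm (hD : D = Set.univ ∨ D = Set.Ioi 0) (δ : Params) (hδ : δ.Admissible D)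
    (θ : Eqn D) : ActsBy δ (δ.perm hD hδ) θ :=
  ⟨δ.act hδ θ, fun _ => ⟨rfl, rfl⟩, δ.related_act hδ θ⟩

namespace ActsBy

variable {δ δ' : Params} {Φ Φ' : Equiv.Perm (Total D)} {θ θ' : Eqn D}

theorem apply_eq (h : ActsBy δ Φ θ) (h' : ActsBy δ Φ' θ) (h1 : δ.δ₁ ≠ 0) (p : θ.dom) :
    Φ ⟨θ, p⟩ = Φ' ⟨θ, p⟩ := by
  obtain ⟨θ₁, a, b⟩ := h
  obtain ⟨θ₂, a', b'⟩ := h'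
  exact Total.eq_of ((a p).1.trans ((Related.unique b b' h1).trans (a' p).1.symm))
    ((a p).2.trans (a' p).2.symm)

theorem one (θ : Eqn D) : ActsBy Params.one (1 : Equiv.Perm (Total D)) θ :=
  ⟨θ, fun p => ⟨rfl, (Params.map_one p).symm⟩, Related.one θ⟩

theorem mul (h : ActsBy δ Φ θ) (h' : ∀ θ', Related δ θ θ' → ActsBy δ' Φ' θ') :
    ActsBy (δ'.comp δ) (Φ' * Φ) θ := by
  obtain ⟨θ₁, a, b⟩ := h
  obtain ⟨θ₂, a', b'⟩ := h' θ₁ b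
  refine ⟨θ₂, fun p => ?_, Related.comp b b'⟩
  obtain ⟨q, hq⟩ : ∃ q : θ₁.dom, Φ ⟨θ, p⟩ = ⟨θ₁, q⟩ := by
    have := (a p).1
    subst this
    exact ⟨_, rfl⟩
  have hq2 := (a p).2
  rw [hq] at hq2
  rw [Equiv.Perm.mul_apply, hq, Params.map_comp, ← hq2]
  exact a' q

theorem apply (h : ActsBy δ Φ θ) (p : θ.dom) :
    ∃ (θ' : Eqn D) (q : θ'.dom), Related δ θ θ' ∧ (q : Pt) = δ.map p ∧ Φ ⟨θ, p⟩ = ⟨θ', q⟩ := by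
  obtain ⟨θ₁, a, b⟩ := h
  have h1 := (a p).1
  have h2 := (a p).2
  subst h1
  exact ⟨_, (Φ ⟨θ, p⟩).2, b, h2, rfl⟩

theorem inv (h : ActsBy δ Φ θ) (h0 : δ.δ₁ * δ.δ₄ ≠ 0) (hr : Related δ θ θ') :
    ActsBy δ.inv Φ⁻¹ θ' := by
  refine ⟨θ, fun q => ?_, hr.inv h0⟩
  obtain ⟨q, hq⟩ := q
  have hq' := hq
  rw [hr.1] at hq'
  obtain ⟨p, hp, rfl⟩ := hq'
  obtain ⟨θ₁, q₁, hr₁, hq₁, happ⟩ := h.apply ⟨p, hp⟩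
  have : (⟨θ', ⟨δ.map p, hq⟩⟩ : Total D) = Φ ⟨θ, ⟨p, hp⟩⟩ := by
    rw [happ]
    exact Total.eq_of (hr.unique hr₁ (left_ne_zero_of_mul h0)) hq₁.symm
  rw [this, Equiv.Perm.inv_def, Equiv.symm_apply_apply]
  exact ⟨rfl, (δ.inv_map_map h0 p).symm⟩

/-- Every equation is obtained from the equation to which `Φ⁻¹` maps it. -/
theorem exists_source (hΦ : ∀ θ, ∃ δ : Params, δ.Admissible D ∧ ActsBy δ Φ θ) (θ' : Eqn D) :
    ∃ (θ : Eqn D) (δ : Params), δ.Admissible D ∧ ActsBy δ Φ θ ∧ Related δ θ θ' := by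
  obtain ⟨q, hq⟩ := θ'.isConnected_dom.nonempty
  obtain ⟨θ, p, hΘ⟩ : ∃ (θ : Eqn D) (p : θ.dom), Φ⁻¹ ⟨θ', ⟨q, hq⟩⟩ = ⟨θ, p⟩ := ⟨_, _, rfl⟩
  obtain ⟨δ, hδ, ha⟩ := hΦ θ
  refine ⟨θ, δ, hδ, ha, ?_⟩
  obtain ⟨θ₁, q₁, hr₁, -, happ⟩ := ha.apply p
  rw [← hΘ, Equiv.Perm.inv_def, Equiv.apply_symm_apply] at happ
  have : θ' = θ₁ := congrArg Sigma.fst happ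
  rwa [this]

end ActsBy

/-! ### The explicit transformations are equivalence transformations -/

theorem isPointTransformation_map (δ : Params) (h : δ.δ₁ * δ.δ₄ ≠ 0) (U : Set Pt) :
    IsPointTransformation δ.map U (δ.map '' U) :=
  ⟨(Function.LeftInverse.injective (δ.inv_map_map h)).injOn.bijOn_image,
    δ.contDiff_map.contDiffOn, δ.inv.map, δ.inv.contDiff_map.contDiffOn,
    fun p _ => δ.inv_map_map h p⟩

section MapsEquation

variable (δ : Params) {u : ℝ × ℝ → ℝ}

theorem dt_tNew_map (z : ℝ × ℝ) : dt (tNew δ.map u) z = δ.δ₁ ^ 2 := by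
  change deriv (fun s => δ.δ₁ ^ 2 * s + δ.δ₂) z.1 = _
  simp

theorem dx_tNew_map (z : ℝ × ℝ) : dx (tNew δ.map u) z = 0 := by
  change deriv (fun _ => δ.δ₁ ^ 2 * z.1 + δ.δ₂) z.2 = _
  simp

theorem dt_xNew_map (z : ℝ × ℝ) : dt (xNew δ.map u) z = 0 := by
  change deriv (fun _ => δ.δ₁ * z.2 + δ.δ₃) z.1 = _
  simp

theorem dx_xNew_map (z : ℝ × ℝ) : dx (xNew δ.map u) z = δ.δ₁ := by
  change deriv (fun y => δ.δ₁ * y + δ.δ₃) z.2 = _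
  simp

theorem jac_map (z : ℝ × ℝ) : jac δ.map u z = δ.δ₁ ^ 3 := by
  rw [jac, dt_tNew_map, dx_tNew_map, dx_xNew_map]
  ring

theorem dt_const_mul (c : ℝ) (z : ℝ × ℝ) : dt (fun z => c * u z) z = c * dt u z := by
  unfold dt
  exact deriv_const_mul_field c

theorem dx_const_mul (c : ℝ) (z : ℝ × ℝ) : dx (fun z => c * u z) z = c * dx u z := by
  unfold dx
  exact deriv_const_mul_field c

theorem dtNew_map (h1 : δ.δ₁ ≠ 0) (g : ℝ × ℝ → ℝ) (z : ℝ × ℝ) :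
    dtNew δ.map u g z = (δ.δ₁ ^ 2)⁻¹ * dt g z := by
  rw [dtNew, jac_map, dt_xNew_map, dx_xNew_map]
  field_simp
  ring

theorem dxNew_map (h1 : δ.δ₁ ≠ 0) (g : ℝ × ℝ → ℝ) (z : ℝ × ℝ) :
    dxNew δ.map u g z = δ.δ₁⁻¹ * dx g z := by
  rw [dxNew, jac_map, dt_tNew_map, dx_tNew_map]
  field_simp
  ring

/-- In the new variables the equation is the old one multiplied by `δ₄ / δ₁²`. -/
theorem mapsEquation_of_related {θ θ' : Eqn D} (h0 : δ.δ₁ * δ.δ₄ ≠ 0) (h : Related δ θ θ') :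
    MapsEquation δ.map θ θ' := by
  have h1 := left_ne_zero_of_mul h0
  have h4 := right_ne_zero_of_mul h0
  intro u _ z hz hu _ _
  have hv : vNew δ.map u = fun z => δ.δ₄ * u z := rfl
  have hx : z.2 ∈ xProj θ.dom := mem_xProj hz
  have e1 : dxNew δ.map u (vNew δ.map u) = fun z => δ.δ₁⁻¹ * δ.δ₄ * dx u z := by
    funext z
    rw [dxNew_map δ h1, hv, dx_const_mul, mul_assoc]
  rw [e1, dxNew_map δ h1, dx_const_mul, dtNew_map δ h1, hv, dt_const_mul]
  change _ ↔ θ'.Holds (δ.δ₁ * z.2 + δ.δ₃) (δ.δ₄ * u z) _ _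
  unfold Eqn.Holds
  rw [h.2.1 _ hx, h.2.2.1 _ hx, h.2.2.2, Params.power, abs_mul,
    Real.mul_rpow (abs_nonneg _) (abs_nonneg _)]
  have h4' := abs_rpow_ne_zero θ.m h4
  generalize |δ.δ₄| ^ θ.m = P at *
  generalize |u z| ^ θ.m = w at *
  have e2 : δ.δ₁⁻¹ * (δ.δ₁⁻¹ * δ.δ₄ * dx (dx u) z) + θ.H z.2 / (δ.δ₁ ^ 2 * (P / δ.δ₄)) * (P * w)
      + θ.F z.2 / δ.δ₁ ^ 2 * (δ.δ₄ * u z)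
      = (δ.δ₁ ^ 2)⁻¹ * (δ.δ₄ * (dx (dx u) z + θ.H z.2 * w + θ.F z.2 * u z)) := by
    field_simp
  rw [e2, mul_right_inj' (inv_ne_zero (pow_ne_zero 2 h1)), mul_right_inj' h4]

end MapsEquation

theorem isEquivalenceTransformation_of_actsBy {Φ : Equiv.Perm (Total D)}
    (hΦ : ∀ θ, ∃ δ : Params, δ.Admissible D ∧ ActsBy δ Φ θ) : IsEquivalenceTransformation Φ := by
  intro θ
  obtain ⟨δ, hδ, θ', ha, hr⟩ := hΦ θ
  refine ⟨θ', δ.map, ha, ?_, mapsEquation_of_related δ hδ.1 hr⟩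
  rw [hr.1]
  exact isPointTransformation_map δ hδ.1 _

/-- The transformation of the space of `(t, x, v, F, H, m)` with given parameters. -/
def Params.extMap (δ : Params) (w : Pt × ℝ × ℝ × ℝ) : Pt × ℝ × ℝ × ℝ :=
  (δ.map w.1, w.2.1 / δ.δ₁ ^ 2, w.2.2.1 / (δ.δ₁ ^ 2 * δ.power w.2.2.2), w.2.2.2)

theorem Params.contDiff_extMap (δ : Params) (h : δ.δ₁ * δ.δ₄ ≠ 0) : ContDiff ℝ ∞ δ.extMap := by
  have h1 := left_ne_zero_of_mul h
  have h4 := right_ne_zero_of_mul h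
  have hp : ContDiff ℝ ∞ δ.power := by
    have : δ.power = fun m => Real.exp (Real.log δ.δ₄ * m) / δ.δ₄ := funext (δ.power_eq_exp h4)
    rw [this]
    fun_prop
  unfold extMap
  refine (δ.contDiff_map.comp contDiff_fst).prodMk (ContDiff.prodMk (by fun_prop)
    (ContDiff.prodMk (ContDiff.div (by fun_prop) ?_ ?_) (by fun_prop)))
  · exact contDiff_const.mul (hp.comp (by fun_prop))
  · exact fun w => mul_ne_zero (pow_ne_zero 2 h1) (δ.power_ne_zero h4 _)

theorem Params.inv_extMap_extMap (δ : Params) (h : δ.δ₁ * δ.δ₄ ≠ 0) (w : Pt × ℝ × ℝ × ℝ) :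
    δ.inv.extMap (δ.extMap w) = w := by
  have h1 := left_ne_zero_of_mul h
  have h4 := right_ne_zero_of_mul h
  have hP := δ.power_ne_zero h4 w.2.2.2
  unfold extMap
  refine Prod.ext (δ.inv_map_map h _) (Prod.ext ?_ (Prod.ext ?_ rfl))
  · simp only [Params.inv]
    field_simp
  · simp only [power_inv]
    simp only [Params.inv]
    field_simp

theorem Params.extMap_mem (δ : Params) (hδ : δ.Admissible D) {w : Pt × ℝ × ℝ × ℝ}
    (hw : w ∈ extSpace D) : δ.extMap w ∈ extSpace D :=
  ⟨hδ.2 _ hw.1, div_ne_zero hw.2.1 (mul_ne_zero (pow_ne_zero 2 (left_ne_zero_of_mul hδ.1))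
    (δ.power_ne_zero (right_ne_zero_of_mul hδ.1) _)), hw.2.2⟩

theorem Params.isPointTransformation_extMap (hD : D = Set.univ ∨ D = Set.Ioi 0) (δ : Params)
    (hδ : δ.Admissible D) : IsPointTransformation δ.extMap (extSpace D) (extSpace D) := by
  have h := hδ.inv hD
  refine ⟨?_, (δ.contDiff_extMap hδ.1).contDiffOn, δ.inv.extMap,
    (δ.inv.contDiff_extMap h.1).contDiffOn, fun w _ => δ.inv_extMap_extMap hδ.1 w⟩
  refine Set.InvOn.bijOn (f' := δ.inv.extMap) ⟨fun w _ => δ.inv_extMap_extMap hδ.1 w, fun w _ => ?_⟩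
    (fun w hw => δ.extMap_mem hδ hw) (fun w hw => δ.inv.extMap_mem h hw)
  have := δ.inv.inv_extMap_extMap h.1 w
  rwa [δ.inv_inv hδ.1] at this

theorem mem_usualEquivGroup_of_actsBy (hD : D = Set.univ ∨ D = Set.Ioi 0) {δ : Params}
    (hδ : δ.Admissible D) {Ψ : Equiv.Perm (Total D)} (h : ∀ θ, ActsBy δ Ψ θ) :
    Ψ ∈ usualEquivGroup D := by
  refine ⟨isEquivalenceTransformation_of_actsBy fun θ => ⟨δ, hδ, h θ⟩, δ.extMap, δ.map,
    δ.isPointTransformation_extMap hD hδ, fun w _ => rfl, ?_⟩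
  intro θ p θ' p' hΨ
  obtain ⟨θ₁, q, hr, hq, happ⟩ := (h θ).apply p
  rw [hΨ] at happ
  cases happ
  have hx := mem_xProj p.2
  unfold Params.extMap
  rw [hq]
  refine Prod.ext rfl (Prod.ext ?_ (Prod.ext ?_ ?_))
  · exact (hr.2.1 _ hx).symm
  · exact (hr.2.2.1 _ hx).symm
  · exact hr.2.2.2.symm

/-! ### The usual equivalence group -/

theorem FirstOrder.congr {f f' : Pt → Pt} {p : Pt} (h : FirstOrder f p) (hf : f =ᶠ[𝓝 p] f') :
    FirstOrder f' p := by
  have hT : compT f =ᶠ[𝓝 p] compT f' := hf.mono fun q hq => by simp [compT, hq]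
  have hX : compX f =ᶠ[𝓝 p] compX f' := hf.mono fun q hq => by simp [compX, hq]
  have hV : compV f =ᶠ[𝓝 p] compV f' := hf.mono fun q hq => by simp [compV, hq]
  obtain ⟨h1, h2, h3, h4, h5, h6, h7, h8⟩ := h
  rw [pd_congr _ hT] at h1 h2
  rw [pd_congr _ hX] at h3 h4
  rw [pd_congr _ hV] at h5 h6
  rw [pd_congr _ hX, pd_congr _ hT] at h7
  rw [pd_congr _ hV, hV.eq_of_nhds] at h8
  exact ⟨h1, h2, h3, h4, h5, h6, h7, h8⟩

theorem actsBy_of_map {Φ : Equiv.Perm (Total D)} {θ θ' : Eqn D} {f : Pt → Pt} {δ : Params}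
    (ha : ∀ p : θ.dom, (Φ ⟨θ, p⟩).1 = θ' ∧ ((Φ ⟨θ, p⟩).2 : Pt) = f p)
    (hf : IsPointTransformation f θ.dom θ'.dom) (hmap : MapsEquation f θ θ')
    (h0 : δ.δ₁ * δ.δ₄ ≠ 0) (hfδ : ∀ p ∈ θ.dom, f p = δ.map p) : ActsBy δ Φ θ :=
  ⟨θ', fun p => ⟨(ha p).1, (ha p).2.trans (hfδ p p.2)⟩,
    hf.1.image_eq.symm.trans (Set.image_congr hfδ), formulas_of_map hf hmap h0 hfδ⟩

theorem exists_admissible_of_firstOrder (hD : D = Set.univ ∨ D = Set.Ioi 0) {θ θ' : Eqn D}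
    {f : Pt → Pt} (hf : IsPointTransformation f θ.dom θ'.dom)
    (hfo : ∀ p ∈ regularPart f θ.dom, FirstOrder f p) :
    ∃ δ : Params, δ.Admissible D ∧ ∀ p ∈ θ.dom, f p = δ.map p := by
  have hs := hf.contDiffAt θ.isOpen_dom
  have hdet := fun p (hp : p ∈ θ.dom) => jacDet_ne_zero θ.isOpen_dom θ'.isOpen_dom hf hp
  obtain ⟨δ, h0, hδ⟩ := exists_params_of_firstOrder θ.isOpen_dom θ.isConnected_dom hs hdet
    (firstOrder_of_regularPart θ.isOpen_dom hs hdet hfo)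
  refine ⟨δ, (δ.admissible_iff hD).mpr ⟨h0, hD.imp_right ?_⟩, hδ⟩
  rintro rfl
  -- On the half-line one point of the domain already shows the sign of `δ₄`: both `v` and `δ₄ v`
  -- are positive there.
  obtain ⟨p, hp⟩ := θ.isConnected_dom.nonempty
  have h1 : 0 < p.2.2 := θ.dom_values p hp
  have h2 : 0 < (f p).2.2 := θ'.dom_values _ (hf.1.mapsTo hp)
  rw [hδ p hp] at h2
  exact pos_of_mul_pos_left h2 h1.le

theorem iteratedDeriv_exp (n : ℕ) : iteratedDeriv n Real.exp = Real.exp := by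
  rw [iteratedDeriv_eq_iterate, Real.iter_deriv_exp]

/-- An equation on the whole space all of whose transformations are explicit. -/
def genericEqn (hD : D = Set.univ ∨ D = Set.Ioi 0) : Eqn D where
  dom := {p | p.2.2 ∈ D}
  isOpen_dom := by
    have : IsOpen D := by
      rcases hD with rfl | rfl
      · exact isOpen_univ
      · exact isOpen_Ioi
    exact this.preimage (continuous_snd.comp continuous_snd)
  isConnected_dom := by
    have h : IsConnected D := by
      rcases hD with rfl | rfl
      · exact isConnected_univ
      · exact isConnected_Ioi
    have h2 : {p : Pt | p.2.2 ∈ D} = Set.univ ×ˢ (Set.univ ×ˢ D) := by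
      ext p
      simp
    rw [h2]
    exact isConnected_univ.prod (isConnected_univ.prod h)
  dom_values := fun _ hp => hp
  F := fun _ => 0
  H := fun x => Real.exp (Real.exp x)
  m := 3
  smooth_F := contDiffOn_const
  smooth_H := by fun_prop
  H_ne_zero := fun _ _ => Real.exp_ne_zero _
  m_ne_zero := by norm_num
  m_ne_one := by norm_num
  F_off := fun _ _ => rfl
  H_off := fun x hx => by
    refine absurd ⟨(0, x, 1), ?_, rfl⟩ hx
    rcases hD with rfl | rfl <;> simp

/-- Here `log H = exp` coincides with all its derivatives, so the genericity expression is `(4 - 3)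
exp(x)²`. -/
theorem genericEqn_generic (hD : D = Set.univ ∨ D = Set.Ioi 0) (x : ℝ) :
    (genericEqn hD).Generic x := by
  have h : (genericEqn hD).logH = Real.exp := funext fun y => Real.log_exp _
  unfold Eqn.Generic
  rw [h, iteratedDeriv_exp, iteratedDeriv_exp, iteratedDeriv_exp]
  have := Real.exp_pos x
  nlinarith

/-- Projectibility makes the point transformation `φ` the same for all equations. The generic
equation lives on the largest possible domain, so its parameters describe `φ` on every other domain.
-/
theorem exists_params_of_mem_usualEquivGroup (hD : D = Set.univ ∨ D = Set.Ioi 0)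
    {Ψ : Equiv.Perm (Total D)} (hΨ : Ψ ∈ usualEquivGroup D) :
    ∃ δ : Params, δ.Admissible D ∧ ∀ θ, ActsBy δ Ψ θ := by
  obtain ⟨hE, Θ, φ, -, hproj, hΘ⟩ := hΨ
  have hφ : ∀ (θ : Eqn D) (p : θ.dom), ((Ψ ⟨θ, p⟩).2 : Pt) = φ p := by
    intro θ p
    have h1 := hΘ θ p (Ψ ⟨θ, p⟩).1 (Ψ ⟨θ, p⟩).2 rfl
    have h2 := hproj ((p : Pt), θ.F (p : Pt).2.1, θ.H (p : Pt).2.1, θ.m)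
      ⟨θ.dom_values p p.2, θ.H_ne_zero _ (mem_xProj p.2), θ.m_ne_zero, θ.m_ne_one⟩
    rw [h1] at h2
    exact h2
  obtain ⟨θ', f, ha, hf, hmap⟩ := hE (genericEqn hD)
  obtain ⟨δ, hδ, hfδ⟩ := exists_admissible_of_firstOrder hD hf fun p hp =>
    (localMap_regularPart hf hmap).firstOrder hp (by norm_num [genericEqn])
      (genericEqn_generic hD _)
  refine ⟨δ, hδ, fun θ => ?_⟩
  obtain ⟨θ'', g, hb, hg, hmap'⟩ := hE θ
  refine actsBy_of_map hb hg hmap' hδ.1 fun p hp => ?_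
  have hp' : p ∈ (genericEqn hD).dom := θ.dom_values p hp
  rw [← hfδ p hp', ← (hb ⟨p, hp⟩).2, ← (ha ⟨p, hp'⟩).2, hφ, hφ]

theorem mem_usualEquivGroup_iff (hD : D = Set.univ ∨ D = Set.Ioi 0) (Ψ : Equiv.Perm (Total D)) :
    Ψ ∈ usualEquivGroup D ↔ ∃ δ : Params, δ.Admissible D ∧ ∀ θ, ActsBy δ Ψ θ :=
  ⟨exists_params_of_mem_usualEquivGroup hD, fun ⟨_, hδ, h⟩ => mem_usualEquivGroup_of_actsBy hD hδ h⟩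

/-! ### Perturbation of the arbitrary elements -/

/-- A smooth family of equations which starts at `θ` and is generic for small nonzero `s`. -/
def Eqn.perturb (θ : Eqn D) (s : ℝ) : Eqn D where
  dom := θ.dom
  isOpen_dom := θ.isOpen_dom
  isConnected_dom := θ.isConnected_dom
  dom_values := θ.dom_values
  F := θ.F
  H := fun x => θ.H x * Real.exp (s * Real.exp x)
  -- The square keeps the exponent at least `2`, hence away from `0` and `1` for every real `s`.
  m := if θ.m = 2 then 2 + s ^ 2 else θ.m
  smooth_F := θ.smooth_F
  smooth_H := θ.smooth_H.mul (by fun_prop)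
  H_ne_zero := fun x hx => mul_ne_zero (θ.H_ne_zero x hx) (Real.exp_ne_zero _)
  m_ne_zero := by
    split_ifs
    · positivity
    · exact θ.m_ne_zero
  m_ne_one := by
    split_ifs
    · nlinarith [sq_nonneg s]
    · exact θ.m_ne_one
  F_off := θ.F_off
  H_off := fun x hx => by rw [θ.H_off x hx, zero_mul]

theorem Eqn.perturb_zero (θ : Eqn D) : θ.perturb 0 = θ := by
  refine Eqn.eq_of rfl (fun _ _ => rfl) (fun x _ => ?_) ?_
  · simp [perturb]
  · simp only [perturb]
    split_ifs with h
    · rw [h]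
      norm_num
    · rfl

theorem Eqn.smoothFamily_perturb (θ : Eqn D) : SmoothFamily θ.perturb := by
  have hmaps : Set.MapsTo (fun q : ℝ × ℝ => q.2) {q : ℝ × ℝ | q.2 ∈ xProj (θ.perturb q.1).dom}
      (xProj θ.dom) := fun _ hq => hq
  refine ⟨θ.isOpen_dom.preimage continuous_snd, ?_, ?_, ?_⟩
  · by_cases h : θ.m = 2
    · have : (fun s => (θ.perturb s).m) = fun s => 2 + s ^ 2 := by
        funext s
        simp [perturb, h]
      rw [this]
      fun_prop
    · have : (fun s => (θ.perturb s).m) = fun _ => θ.m := by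
        funext s
        simp [perturb, h]
      rw [this]
      fun_prop
  · exact θ.smooth_F.comp contDiff_snd.contDiffOn hmaps
  · refine (θ.smooth_H.comp contDiff_snd.contDiffOn hmaps).mul ?_
    exact (by fun_prop : ContDiff ℝ ∞ fun q : ℝ × ℝ => Real.exp (q.1 * Real.exp q.2)).contDiffOn

theorem Eqn.iteratedDeriv_logH_perturb (θ : Eqn D) {x : ℝ} (hx : x ∈ xProj θ.dom) (s : ℝ) (n : ℕ) :
    iteratedDeriv n (θ.perturb s).logH x = iteratedDeriv n θ.logH x + s * Real.exp x := by
  have h : (θ.perturb s).logH =ᶠ[𝓝 x] θ.logH + fun y => s * Real.exp y := by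
    filter_upwards [(isOpen_xProj θ.isOpen_dom).mem_nhds hx] with y hy
    change Real.log (θ.H y * _) = _
    rw [Real.log_mul (θ.H_ne_zero y hy) (Real.exp_ne_zero _), Real.log_exp]
    rfl
  rw [h.iteratedDeriv_eq, iteratedDeriv_add, iteratedDeriv_const_mul_field, iteratedDeriv_exp]
  · exact (θ.contDiffAt_logH hx).of_le (by exact_mod_cast le_top)
  · exact ContDiff.contDiffAt (by fun_prop)

theorem eventually_quadratic_ne_zero {a b c : ℝ} (hc : c ≠ 0) :
    ∀ᶠ s in 𝓝[≠] (0 : ℝ), a + b * s + c * s ^ 2 ≠ 0 := by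
  let P : Polynomial ℝ := Polynomial.C a + Polynomial.C b * Polynomial.X
    + Polynomial.C c * Polynomial.X ^ 2
  have hP : P ≠ 0 := by
    intro h
    apply hc
    have := congrArg (fun Q => Polynomial.coeff Q 2) h
    simpa [P, Polynomial.coeff_X, Polynomial.coeff_C] using this
  have hfin : {s : ℝ | P.IsRoot s}.Finite := Polynomial.finite_setOfPred_isRoot hP
  have hmem : ({s : ℝ | P.IsRoot s} \ {0})ᶜ ∈ 𝓝 (0 : ℝ) :=
    (hfin.subset Set.sdiff_subset).isClosed.isOpen_compl.mem_nhds (by simp)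
  filter_upwards [mem_nhdsWithin_of_mem_nhds hmem, self_mem_nhdsWithin] with s h1 h2 h3
  exact h1 ⟨by simpa [P, Polynomial.IsRoot] using h3, h2⟩

/-- The perturbation adds `s e^x` to every derivative of `log |H|`, so the genericity expression is
a quadratic polynomial in `s` with leading coefficient `(4 - 3) e^(2x)`, which has finitely many
roots. -/
theorem Eqn.eventually_generic_perturb (θ : Eqn D) {x : ℝ} (hx : x ∈ xProj θ.dom) :
    ∀ᶠ s in 𝓝[≠] (0 : ℝ), (θ.perturb s).Generic x ∧ (θ.perturb s).m ≠ 2 := by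
  have h := eventually_quadratic_ne_zero (c := Real.exp x ^ 2)
    (a := 4 * iteratedDeriv 4 θ.logH x ^ 2
      - 3 * iteratedDeriv 3 θ.logH x * iteratedDeriv 5 θ.logH x)
    (b := Real.exp x * (8 * iteratedDeriv 4 θ.logH x - 3 * iteratedDeriv 3 θ.logH x
      - 3 * iteratedDeriv 5 θ.logH x)) (pow_ne_zero 2 (Real.exp_ne_zero x))
  filter_upwards [h, self_mem_nhdsWithin] with s hs hs0
  constructor
  · unfold Generic
    rw [θ.iteratedDeriv_logH_perturb hx, θ.iteratedDeriv_logH_perturb hx,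
      θ.iteratedDeriv_logH_perturb hx]
    intro h0
    apply hs
    linear_combination h0
  · simp only [perturb]
    split_ifs with hm
    · have : s ^ 2 ≠ 0 := pow_ne_zero 2 hs0
      intro h0
      apply this
      linarith
    · exact hm

theorem eq_zero_of_eventually_punctured {ψ : ℝ → ℝ} (hψ : ContinuousAt ψ 0)
    (h : ∀ᶠ s in 𝓝[≠] (0 : ℝ), ψ s = 0) : ψ 0 = 0 :=
  tendsto_nhds_unique (hψ.tendsto.mono_left nhdsWithin_le_nhds)
    (tendsto_const_nhds.congr' (h.mono fun _ hs => hs.symm))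

/-- A derivative of the member of the family at `s` is a joint derivative in the direction `(0, e)`,
which is continuous in `s`. -/
theorem continuousAt_pd_family {g : ℝ × Pt → ℝ} {s : ℝ} {p : Pt} {W : Set (ℝ × Pt)}
    (hW : IsOpen W) (hp : (s, p) ∈ W) (hg : ContDiffOn ℝ ∞ g W) (e : Pt) :
    ContinuousAt (fun s => pd e (fun p => g (s, p)) p) s := by
  have hgp : ContDiffAt ℝ ∞ g (s, p) := hg.contDiffAt (hW.mem_nhds hp)
  have hc : Continuous fun r : ℝ => (r, p) := by fun_prop
  have h1 : ContinuousAt (fun r : ℝ => fderiv ℝ g (r, p) (0, e)) s :=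
    (ContinuousAt.comp (f := fun r : ℝ => (r, p)) (g := fderiv ℝ g)
      (hgp.fderiv_right (m := ∞) (by simp)).continuousAt hc.continuousAt).clm_apply
      continuousAt_const
  refine h1.congr ?_
  filter_upwards [hc.continuousAt.eventually (hW.mem_nhds hp)] with r hr
  have hd := differentiableAt_of_smooth (hg.contDiffAt (hW.mem_nhds hr))
  have := hd.hasFDerivAt.comp p ((hasFDerivAt_const r p).prodMk (hasFDerivAt_id p))
  unfold pd
  rw [show (fun p => g (r, p)) = g ∘ fun p => (r, p) from rfl]
  rw [HasFDerivAt.fderiv this]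
  simp

/-- The generic argument need not apply to `θ` itself. It applies to the members of `θ.perturb` at
small `s ≠ 0`, and smooth dependence carries the first-order conditions to `s = 0`. -/
theorem exists_actsBy_of_mem_genExtEquivGroup (hD : D = Set.univ ∨ D = Set.Ioi 0)
    {Φ : Equiv.Perm (Total D)} (hE : IsEquivalenceTransformation Φ) (hS : DependsSmoothly Φ)
    (θ : Eqn D) : ∃ δ : Params, δ.Admissible D ∧ ActsBy δ Φ θ := by
  obtain ⟨θ₁, G, -, hG, hGa⟩ := hS θ.perturb θ.smoothFamily_perturb
  have hE' : ∀ s, ∃ (θ' : Eqn D) (f : Pt → Pt), (∀ p ∈ θ.dom, f p = G (s, p)) ∧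
      (∀ p : (θ.perturb s).dom, (Φ ⟨θ.perturb s, p⟩).1 = θ' ∧
        ((Φ ⟨θ.perturb s, p⟩).2 : Pt) = f p) ∧
      IsPointTransformation f θ.dom θ'.dom ∧ MapsEquation f (θ.perturb s) θ' := by
    intro s
    obtain ⟨θ', f, ha, hf, hmap⟩ := hE (θ.perturb s)
    refine ⟨θ', f, fun p hp => ?_, ha, hf, hmap⟩
    exact (ha ⟨p, hp⟩).2.symm.trans (hGa s ⟨p, hp⟩).2
  have hW : IsOpen {q : ℝ × Pt | q.2 ∈ (θ.perturb q.1).dom} := θ.smoothFamily_perturb.1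
  have hfo : ∀ p ∈ θ.dom, p.2.2 ≠ 0 → compV (fun p => G (0, p)) p ≠ 0 →
      FirstOrder (fun p => G (0, p)) p := by
    intro p hp hv hV
    have hGp : ContDiffAt ℝ ∞ G (0, p) := hG.contDiffAt (hW.mem_nhds hp)
    have hVc : ContinuousAt (fun s => compV (fun p => G (s, p)) p) 0 :=
      ContinuousAt.comp (f := fun s : ℝ => (s, p)) (g := fun q => (G q).2.2)
        hGp.snd.snd.continuousAt (by fun_prop)
    -- How small `s` must be may depend on `p`; this is harmless, as the limit is taken at each
    -- point separately.
    have hev : ∀ᶠ s in 𝓝[≠] (0 : ℝ), FirstOrder (fun p => G (s, p)) p := by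
      filter_upwards [θ.eventually_generic_perturb (mem_xProj hp),
        mem_nhdsWithin_of_mem_nhds (hVc.eventually_ne hV)] with s hs hVs
      obtain ⟨θ', f, hfG, -, hf, hmap⟩ := hE' s
      have hreg : p ∈ regularPart f θ.dom := by
        refine ⟨hp, hv, ?_⟩
        unfold compV at hVs ⊢
        rwa [hfG p hp]
      exact ((localMap_regularPart (θ := θ.perturb s) hf hmap).firstOrder hreg hs.2 hs.1).congr
        (mem_of_superset (θ.isOpen_dom.mem_nhds hp) hfG)
    have hT := fun e => continuousAt_pd_family (g := fun q => (G q).1) hW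
      (show ((0 : ℝ), p) ∈ _ from hp) hG.fst e
    have hX := fun e => continuousAt_pd_family (g := fun q => (G q).2.1) hW
      (show ((0 : ℝ), p) ∈ _ from hp) hG.snd.fst e
    have hV := fun e => continuousAt_pd_family (g := fun q => (G q).2.2) hW
      (show ((0 : ℝ), p) ∈ _ from hp) hG.snd.snd e
    refine ⟨?_, ?_, ?_, ?_, ?_, ?_, ?_, ?_⟩
    · exact eq_zero_of_eventually_punctured (hT eX) (hev.mono fun _ h => h.T_x)
    · exact eq_zero_of_eventually_punctured (hT eV) (hev.mono fun _ h => h.T_v)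
    · exact eq_zero_of_eventually_punctured (hX eV) (hev.mono fun _ h => h.X_v)
    · exact eq_zero_of_eventually_punctured (hX eT) (hev.mono fun _ h => h.X_t)
    · exact eq_zero_of_eventually_punctured (hV eT) (hev.mono fun _ h => h.V_t)
    · exact eq_zero_of_eventually_punctured (hV eX) (hev.mono fun _ h => h.V_x)
    · exact sub_eq_zero.mp (eq_zero_of_eventually_punctured (((hX eX).pow 2).sub (hT eT))
        (hev.mono fun _ h => sub_eq_zero.mpr h.T_t))
    · exact sub_eq_zero.mp (eq_zero_of_eventually_punctured
        (hVc.sub (continuousAt_const.mul (hV eV)))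
        (hev.mono fun _ h => sub_eq_zero.mpr h.V_v))
  obtain ⟨θ', f, hfG, ha, hf, hmap⟩ := hE' 0
  rw [θ.perturb_zero] at ha hmap
  obtain ⟨δ, hδ, hfδ⟩ := exists_admissible_of_firstOrder hD hf fun p hp =>
    (hfo p hp.1 hp.2.1 (by
      have := hp.2.2
      unfold compV at this
      rwa [hfG p hp.1] at this)).congr
      (mem_of_superset (θ.isOpen_dom.mem_nhds hp.1) fun q hq => (hfG q hq).symm)
  exact ⟨δ, hδ, actsBy_of_map ha hf hmap hδ.1 hfδ⟩

/-! ### Smooth dependence of the parameters -/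

/-- The parameters are chosen separately for each equation, but the transformation determines them:
`δ₁` and `δ₄` are difference quotients of its components, and `δ₂`, `δ₃` are what remains. -/
theorem isGivenByFormulas_of_mem (hD : D = Set.univ ∨ D = Set.Ioi 0) {Φ : Equiv.Perm (Total D)}
    (hE : IsEquivalenceTransformation Φ) (hS : DependsSmoothly Φ) : IsGivenByFormulas Φ := by
  choose δ hδ hact using exists_actsBy_of_mem_genExtEquivGroup hD hE hS
  refine ⟨δ, fun θ => ⟨hδ θ, hact θ⟩, fun θ hθ => ?_⟩
  obtain ⟨θ', f, -, hf, hfa⟩ := hS θ hθ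
  have hfδ : ∀ s, ∀ p ∈ (θ s).dom, f (s, p) = (δ (θ s)).map p := by
    intro s p hp
    obtain ⟨_, ha, -⟩ := hact (θ s)
    rw [← (hfa s ⟨p, hp⟩).2, (ha ⟨p, hp⟩).2]
  have key : ∀ s₀, ContDiffAt ℝ ∞ (fun s => (δ (θ s)).δ₁) s₀ ∧
      ContDiffAt ℝ ∞ (fun s => (δ (θ s)).δ₂) s₀ ∧ ContDiffAt ℝ ∞ (fun s => (δ (θ s)).δ₃) s₀ ∧
      ContDiffAt ℝ ∞ (fun s => (δ (θ s)).δ₄) s₀ := by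
    intro s₀
    obtain ⟨⟨t, x, v⟩, hp⟩ := (θ s₀).isConnected_dom.nonempty
    -- The base point and its two shifts by `ε` lie in the domain at `s₀`, hence in the domains for
    -- all `s` near `s₀` by openness of the family.
    obtain ⟨ε, hε, hx, hv⟩ : ∃ ε : ℝ, ε ≠ 0 ∧ (t, x + ε, v) ∈ (θ s₀).dom ∧
        (t, x, v + ε) ∈ (θ s₀).dom := by
      have hO := (θ s₀).isOpen_dom
      have h1 : ∀ᶠ ε : ℝ in 𝓝 0, (t, x + ε, v) ∈ (θ s₀).dom :=
        (by fun_prop : Continuous fun ε : ℝ => ((t, x + ε, v) : Pt)).continuousAt.eventually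
          (hO.mem_nhds (by simpa using hp))
      have h2 : ∀ᶠ ε : ℝ in 𝓝 0, (t, x, v + ε) ∈ (θ s₀).dom :=
        (by fun_prop : Continuous fun ε : ℝ => ((t, x, v + ε) : Pt)).continuousAt.eventually
          (hO.mem_nhds (by simpa using hp))
      have h3 : ∀ᶠ ε : ℝ in 𝓝[≠] 0, ε ≠ 0 := self_mem_nhdsWithin
      obtain ⟨ε, h4, h5, h6⟩ := (h3.and (mem_nhdsWithin_of_mem_nhds (h1.and h2))).exists
      exact ⟨ε, h4, h5, h6⟩
    have hev : ∀ p, p ∈ (θ s₀).dom → ∀ᶠ s in 𝓝 s₀, f (s, p) = (δ (θ s)).map p := by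
      intro p hp
      have : ∀ᶠ s in 𝓝 s₀, (s, p) ∈ {q : ℝ × Pt | q.2 ∈ (θ q.1).dom} :=
        (by fun_prop : Continuous fun s : ℝ => (s, p)).continuousAt.eventually (hθ.1.mem_nhds hp)
      exact this.mono fun s hs => hfδ s p hs
    have hsm : ∀ p, p ∈ (θ s₀).dom → ContDiffAt ℝ ∞ (fun s => f (s, p)) s₀ := by
      intro p hp
      exact ContDiffAt.comp s₀ (g := f) (f := fun s : ℝ => (s, p))
        (hf.contDiffAt (hθ.1.mem_nhds hp)) (by fun_prop)
    have c1 : ContDiffAt ℝ ∞ (fun s => (δ (θ s)).δ₁) s₀ := by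
      refine (((hsm _ hx).snd.fst.sub (hsm _ hp).snd.fst).div_const ε).congr_of_eventuallyEq ?_
      filter_upwards [hev _ hx, hev _ hp] with s h1 h2
      simp only [h1, h2, Params.map]
      field_simp
      ring
    have c4 : ContDiffAt ℝ ∞ (fun s => (δ (θ s)).δ₄) s₀ := by
      refine (((hsm _ hv).snd.snd.sub (hsm _ hp).snd.snd).div_const ε).congr_of_eventuallyEq ?_
      filter_upwards [hev _ hv, hev _ hp] with s h1 h2
      simp only [h1, h2, Params.map]
      field_simp
      ring
    refine ⟨c1, ?_, ?_, c4⟩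
    · refine ((hsm _ hp).fst.sub ((c1.pow 2).mul contDiffAt_const)).congr_of_eventuallyEq
        (f₁ := fun s => (δ (θ s)).δ₂) (f := fun s => (f (s, (t, x, v))).1 - (δ (θ s)).δ₁ ^ 2 * t) ?_
      filter_upwards [hev _ hp] with s h1
      simp only [h1, Params.map]
      ring
    · refine ((hsm _ hp).snd.fst.sub (c1.mul contDiffAt_const)).congr_of_eventuallyEq
        (f₁ := fun s => (δ (θ s)).δ₃) (f := fun s => (f (s, (t, x, v))).2.1 - (δ (θ s)).δ₁ * x) ?_
      filter_upwards [hev _ hp] with s h1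
      simp only [h1, Params.map]
      ring
  exact ⟨contDiff_iff_contDiffAt.mpr fun s => (key s).1,
    contDiff_iff_contDiffAt.mpr fun s => (key s).2.1,
    contDiff_iff_contDiffAt.mpr fun s => (key s).2.2.1,
    contDiff_iff_contDiffAt.mpr fun s => (key s).2.2.2⟩

theorem IsGivenByFormulas.exists_actsBy {Φ : Equiv.Perm (Total D)} (h : IsGivenByFormulas Φ) :
    ∀ θ, ∃ δ : Params, δ.Admissible D ∧ ActsBy δ Φ θ := by
  obtain ⟨δ, hδ, -⟩ := h
  exact fun θ => ⟨δ θ, hδ θ⟩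

/-- The total domain of the new family is a preimage of the old one under the inverse maps, and the
new `F`, `H` are the old ones composed with the inverse change of `x` and rescaled, all smoothly in
`s`. -/
theorem IsGivenByFormulas.dependsSmoothly {Φ : Equiv.Perm (Total D)} (h : IsGivenByFormulas Φ) :
    DependsSmoothly Φ := by
  obtain ⟨δ, hδ, hsm⟩ := h
  intro θ hθ
  obtain ⟨c1, c2, c3, c4⟩ := hsm θ hθ
  have hact := fun s => (hδ (θ s)).2
  choose θ' ha hr using hact
  obtain ⟨hopen, hm, hF, hH⟩ := hθ
  have n0 : ∀ s, (δ (θ s)).δ₁ * (δ (θ s)).δ₄ ≠ 0 := fun s => (hδ (θ s)).1.1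
  have n1 : ∀ s, (δ (θ s)).δ₁ ≠ 0 := fun s => left_ne_zero_of_mul (n0 s)
  have n4 : ∀ s, (δ (θ s)).δ₄ ≠ 0 := fun s => right_ne_zero_of_mul (n0 s)
  have hr' : ∀ s, Related (δ (θ s)) (θ s) (θ' s) := hr
  have hmaps : Set.MapsTo
      (fun q : ℝ × ℝ => (q.1, (q.2 - (δ (θ q.1)).δ₃) / (δ (θ q.1)).δ₁))
      {q : ℝ × ℝ | q.2 ∈ xProj (θ' q.1).dom} {q : ℝ × ℝ | q.2 ∈ xProj (θ q.1).dom} := by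
    intro q hq
    have hq' : q.2 ∈ xProj (θ' q.1).dom := hq
    rw [(hr' q.1).1, Params.mem_xProj_image _ (n1 q.1)] at hq'
    exact hq'
  have c1' : ContDiff ℝ ∞ fun q : ℝ × ℝ => (δ (θ q.1)).δ₁ := c1.comp contDiff_fst
  have c3' : ContDiff ℝ ∞ fun q : ℝ × ℝ => (δ (θ q.1)).δ₃ := c3.comp contDiff_fst
  have harg : ContDiff ℝ ∞
      (fun q : ℝ × ℝ => (q.1, (q.2 - (δ (θ q.1)).δ₃) / (δ (θ q.1)).δ₁)) :=
    contDiff_fst.prodMk ((contDiff_snd.sub c3').div c1' fun q => n1 q.1)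
  have hpow : ContDiff ℝ ∞ fun s => (δ (θ s)).power (θ s).m := by
    have : (fun s => (δ (θ s)).power (θ s).m)
        = fun s => Real.exp (Real.log (δ (θ s)).δ₄ * (θ s).m) / (δ (θ s)).δ₄ :=
      funext fun s => Params.power_eq_exp _ (n4 s) _
    rw [this]
    exact (((c4.log n4).mul hm).exp).div c4 n4
  refine ⟨θ', fun q => (δ (θ q.1)).map q.2, ⟨?_, ?_, ?_, ?_⟩, ?_, ?_⟩
  · have : {q : ℝ × Pt | q.2 ∈ (θ' q.1).dom}
        = (fun q : ℝ × Pt => (q.1, (δ (θ q.1)).inv.map q.2)) ⁻¹'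
          {q : ℝ × Pt | q.2 ∈ (θ q.1).dom} := by
      ext q
      change q.2 ∈ (θ' q.1).dom ↔ _
      rw [(hr' q.1).1, Params.image_map _ (n0 q.1)]
      rfl
    rw [this]
    refine hopen.preimage ?_
    have k1 : Continuous fun q : ℝ × Pt => (δ (θ q.1)).δ₁⁻¹ :=
      (c1.continuous.comp continuous_fst).inv₀ fun q => n1 q.1
    have k1' : Continuous fun q : ℝ × Pt => (δ (θ q.1)).δ₁ := c1.continuous.comp continuous_fst
    have k2 : Continuous fun q : ℝ × Pt => (δ (θ q.1)).δ₂ := c2.continuous.comp continuous_fst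
    have k3 : Continuous fun q : ℝ × Pt => (δ (θ q.1)).δ₃ := c3.continuous.comp continuous_fst
    have k4 : Continuous fun q : ℝ × Pt => (δ (θ q.1)).δ₄⁻¹ :=
      (c4.continuous.comp continuous_fst).inv₀ fun q => n4 q.1
    simp only [Params.map, Params.inv]
    refine continuous_fst.prodMk (((((k1.pow 2).mul (by fun_prop)).add
      (k2.neg.div (k1'.pow 2) fun q => pow_ne_zero 2 (n1 q.1)))).prodMk
      (((k1.mul (by fun_prop)).add (k3.neg.div k1' fun q => n1 q.1)).prodMk
        (k4.mul (by fun_prop))))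
  · rw [show (fun s => (θ' s).m) = fun s => (θ s).m from funext fun s => (hr' s).2.2.2]
    exact hm
  · refine ((hF.comp harg.contDiffOn hmaps).div (c1'.pow 2).contDiffOn
      fun q _ => pow_ne_zero 2 (n1 q.1)).congr fun q _ => ?_
    exact (hr' q.1).F_eq (n1 q.1) q.2
  · refine ((hH.comp harg.contDiffOn hmaps).div
      ((c1'.pow 2).mul (hpow.comp contDiff_fst)).contDiffOn
      fun q _ => mul_ne_zero (pow_ne_zero 2 (n1 q.1))
        (Params.power_ne_zero _ (n4 q.1) _)).congr fun q _ => ?_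
    exact (hr' q.1).H_eq (n1 q.1) q.2
  · have k1 : ContDiff ℝ ∞ fun q : ℝ × Pt => (δ (θ q.1)).δ₁ := c1.comp contDiff_fst
    have k2 : ContDiff ℝ ∞ fun q : ℝ × Pt => (δ (θ q.1)).δ₂ := c2.comp contDiff_fst
    have k3 : ContDiff ℝ ∞ fun q : ℝ × Pt => (δ (θ q.1)).δ₃ := c3.comp contDiff_fst
    have k4 : ContDiff ℝ ∞ fun q : ℝ × Pt => (δ (θ q.1)).δ₄ := c4.comp contDiff_fst
    simp only [Params.map]
    exact ((((k1.pow 2).mul (by fun_prop)).add k2).prodMk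
      (((k1.mul (by fun_prop)).add k3).prodMk (k4.mul (by fun_prop)))).contDiffOn
  · exact fun s p => ha s p

/-- The explicit form is used: every equation is the full image of some equation under admissible
parameters, and the inverse parameters take it back. -/
theorem isEquivalenceTransformation_inv {Φ : Equiv.Perm (Total D)}
    (hD : D = Set.univ ∨ D = Set.Ioi 0)
    (h : ∀ θ, ∃ δ : Params, δ.Admissible D ∧ ActsBy δ Φ θ) :
    IsEquivalenceTransformation Φ⁻¹ := by
  refine isEquivalenceTransformation_of_actsBy fun θ' => ?_
  obtain ⟨θ, δ, hδ, ha, hr⟩ := ActsBy.exists_source h θ'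
  exact ⟨δ.inv, hδ.inv hD, ha.inv hδ.1 hr⟩

theorem DependsSmoothly.mul {Φ Φ' : Equiv.Perm (Total D)} (h' : DependsSmoothly Φ')
    (h : DependsSmoothly Φ) : DependsSmoothly (Φ' * Φ) := by
  intro θ hθ
  obtain ⟨θ₁, f, hθ₁, hf, ha⟩ := h θ hθ
  obtain ⟨θ₂, g, hθ₂, hg, hb⟩ := h' θ₁ hθ₁
  have happ : ∀ (s : ℝ) (p : (θ s).dom), ∃ q : (θ₁ s).dom, (q : Pt) = f (s, p) ∧
      Φ ⟨θ s, p⟩ = ⟨θ₁ s, q⟩ := by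
    intro s p
    obtain ⟨h1, h2⟩ := ha s p
    generalize Φ ⟨θ s, p⟩ = a at h1 h2 ⊢
    obtain ⟨θ₀, q⟩ := a
    subst h1
    exact ⟨q, h2, rfl⟩
  refine ⟨θ₂, fun q => g (q.1, f q), hθ₂, ?_, fun s p => ?_⟩
  · refine hg.comp (contDiff_fst.contDiffOn.prodMk hf) fun q hq => ?_
    obtain ⟨r, hr, -⟩ := happ q.1 ⟨q.2, hq⟩
    change f (q.1, q.2) ∈ (θ₁ q.1).dom
    rw [← hr]
    exact r.2
  · obtain ⟨q, hq, hΦ⟩ := happ s p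
    change _ ∧ _ = g (s, f (s, p))
    rw [Equiv.Perm.mul_apply, hΦ, ← hq]
    exact hb s q

theorem dependsSmoothly_one : DependsSmoothly (1 : Equiv.Perm (Total D)) :=
  fun θ hθ => ⟨θ, fun q => q.2, hθ, contDiff_snd.contDiffOn, fun _ _ => ⟨rfl, rfl⟩⟩

/-! ### Group structures -/

/-- The usual equivalence group as a subgroup. -/
def usualSubgroup (hD : D = Set.univ ∨ D = Set.Ioi 0) : Subgroup (Equiv.Perm (Total D)) where
  carrier := usualEquivGroup D
  mul_mem' := by
    intro Φ' Φ h' h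
    rw [mem_usualEquivGroup_iff hD] at h h' ⊢
    obtain ⟨δ', hδ', ha'⟩ := h'
    obtain ⟨δ, hδ, ha⟩ := h
    exact ⟨δ'.comp δ, hδ'.comp hδ, fun θ => (ha θ).mul fun θ' _ => ha' θ'⟩
  one_mem' := (mem_usualEquivGroup_iff hD _).mpr
    ⟨Params.one, Params.admissible_one, ActsBy.one⟩
  inv_mem' := by
    intro Φ h
    rw [mem_usualEquivGroup_iff hD] at h ⊢
    obtain ⟨δ, hδ, ha⟩ := h
    refine ⟨δ.inv, hδ.inv hD, fun θ' => ?_⟩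
    have hr := (δ.inv.related_act (hδ.inv hD) θ').inv (hδ.inv hD).1
    rw [δ.inv_inv hδ.1] at hr
    exact (ha _).inv hδ.1 hr

theorem inv_mem_genExtEquivGroup (hD : D = Set.univ ∨ D = Set.Ioi 0) {Φ : Equiv.Perm (Total D)}
    (h : Φ ∈ genExtEquivGroup D) : Φ⁻¹ ∈ genExtEquivGroup D := by
  obtain ⟨hE, hS, hS'⟩ := h
  refine ⟨isEquivalenceTransformation_inv hD (exists_actsBy_of_mem_genExtEquivGroup hD hE hS),
    hS', ?_⟩
  rwa [inv_inv]

/-- The generalized extended equivalence group as a subgroup. -/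
def genExtSubgroup (hD : D = Set.univ ∨ D = Set.Ioi 0) : Subgroup (Equiv.Perm (Total D)) where
  carrier := genExtEquivGroup D
  mul_mem' := by
    rintro Φ' Φ ⟨hE', hS', hI'⟩ ⟨hE, hS, hI⟩
    refine ⟨isEquivalenceTransformation_of_actsBy fun θ => ?_, hS'.mul hS, ?_⟩
    · obtain ⟨δ, hδ, ha⟩ := exists_actsBy_of_mem_genExtEquivGroup hD hE hS θ
      obtain ⟨δ', hδ', ha'⟩ :=
        exists_actsBy_of_mem_genExtEquivGroup hD hE' hS' (δ.act hδ θ)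
      refine ⟨δ'.comp δ, hδ'.comp hδ, ha.mul fun θ' hr => ?_⟩
      rwa [hr.unique (δ.related_act hδ θ) (left_ne_zero_of_mul hδ.1)]
    · rw [mul_inv_rev]
      exact hI.mul hI'
  one_mem' := by
    refine ⟨isEquivalenceTransformation_of_actsBy fun θ =>
      ⟨Params.one, Params.admissible_one, ActsBy.one θ⟩, dependsSmoothly_one, ?_⟩
    rw [inv_one]
    exact dependsSmoothly_one
  inv_mem' := inv_mem_genExtEquivGroup hD

theorem mem_genExtEquivGroup_iff (hD : D = Set.univ ∨ D = Set.Ioi 0) (Φ : Equiv.Perm (Total D)) :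
    Φ ∈ genExtEquivGroup D ↔ IsGivenByFormulas Φ ∧ IsGivenByFormulas Φ⁻¹ := by
  constructor
  · intro h
    have h' := inv_mem_genExtEquivGroup hD h
    exact ⟨isGivenByFormulas_of_mem hD h.1 h.2.1, isGivenByFormulas_of_mem hD h'.1 h'.2.1⟩
  · rintro ⟨h, h'⟩
    exact ⟨isEquivalenceTransformation_of_actsBy h.exists_actsBy, h.dependsSmoothly,
      h'.dependsSmoothly⟩

theorem isGivenByFormulas_of_mem_usualEquivGroup (hD : D = Set.univ ∨ D = Set.Ioi 0)
    {Ψ : Equiv.Perm (Total D)} (h : Ψ ∈ usualEquivGroup D) : IsGivenByFormulas Ψ := by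
  obtain ⟨δ, hδ, ha⟩ := (mem_usualEquivGroup_iff hD Ψ).mp h
  exact ⟨fun _ => δ, fun θ => ⟨hδ, ha θ⟩,
    fun _ _ => ⟨contDiff_const, contDiff_const, contDiff_const, contDiff_const⟩⟩

theorem usualEquivGroup_subset (hD : D = Set.univ ∨ D = Set.Ioi 0) :
    usualEquivGroup D ⊆ genExtEquivGroup D := fun _ h =>
  (mem_genExtEquivGroup_iff hD _).mpr ⟨isGivenByFormulas_of_mem_usualEquivGroup hD h,
    isGivenByFormulas_of_mem_usualEquivGroup hD ((usualSubgroup hD).inv_mem h)⟩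

end ImagedClass
end

theorem mainTheorem10 (D : Set ℝ) (hD : D = Set.univ ∨ D = Set.Ioi 0) :
    -- the two sets of transformations are groups
    (∃ G K : Subgroup (Equiv.Perm (ImagedClass.Total D)),
      (G : Set (Equiv.Perm (ImagedClass.Total D))) = ImagedClass.usualEquivGroup D ∧
      (K : Set (Equiv.Perm (ImagedClass.Total D))) = ImagedClass.genExtEquivGroup D) ∧
    -- the usual group is formed by the transformations of the given form, with constant parameters
    (∀ Ψ : Equiv.Perm (ImagedClass.Total D), Ψ ∈ ImagedClass.usualEquivGroup D ↔
      ∃ δ : ImagedClass.Params, δ.Admissible D ∧ ∀ θ, ImagedClass.ActsBy δ Ψ θ) ∧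
    -- all admissible values of the parameters occur
    (∀ δ : ImagedClass.Params, δ.Admissible D →
      ∃! Ψ : Equiv.Perm (ImagedClass.Total D), ∀ θ, ImagedClass.ActsBy δ Ψ θ) ∧
    -- the generalized extended group coincides with the usual one: it contains the usual group,
    -- and on each equation each of its elements acts as an element of the usual group
    ImagedClass.usualEquivGroup D ⊆ ImagedClass.genExtEquivGroup D ∧
    (∀ Φ ∈ ImagedClass.genExtEquivGroup D, ∀ θ : ImagedClass.Eqn D,
      ∃ Ψ ∈ ImagedClass.usualEquivGroup D, ∀ p : θ.dom, Φ ⟨θ, p⟩ = Ψ ⟨θ, p⟩) ∧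
    -- so it is formed by the transformations of the same form, where the values of the
    -- parameters are chosen for each equation
    (∀ Φ : Equiv.Perm (ImagedClass.Total D), Φ ∈ ImagedClass.genExtEquivGroup D ↔
      ImagedClass.IsGivenByFormulas Φ ∧ ImagedClass.IsGivenByFormulas Φ⁻¹) := by
  refine ⟨⟨ImagedClass.usualSubgroup hD, ImagedClass.genExtSubgroup hD, rfl, rfl⟩,
    ImagedClass.mem_usualEquivGroup_iff hD, fun δ hδ => ?_, ImagedClass.usualEquivGroup_subset hD,
    fun Φ hΦ θ => ?_, ImagedClass.mem_genExtEquivGroup_iff hD⟩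
  · refine ⟨δ.perm hD hδ, δ.actsBy_perm hD hδ, fun Ψ hΨ => Equiv.ext fun ⟨θ, p⟩ => ?_⟩
    exact (hΨ θ).apply_eq (δ.actsBy_perm hD hδ θ) (left_ne_zero_of_mul hδ.1) p
  · obtain ⟨δ, hδ, ha⟩ :=
      ImagedClass.exists_actsBy_of_mem_genExtEquivGroup hD hΦ.1 hΦ.2.1 θ
    exact ⟨δ.perm hD hδ, ImagedClass.mem_usualEquivGroup_of_actsBy hD hδ (δ.actsBy_perm hD hδ),
      ha.apply_eq (δ.actsBy_perm hD hδ θ) (left_ne_zero_of_mul hδ.1)⟩
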